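/- Let $m\ge 1$ be an integer, $s\in(0,1]$, $p\in[1,\infty)$, and let $\mathcal M$ be a nonempty $m$-dimensional smooth Riemannian manifold (without boundary) which is either compact or (isometric to) the Euclidean space $\mathbb R^m$, with geodesic distance $d_{\mathcal M}$ and Riemannian volume. Let $\pi:\mathbb R\to\mathbb S^1$, $\pi(t)=(\cos t,\sin t)$, and let $\mathbb B^m$ be the open unit ball of $\mathbb R^m$. Let $X$ be $\mathcal M$ or $\mathbb B^m$ and let $\mathcal N$ be $\mathbb R$ or $\mathbb S^1\subset\mathbb R^2$, with its geodesic distance $d_{\mathcal N}$. For a measurable map $f:X\to\mathcal N$ and $\sigma\in(0,1)$, $q\ge1$, put $$\mathcal E_{\sigma,q}(f,X)=\int_X\int_X\frac{d_{\mathcal N}(f(x),f(y))^q}{d_X(x,y)^{m+\sigma q}}\,\mathrm dx\,\mathrm dy ,$$ where $d_X(x,y)=\infty$, so that the integrand is $0$, if $x,y$ lie in different components. For every real $q>0$ put $\mathcal E_{1,q}(f,X)=\int_X|Df|^q$ if $f$ is weakly differentiable (that is, $f$ is locally integrable and has a locally integrable weak derivative $Df$), and $\mathcal E_{1,q}(f,X)=\infty$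 otherwise. Let $W^{\sigma,q}(X,\mathcal N)$ be the set of measurable $f:X\to\mathcal N$ with $\mathcal E_{\sigma,q}(f,X)<\infty$, for $\sigma\in(0,1)$, $q\ge 1$ and for $\sigma=1$, $q>0$. **Theorem.** Suppose that for every $u\in W^{s,p}(\mathcal M,\mathbb S^1)$ there is $\varphi\in W^{s,p}(\mathcal M,\mathbb R)+W^{1,sp}(\mathcal M,\mathbb R)$ such that $u=\pi\circ\varphi$ almost everywhere in $\mathcal M$. Then there is a constant $C>0$ such that for every $u\in W^{s,p}(\mathbb B^m,\mathbb S^1)$, if either $sp<m$ or $\mathcal E_{s,p}(u,\mathbb B^m)\le 1/C$, then there exist $\varphi_1\in W^{s,p}(\mathbb B^m,\mathbb R)$ and $\varphi_2\in W^{1,sp}(\mathbb B^m,\mathbb R)$ such that $u=\pi\circ(\varphi_1+\varphi_2)$ on $\mathbb B^m$ and $$\mathcal E_{s,p}(\varphi_1,\mathbb B^m)+\mathcal E_{1,sp}(\varphi_2,\mathbb B^m)\le C\,\mathcal E_{s,p}(u,\mathbb B^m).$$ -/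

import Mathlib

open MeasureTheory Bundle Manifold
open scoped ENNReal ContDiff

noncomputable section

namespace WeakLifting

/-- Geodesic distance on the unit circle `𝕊¹ ⊂ ℂ = ℝ²`: the unoriented angle between two points. -/
def circleDist (z w : Circle) : ℝ≥0∞ :=
  ENNReal.ofReal (InnerProductGeometry.angle (z : ℂ) (w : ℂ))

/-- The Gagliardo energy
`∫ ∫ d (u x) (u y) ^ p / dist x y ^ (m + s p) dμ(y) dμ(x)`
of a map from an `m`-dimensional space `X` to a space `N` with distance `d`.
Points of `X` at infinite distance (in different components) do not interact. -/
def gagliardoEnergy {X N : Type*} [EMetricSpace X] [MeasurableSpace X] (d : N → N → ℝ≥0∞)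
    (m : ℕ) (s p : ℝ) (μ : Measure X) (u : X → N) : ℝ≥0∞ :=
  ∫⁻ x, ∫⁻ y, d (u x) (u y) ^ p / edist x y ^ ((m : ℝ) + s * p) ∂μ ∂μ

section Euclidean

variable {m : ℕ} {F : Type*} [NormedAddCommGroup F] [NormedSpace ℝ F]

/-- `f` is weakly differentiable on the open set `Ω ⊆ ℝᵐ` with weak derivative `f'`:
both are locally integrable on `Ω`, and one can integrate by parts against all smooth
functions with compact support in `Ω`. -/
structure HasWeakFDerivOn (Ω : Set (EuclideanSpace ℝ (Fin m)))
    (f : EuclideanSpace ℝ (Fin m) → F)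
    (f' : EuclideanSpace ℝ (Fin m) → EuclideanSpace ℝ (Fin m) →L[ℝ] F) : Prop where
  locallyIntegrableOn : LocallyIntegrableOn f Ω volume
  locallyIntegrableOn_deriv : LocallyIntegrableOn f' Ω volume
  integral_eq : ∀ ψ : EuclideanSpace ℝ (Fin m) → ℝ, ContDiff ℝ ∞ ψ → HasCompactSupport ψ →
    tsupport ψ ⊆ Ω → ∀ v : EuclideanSpace ℝ (Fin m),
      ∫ x in Ω, fderiv ℝ ψ x v • f x = -∫ x in Ω, ψ x • f' x v

/-- The energy `∫_Ω |Df| ^ q` on an open set `Ω ⊆ ℝᵐ`, equal to `∞` if `f` is not weakly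
differentiable on `Ω`. (The weak derivative is unique almost everywhere, so that the infimum is
over a single value.) -/
def dirichletEnergyOn (Ω : Set (EuclideanSpace ℝ (Fin m))) (q : ℝ)
    (f : EuclideanSpace ℝ (Fin m) → F) : ℝ≥0∞ :=
  ⨅ (f' : EuclideanSpace ℝ (Fin m) → EuclideanSpace ℝ (Fin m) →L[ℝ] F)
    (_ : HasWeakFDerivOn Ω f f'), ∫⁻ x in Ω, ENNReal.ofReal ‖f' x‖ ^ q

/-- The Sobolev energy `ℰ_{s,p}(φ, Ω)` of a real-valued function on an open set `Ω ⊆ ℝᵐ`. -/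
def realEnergyOn (Ω : Set (EuclideanSpace ℝ (Fin m))) (s p : ℝ)
    (φ : EuclideanSpace ℝ (Fin m) → ℝ) : ℝ≥0∞ :=
  if s = 1 then dirichletEnergyOn Ω p φ
  else gagliardoEnergy edist m s p (volume.restrict Ω) φ

/-- The Sobolev energy `ℰ_{s,p}(u, Ω)` of a circle-valued map on an open set `Ω ⊆ ℝᵐ`. -/
def circleEnergyOn (Ω : Set (EuclideanSpace ℝ (Fin m))) (s p : ℝ)
    (u : EuclideanSpace ℝ (Fin m) → Circle) : ℝ≥0∞ :=
  if s = 1 then dirichletEnergyOn Ω p (fun x => (u x : ℂ))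
  else gagliardoEnergy circleDist m s p (volume.restrict Ω) u

/-- `φ ∈ W^{s,p}(Ω, ℝ)`. -/
def MemRealSobolevOn (Ω : Set (EuclideanSpace ℝ (Fin m))) (s p : ℝ)
    (φ : EuclideanSpace ℝ (Fin m) → ℝ) : Prop :=
  AEMeasurable φ (volume.restrict Ω) ∧ realEnergyOn Ω s p φ < ⊤

/-- `u ∈ W^{s,p}(Ω, 𝕊¹)`. -/
def MemCircleSobolevOn (Ω : Set (EuclideanSpace ℝ (Fin m))) (s p : ℝ)
    (u : EuclideanSpace ℝ (Fin m) → Circle) : Prop :=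
  AEMeasurable (fun x => (u x : ℂ)) (volume.restrict Ω) ∧ circleEnergyOn Ω s p u < ⊤

end Euclidean

section Riemannian

/-! On an `m`-dimensional Riemannian manifold, `edist` is the geodesic distance and the Riemannian
volume is the `m`-dimensional Hausdorff measure `μHE[m]` of the geodesic distance, normalized so
that it is the Lebesgue measure on `ℝᵐ`. -/

variable (m : ℕ) {M : Type*} [EMetricSpace M] [MeasurableSpace M] [BorelSpace M]
  [ChartedSpace (EuclideanSpace ℝ (Fin m)) M] [IsManifold (𝓡 m) ∞ M]
  [RiemannianBundle (fun x : M => TangentSpace (𝓡 m) x)]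
  {F : Type*} [NormedAddCommGroup F] [NormedSpace ℝ F]

/-- `f : M → F` is weakly differentiable with weak derivative `f' x : T_x M → F`:
in each chart, with inverse `κ`, the function `f ∘ κ` has the weak derivative
`y ↦ f' (κ y) ∘ Dκ(y)`. -/
def HasWeakMFDeriv (f : M → F) (f' : (x : M) → TangentSpace (𝓡 m) x →L[ℝ] F) : Prop :=
  ∀ x₀ : M, HasWeakFDerivOn (extChartAt (𝓡 m) x₀).target
    (fun y => f ((extChartAt (𝓡 m) x₀).symm y))
    (fun y => (f' ((extChartAt (𝓡 m) x₀).symm y)).comp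
      (mfderiv 𝓘(ℝ, EuclideanSpace ℝ (Fin m)) (𝓡 m) (extChartAt (𝓡 m) x₀).symm y))

/-- The energy `∫_M |Df| ^ q` on a Riemannian manifold, equal to `∞` if `f` is not weakly
differentiable; `|Df(x)|` is the norm with respect to the Riemannian metric on `T_x M`. -/
def dirichletEnergy (q : ℝ) (f : M → F) : ℝ≥0∞ :=
  ⨅ (f' : (x : M) → TangentSpace (𝓡 m) x →L[ℝ] F) (_ : HasWeakMFDeriv m f f'),
    ∫⁻ x, ENNReal.ofReal ‖f' x‖ ^ q ∂(μHE[m])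

/-- The Sobolev energy `ℰ_{s,p}(φ, M)` of a real-valued function on a Riemannian manifold. -/
def realEnergy (s p : ℝ) (φ : M → ℝ) : ℝ≥0∞ :=
  if s = 1 then dirichletEnergy m p φ else gagliardoEnergy edist m s p μHE[m] φ

/-- The Sobolev energy `ℰ_{s,p}(u, M)` of a circle-valued map on a Riemannian manifold. -/
def circleEnergy (s p : ℝ) (u : M → Circle) : ℝ≥0∞ :=
  if s = 1 then dirichletEnergy m p (fun x => (u x : ℂ))
  else gagliardoEnergy circleDist m s p μHE[m] u

/-- `φ ∈ W^{s,p}(M, ℝ)`. -/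
def MemRealSobolev (s p : ℝ) (φ : M → ℝ) : Prop :=
  AEMeasurable φ μHE[m] ∧ realEnergy m s p φ < ⊤

/-- `u ∈ W^{s,p}(M, 𝕊¹)`. -/
def MemCircleSobolev (s p : ℝ) (u : M → Circle) : Prop :=
  AEMeasurable (fun x => (u x : ℂ)) μHE[m] ∧ circleEnergy m s p u < ⊤

end Riemannian

end WeakLifting

end

open MeasureTheory Bundle Manifold
open scoped ENNReal ContDiff

noncomputable section

namespace WeakLifting

open Set Metric Filter Topology
open scoped NNReal

/-! ### Chordal and geodesic distance on the circle. -/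

section Circle

/-! For `s = 1` the estimate is free: if `u = exp (i φ)` with `φ` weakly differentiable, then `|Dφ|
= |Du|`, so `C = 1` works and only the existence of a lifting has to be carried from the manifold to
the ball. A map on the ball cannot be transplanted as it is, since it need not be constant near the
boundary. It is first composed with an opening map, the identity near a centre `a` and constant far
from it; averaging over `a` shows that weak differentiability and finite energy survive for almost
every centre (`HasWeakFDerivOn.exists_openingMap`). The opened map is transplanted by a bi-Lipschitz
chart, lifted there and pulled back, which lifts `u` on each smaller concentric ball
(`HasWeakFDerivOn.exists_local_lifting`). Two weakly differentiable liftings of the same map differ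
by a constant, so these local liftings glue (`HasWeakFDerivOn.exists_lifting_of_local`).

For `s < 1` the linear estimate is a nonlinear uniform boundedness principle
(`exists_linear_lifting_estimate`). If it fails, there are maps `u n` all of whose liftings cost at
least `2 ^ n` times the energy of `u n`. A copy at scale `a` has its energy multiplied by `a ^ (m -
s p)`, which can be brought below `2⁻¹ ^ n` by taking `a` small if `s p < m`, and by the smallness
of the energy otherwise (`exists_rescaled_of_forall_not`). Replacing one copy at scale `a` by `N ^
m` copies at scale `a / N` multiplies the energy by `N ^ (s p)`, so a suitable `N` brings the energy
of generation `n` up to the order of `2⁻¹ ^ n` exactly. All copies are placed in disjoint balls and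
glued to one map of finite energy, which the hypothesis lifts with finite energy. Restricted to the
disjoint balls and scaled back, this lifting lifts every copy, hence costs at least the sum of `2 ^
n * 2⁻¹ ^ n`, which is infinite.

Placing copies side by side requires maps that are constant off a ball, with energy controlled
linearly by the energy on the unit ball. This is `exists_extension`: fold space into the ball by
inversion, then open with a centre chosen by averaging the fractional energy
(`exists_gagliardoEnergy_openingMap_le`). Gluing costs a factor `2 ^ (p - 1)` (`exists_glue`), and
the energy of the lifting is superadditive over disjoint sets (`tsum_gagliardoEnergy_restrict_le`,
`tsum_dirichletEnergyOn_le`). These pieces meet in `LipschitzChart.exists_lifting_of_packing`. Maps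
of zero energy are constant and are treated apart. -/

lemma dist_sq_eq_two_sub_cos_angle (z w : Circle) :
    dist z w ^ 2 = 2 - 2 * Real.cos (InnerProductGeometry.angle (z : ℂ) (w : ℂ)) := by
  have h : dist z w = ‖(z : ℂ) - w‖ := by rw [← dist_eq_norm]; rfl
  have := InnerProductGeometry.norm_sub_sq_eq_norm_sq_add_norm_sq_sub_two_mul_norm_mul_norm_mul_cos_angle
    (z : ℂ) (w : ℂ)
  simp only [Circle.norm_coe] at this
  rw [h, sq, this]
  ring

/-- Squaring reduces chord against arc to `1 - x² / 2 ≤ cos x`. -/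
lemma edist_le_circleDist (z w : Circle) : edist z w ≤ circleDist z w := by
  rw [edist_dist, circleDist]
  refine ENNReal.ofReal_le_ofReal (abs_le_of_sq_le_sq' ?_
    (InnerProductGeometry.angle_nonneg _ _)).2
  rw [dist_sq_eq_two_sub_cos_angle]
  have := Real.one_sub_sq_div_two_le_cos (x := InnerProductGeometry.angle (z : ℂ) (w : ℂ))
  linarith

/-- Squaring reduces this to `cos x ≤ 1 - 2 x² / π²` on `[-π, π]`. Together with the previous bound,
it lets the whole argument run with the chordal distance, for which the circle is a metric space. -/
lemma circleDist_le_edist (z w : Circle) :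
    circleDist z w ≤ ENNReal.ofReal (Real.pi / 2) * edist z w := by
  rw [edist_dist, circleDist, ← ENNReal.ofReal_mul (by positivity)]
  refine ENNReal.ofReal_le_ofReal (abs_le_of_sq_le_sq' ?_ (by positivity)).2
  rw [mul_pow, dist_sq_eq_two_sub_cos_angle]
  have := Real.cos_le_one_sub_mul_cos_sq (x := InnerProductGeometry.angle (z : ℂ) (w : ℂ)) (by
    rw [abs_of_nonneg (InnerProductGeometry.angle_nonneg _ _)]
    exact InnerProductGeometry.angle_le_pi _ _)
  have hpi := Real.pi_pos
  calc InnerProductGeometry.angle (z : ℂ) (w : ℂ) ^ 2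
      = (Real.pi / 2) ^ 2 * (2 - 2 * (1 - 2 / Real.pi ^ 2 *
          InnerProductGeometry.angle (z : ℂ) (w : ℂ) ^ 2)) := by field_simp; ring
    _ ≤ _ := by gcongr

end Circle

/-! ### Gagliardo energies: comparison and change of variables. -/

section Gagliardo

variable {X Y N : Type*} [EMetricSpace X] [MeasurableSpace X] 
  [EMetricSpace Y] [MeasurableSpace Y] 

lemma gagliardoEnergy_mono_dist {d d' : N → N → ℝ≥0∞} {m : ℕ} {s p : ℝ} (hp : 0 ≤ p)
    {μ : Measure X} {c : ℝ≥0∞} (hc : c ≠ ⊤) (h : ∀ a b, d a b ≤ c * d' a b) (u : X → N) :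
    gagliardoEnergy d m s p μ u ≤ c ^ p * gagliardoEnergy d' m s p μ u := by
  have hc' : c ^ p ≠ ⊤ := ENNReal.rpow_ne_top_of_nonneg hp hc
  simp only [gagliardoEnergy]
  rw [← lintegral_const_mul' _ _ hc']
  refine lintegral_mono fun x => ?_
  rw [← lintegral_const_mul' _ _ hc']
  refine lintegral_mono fun y => ?_
  rw [← mul_div_assoc, ← ENNReal.mul_rpow_of_nonneg _ _ hp]
  gcongr
  exact h _ _

lemma gagliardoEnergy_congr {d : N → N → ℝ≥0∞} {m : ℕ} {s p : ℝ} {μ : Measure X} {u v : X → N}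
    (h : u =ᵐ[μ] v) : gagliardoEnergy d m s p μ u = gagliardoEnergy d m s p μ v := by
  refine lintegral_congr_ae ?_
  filter_upwards [h] with x hx
  refine lintegral_congr_ae ?_
  filter_upwards [h] with y hy
  rw [hx, hy]

lemma gagliardoEnergy_mono_measure {d : N → N → ℝ≥0∞} {m : ℕ} {s p : ℝ} {μ ν : Measure X}
    (h : μ ≤ ν) (u : X → N) : gagliardoEnergy d m s p μ u ≤ gagliardoEnergy d m s p ν u :=
  (lintegral_mono fun _ => lintegral_mono' h le_rfl).trans (lintegral_mono' h le_rfl)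

/-- The Gagliardo energy only depends on the distances between the values. -/
lemma gagliardoEnergy_congr_dist {N' : Type*} {d : N → N → ℝ≥0∞} {d' : N' → N' → ℝ≥0∞} {m : ℕ}
    {s p : ℝ} {μ : Measure X} {u : X → N} {v : X → N'}
    (h : ∀ x y, d (u x) (u y) = d' (v x) (v y)) :
    gagliardoEnergy d m s p μ u = gagliardoEnergy d' m s p μ v := by
  simp only [gagliardoEnergy, h]

/-- The bound on the pushforward is used once in each variable, whence the factor `K * K`. -/
lemma lintegral_lintegral_comp_le {X Y : Type*} [MeasurableSpace X] [MeasurableSpace Y]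
    {μ : Measure X} {ν : Measure Y} [SFinite ν] {Ψ : X → Y} {K : ℝ≥0∞}
    (hΨ : AEMeasurable Ψ μ) (hmap : μ.map Ψ ≤ K • ν) {F : Y → Y → ℝ≥0∞}
    (hF : Measurable (Function.uncurry F)) :
    ∫⁻ x, ∫⁻ y, F (Ψ x) (Ψ y) ∂μ ∂μ ≤ K * K * ∫⁻ x, ∫⁻ y, F x y ∂ν ∂ν := by
  have h1 : ∀ x, ∫⁻ y, F (Ψ x) (Ψ y) ∂μ ≤ K * ∫⁻ y, F (Ψ x) y ∂ν := by
    intro x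
    rw [← lintegral_map' (f := fun y => F (Ψ x) y)
      (hF.comp (measurable_const.prodMk measurable_id)).aemeasurable hΨ, ← smul_eq_mul, ← lintegral_smul_measure]
    exact lintegral_mono' hmap le_rfl
  have hmeas : Measurable fun x => ∫⁻ y, F x y ∂ν := hF.lintegral_prod_right'
  calc _ ≤ ∫⁻ x, K * ∫⁻ y, F (Ψ x) y ∂ν ∂μ := lintegral_mono h1
    _ = ∫⁻ x, K * ∫⁻ y, F x y ∂ν ∂(μ.map Ψ) := by
        rw [lintegral_map' (hmeas.const_mul K).aemeasurable hΨ]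
    _ ≤ ∫⁻ x, K * ∫⁻ y, F x y ∂ν ∂(K • ν) := lintegral_mono' hmap le_rfl
    _ = _ := by rw [lintegral_smul_measure, lintegral_const_mul _ hmeas, smul_eq_mul, mul_assoc]

variable [OpensMeasurableSpace Y] [SecondCountableTopology Y] [EMetricSpace N] [MeasurableSpace N]
  [OpensMeasurableSpace N] [SecondCountableTopology N]

lemma measurable_gagliardo_integrand {s p : ℝ} (m : ℕ) {u : Y → N} (hu : Measurable u) :
    Measurable (Function.uncurry fun x y : Y =>
      edist (u x) (u y) ^ p / edist x y ^ ((m : ℝ) + s * p)) := by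
  unfold Function.uncurry
  have h1 : Measurable fun q : Y × Y => edist (u q.1) (u q.2) :=
    (hu.comp measurable_fst).edist (hu.comp measurable_snd)
  have h2 : Measurable fun q : Y × Y => edist q.1 q.2 := measurable_edist
  exact (h1.pow_const p).div (h2.pow_const _)

/-- Change of variables in a Gagliardo energy by a Lipschitz map that compresses volumes by a
bounded factor. -/
lemma gagliardoEnergy_comp_le {μ : Measure X} {ν : Measure Y} [SFinite ν] {Ψ : X → Y}
    {K : ℝ≥0∞} {L : ℝ≥0∞} (hL : L ≠ ⊤) {m : ℕ} {s p : ℝ} (hs : 0 ≤ s) (hp : 0 < p)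
    (hΨ : AEMeasurable Ψ μ) (hmap : μ.map Ψ ≤ K • ν)
    (hlip : ∀ᵐ x ∂μ, ∀ᵐ y ∂μ, edist (Ψ x) (Ψ y) ≤ L * edist x y)
    {u : Y → N} (hu : AEMeasurable u ν) :
    gagliardoEnergy edist m s p μ (u ∘ Ψ) ≤
      L ^ ((m : ℝ) + s * p) * (K * K) * gagliardoEnergy edist m s p ν u := by
  have hsp : 0 ≤ (m : ℝ) + s * p := by positivity
  have hL' : L ^ ((m : ℝ) + s * p) ≠ ⊤ := ENNReal.rpow_ne_top_of_nonneg hsp hL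
  have hac : μ.map Ψ ≪ ν := (Measure.absolutelyContinuous_of_le hmap).trans
    Measure.smul_absolutelyContinuous
  have hcongr : u ∘ Ψ =ᵐ[μ] hu.mk u ∘ Ψ :=
    ae_of_ae_map hΨ (hac hu.ae_eq_mk)
  rw [gagliardoEnergy_congr hcongr, gagliardoEnergy_congr hu.ae_eq_mk, mul_assoc]
  refine le_trans ?_ (mul_le_mul' le_rfl
    (lintegral_lintegral_comp_le hΨ hmap (measurable_gagliardo_integrand m hu.measurable_mk)))
  simp only [gagliardoEnergy]
  rw [← lintegral_const_mul' _ _ hL']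
  refine lintegral_mono_ae ?_
  filter_upwards [hlip] with x hx
  rw [← lintegral_const_mul' _ _ hL']
  refine lintegral_mono_ae ?_
  filter_upwards [hx] with y hxy
  simp only [Function.comp_apply]
  set u' := hu.mk u
  have h2 : edist (Ψ x) (Ψ y) ^ ((m : ℝ) + s * p) ≤
      L ^ ((m : ℝ) + s * p) * edist x y ^ ((m : ℝ) + s * p) := by
    rw [← ENNReal.mul_rpow_of_nonneg _ _ hsp]
    gcongr
  -- If the values agree, the quotient vanishes even on the diagonal. Otherwise `Ψ x ≠ Ψ y`, so the
  -- denominator is nonzero and division can be undone.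
  rcases eq_or_ne (edist (u' (Ψ x)) (u' (Ψ y))) 0 with h0 | h0
  · rw [h0, ENNReal.zero_rpow_of_pos hp]; simp
  have hne : edist (Ψ x) (Ψ y) ^ ((m : ℝ) + s * p) ≠ 0 := by
    have : edist (Ψ x) (Ψ y) ≠ 0 := by
      intro h
      rw [edist_eq_zero.1 h, edist_self] at h0
      exact h0 rfl
    simp [ENNReal.rpow_eq_zero_iff, this, hsp.not_gt]
  -- Images in different components force `x` and `y` into different components, because `L` is
  -- finite; then the left integrand is zero.
  rcases eq_or_ne (edist (Ψ x) (Ψ y) ^ ((m : ℝ) + s * p)) ⊤ with htop | htop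
  · have : edist x y ^ ((m : ℝ) + s * p) = ⊤ := by
      rw [htop, top_le_iff] at h2
      by_contra h
      exact ENNReal.mul_ne_top hL' h h2
    rw [this, ENNReal.div_top]
    exact zero_le
  refine ENNReal.div_le_of_le_mul ?_
  calc edist (u' (Ψ x)) (u' (Ψ y)) ^ p
      = edist (u' (Ψ x)) (u' (Ψ y)) ^ p / edist (Ψ x) (Ψ y) ^ ((m : ℝ) + s * p) *
          edist (Ψ x) (Ψ y) ^ ((m : ℝ) + s * p) := (ENNReal.div_mul_cancel hne htop).symm
    _ ≤ edist (u' (Ψ x)) (u' (Ψ y)) ^ p / edist (Ψ x) (Ψ y) ^ ((m : ℝ) + s * p) *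
          (L ^ ((m : ℝ) + s * p) * edist x y ^ ((m : ℝ) + s * p)) := by gcongr
    _ = _ := by ring

end Gagliardo

/-! ### Mollification in `L¹`. -/

section
open scoped Convolution

section Mollify

variable {m : ℕ} {F : Type*} [NormedAddCommGroup F] [NormedSpace ℝ F]

-- Young's inequality in `L¹`: the mollifier has mass one, and Tonelli with translation invariance
-- does the rest.
open ContinuousLinearMap in
lemma lintegral_enorm_convolution_le [CompleteSpace F]
    (φ : ContDiffBump (0 : EuclideanSpace ℝ (Fin m)))
    {f : EuclideanSpace ℝ (Fin m) → F} (hf : AEStronglyMeasurable f volume) :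
    ∫⁻ x, ‖(φ.normed volume ⋆[lsmul ℝ ℝ, volume] f) x‖ₑ ≤ ∫⁻ x, ‖f x‖ₑ := by
  have hφ : ∫⁻ t, ‖φ.normed volume t‖ₑ = 1 := by
    have h1 := φ.integral_normed (μ := volume)
    have h2 := ofReal_integral_eq_lintegral_ofReal (φ.integrable_normed (μ := volume))
      (ae_of_all _ fun x => φ.nonneg_normed x)
    rw [h1] at h2
    simp only [ENNReal.ofReal_one] at h2
    rw [h2]
    refine lintegral_congr fun t => ?_
    rw [Real.enorm_eq_ofReal (φ.nonneg_normed t)]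
  have hmeas : AEMeasurable (Function.uncurry fun x t : EuclideanSpace ℝ (Fin m) =>
      ‖φ.normed volume t‖ₑ * ‖f (x - t)‖ₑ) (volume.prod volume) := by
    have h1 : AEStronglyMeasurable (fun q : EuclideanSpace ℝ (Fin m) × EuclideanSpace ℝ (Fin m) =>
        f (q.1 - q.2)) (volume.prod volume) :=
      hf.comp_quasiMeasurePreserving (quasiMeasurePreserving_sub volume volume)
    have h2 : Measurable (φ.normed volume) := φ.continuous_normed.measurable
    exact ((h2.comp measurable_snd).enorm.aemeasurable).mul h1.enorm
  calc ∫⁻ x, ‖(φ.normed volume ⋆[lsmul ℝ ℝ, volume] f) x‖ₑ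
      ≤ ∫⁻ x, ∫⁻ t, ‖φ.normed volume t‖ₑ * ‖f (x - t)‖ₑ := by
        refine lintegral_mono fun x => ?_
        rw [convolution_def]
        refine (enorm_integral_le_lintegral_enorm _).trans (lintegral_mono fun t => ?_)
        simp [enorm_smul]
    _ = ∫⁻ t, ∫⁻ x, ‖φ.normed volume t‖ₑ * ‖f (x - t)‖ₑ := lintegral_lintegral_swap hmeas
    _ = ∫⁻ t, ‖φ.normed volume t‖ₑ * ∫⁻ x, ‖f x‖ₑ := by
        refine lintegral_congr fun t => ?_
        rw [lintegral_const_mul' _ _ enorm_ne_top, lintegral_sub_right_eq_self (fun x => ‖f x‖ₑ)]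
    _ = ∫⁻ x, ‖f x‖ₑ := by
        rw [lintegral_mul_const'' _ (by
          exact (φ.continuous_normed.measurable.enorm).aemeasurable), hφ, one_mul]

-- Density of compactly supported continuous functions: mollification is an `L¹` contraction, and it
-- converges uniformly on a uniformly continuous function, which is convergence in `L¹(K)` because
-- `K` has finite measure. The threshold `δ` does not depend on the shape of the bump, so one bump
-- can later serve a function and its derivative at once.
open ContinuousLinearMap in
lemma exists_forall_lintegral_convolution_sub_le [CompleteSpace F]
    {f : EuclideanSpace ℝ (Fin m) → F} (hf : Integrable f) {K : Set (EuclideanSpace ℝ (Fin m))}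
    (hK : volume K ≠ ⊤) {ε : ℝ≥0∞} (hε : ε ≠ 0) :
    ∃ δ > (0 : ℝ), ∀ φ : ContDiffBump (0 : EuclideanSpace ℝ (Fin m)), φ.rOut < δ →
      ∫⁻ x in K, ‖(φ.normed volume ⋆[lsmul ℝ ℝ, volume] f) x - f x‖ₑ ≤ ε := by
  have hε3 : ε / 3 ≠ 0 := by simp [hε]
  obtain ⟨h, hhc, hfh, hcont, hhi⟩ := hf.exists_hasCompactSupport_lintegral_sub_le hε3
  obtain ⟨η, hη, hηK⟩ : ∃ η > (0 : ℝ), ENNReal.ofReal η * volume K ≤ ε / 3 := by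
    obtain ⟨η, hη0, hη⟩ := ENNReal.exists_nnreal_pos_mul_lt hK hε3
    exact ⟨η, by exact_mod_cast hη0, by simpa using hη.le⟩
  have huc := hhc.uniformContinuous_of_continuous hcont
  obtain ⟨δ, hδ, hδh⟩ := Metric.uniformContinuous_iff.1 huc η hη
  refine ⟨δ, hδ, fun φ hφ => ?_⟩
  -- Three errors of size `ε / 3`: mollifying `f - h`, mollifying `h`, and `h - f` itself.
  have hptw : ∀ x, (φ.normed volume ⋆[lsmul ℝ ℝ, volume] f) x - f x =
      (φ.normed volume ⋆[lsmul ℝ ℝ, volume] (f - h)) x +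
        ((φ.normed volume ⋆[lsmul ℝ ℝ, volume] h) x - h x) + (h x - f x) := by
    intro x
    have e1 : ConvolutionExistsAt (φ.normed volume) (f - h) x (lsmul ℝ ℝ) volume :=
      φ.hasCompactSupport_normed.convolutionExists_left _ φ.continuous_normed
        (hf.sub hhi).locallyIntegrable x
    have e2 : ConvolutionExistsAt (φ.normed volume) h x (lsmul ℝ ℝ) volume :=
      φ.hasCompactSupport_normed.convolutionExists_left _ φ.continuous_normed
        hhi.locallyIntegrable x
    have := e1.distrib_add e2
    rw [sub_add_cancel] at this
    rw [this]
    abel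
  have b1 : ∫⁻ x, ‖(φ.normed volume ⋆[lsmul ℝ ℝ, volume] (f - h)) x‖ₑ ≤ ε / 3 :=
    (lintegral_enorm_convolution_le φ (hf.sub hhi).1).trans hfh
  have b2 : ∫⁻ x in K, ‖(φ.normed volume ⋆[lsmul ℝ ℝ, volume] h) x - h x‖ₑ ≤ ε / 3 := by
    calc _ ≤ ∫⁻ x in K, ENNReal.ofReal η := by
          refine lintegral_mono fun x => ?_
          have := φ.dist_normed_convolution_le (μ := volume) (g := h) (x₀ := x) (ε := η)
            hcont.aestronglyMeasurable (fun y hy => (hδh (lt_trans hy hφ)).le)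
          rw [← edist_eq_enorm_sub, edist_dist]
          exact ENNReal.ofReal_le_ofReal this
      _ ≤ ε / 3 := by simpa using hηK
  have b3 : ∫⁻ x, ‖h x - f x‖ₑ ≤ ε / 3 := by simpa only [enorm_sub_rev] using hfh
  have m1 : Continuous (φ.normed volume ⋆[lsmul ℝ ℝ, volume] (f - h)) :=
    φ.hasCompactSupport_normed.continuous_convolution_left _ φ.continuous_normed
      (hf.sub hhi).locallyIntegrable
  have m2 : Continuous (φ.normed volume ⋆[lsmul ℝ ℝ, volume] h) :=
    φ.hasCompactSupport_normed.continuous_convolution_left _ φ.continuous_normed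
      hhi.locallyIntegrable
  calc _ ≤ ∫⁻ x in K, (‖(φ.normed volume ⋆[lsmul ℝ ℝ, volume] (f - h)) x‖ₑ +
        ‖(φ.normed volume ⋆[lsmul ℝ ℝ, volume] h) x - h x‖ₑ) + ‖h x - f x‖ₑ := by
        refine lintegral_mono fun x => ?_
        rw [hptw]
        exact (enorm_add_le _ _).trans (add_le_add (enorm_add_le _ _) le_rfl)
    _ = (∫⁻ x in K, ‖(φ.normed volume ⋆[lsmul ℝ ℝ, volume] (f - h)) x‖ₑ) +
        (∫⁻ x in K, ‖(φ.normed volume ⋆[lsmul ℝ ℝ, volume] h) x - h x‖ₑ) +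
        ∫⁻ x in K, ‖h x - f x‖ₑ := by
        have c1 : Measurable fun x => ‖(φ.normed volume ⋆[lsmul ℝ ℝ, volume] (f - h)) x‖ₑ :=
          m1.enorm.measurable
        have c2 : Measurable fun x => ‖(φ.normed volume ⋆[lsmul ℝ ℝ, volume] h) x - h x‖ₑ :=
          (m2.sub hcont).enorm.measurable
        rw [lintegral_add_left (f := fun x => _ + _) (c1.add c2), lintegral_add_left c1]
    _ ≤ ε / 3 + ε / 3 + ε / 3 := by
        gcongr
        · exact (setLIntegral_le_lintegral _ _).trans b1
        · exact (setLIntegral_le_lintegral _ _).trans b3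
    _ = ε := ENNReal.add_thirds ε

end Mollify
end

/-! ### Weak derivatives: calculus and uniqueness. -/

section
open scoped Convolution

section Weak

variable {m : ℕ} {F : Type*} [NormedAddCommGroup F] [NormedSpace ℝ F]
  {Ω Ω' : Set (EuclideanSpace ℝ (Fin m))} {f g : EuclideanSpace ℝ (Fin m) → F}
  {f' g' : EuclideanSpace ℝ (Fin m) → EuclideanSpace ℝ (Fin m) →L[ℝ] F}

lemma HasWeakFDerivOn.congr_ae (h : HasWeakFDerivOn Ω f f') (hf : f =ᵐ[volume.restrict Ω] g)
    (hf' : f' =ᵐ[volume.restrict Ω] g') : HasWeakFDerivOn Ω g g' where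
  locallyIntegrableOn := h.locallyIntegrableOn.congr hf
  locallyIntegrableOn_deriv := h.locallyIntegrableOn_deriv.congr hf'
  integral_eq ψ hψ hc hs v := by
    have e1 : ∫ x in Ω, fderiv ℝ ψ x v • f x = ∫ x in Ω, fderiv ℝ ψ x v • g x :=
      integral_congr_ae (by filter_upwards [hf] with x hx; rw [hx])
    have e2 : ∫ x in Ω, ψ x • f' x v = ∫ x in Ω, ψ x • g' x v :=
      integral_congr_ae (by filter_upwards [hf'] with x hx; rw [hx])
    rw [← e1, h.integral_eq ψ hψ hc hs v, e2]

lemma setIntegral_fderiv_smul_eq (ψ : EuclideanSpace ℝ (Fin m) → ℝ) (hs : tsupport ψ ⊆ Ω)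
    (f : EuclideanSpace ℝ (Fin m) → F) (v : EuclideanSpace ℝ (Fin m)) :
    ∫ x in Ω, fderiv ℝ ψ x v • f x = ∫ x, fderiv ℝ ψ x v • f x := by
  refine setIntegral_eq_integral_of_forall_compl_eq_zero fun x hx => ?_
  have : fderiv ℝ ψ x = 0 := by
    by_contra h
    exact hx (hs (support_fderiv_subset ℝ h))
  simp [this]

lemma setIntegral_smul_eq (ψ : EuclideanSpace ℝ (Fin m) → ℝ) (hs : tsupport ψ ⊆ Ω)
    (f : EuclideanSpace ℝ (Fin m) → F) :
    ∫ x in Ω, ψ x • f x = ∫ x, ψ x • f x := by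
  refine setIntegral_eq_integral_of_forall_compl_eq_zero fun x hx => ?_
  have : ψ x = 0 := by
    by_contra h
    exact hx (hs (subset_tsupport ψ h))
  simp [this]

lemma HasWeakFDerivOn.mono (h : HasWeakFDerivOn Ω f f') (hsub : Ω' ⊆ Ω) :
    HasWeakFDerivOn Ω' f f' where
  locallyIntegrableOn := h.locallyIntegrableOn.mono_set hsub
  locallyIntegrableOn_deriv := h.locallyIntegrableOn_deriv.mono_set hsub
  integral_eq ψ hψ hc hs v := by
    have := h.integral_eq ψ hψ hc (hs.trans hsub) v
    rwa [setIntegral_fderiv_smul_eq ψ (hs.trans hsub), setIntegral_smul_eq ψ (hs.trans hsub),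
      ← setIntegral_fderiv_smul_eq ψ hs, ← setIntegral_smul_eq ψ hs] at this

/-- Local integrability on `Ω` suffices, as only the compact set `tsupport ψ` matters. The
integrability conditions needed to add or subtract tested integrals come from here. -/
lemma integrable_continuous_smul_of_tsupport_subset {G : Type*}
    [NormedAddCommGroup G] [NormedSpace ℝ G] {f : EuclideanSpace ℝ (Fin m) → G}
    (hf : LocallyIntegrableOn f Ω) {ψ : EuclideanSpace ℝ (Fin m) → ℝ} (hψ : Continuous ψ)
    (hc : HasCompactSupport ψ) (hs : tsupport ψ ⊆ Ω) : Integrable fun x => ψ x • f x := by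
  have h1 : IntegrableOn f (tsupport ψ) := hf.integrableOn_compact_subset hs hc
  have h2 : IntegrableOn (fun x => ψ x • f x) (tsupport ψ) :=
    h1.continuousOn_smul hψ.continuousOn hc
  exact (integrableOn_iff_integrable_of_support_subset fun x hx => by
    refine subset_tsupport ψ fun h0 => hx ?_
    simp [h0]).1 h2

lemma hasCompactSupport_fderiv_apply {ψ : EuclideanSpace ℝ (Fin m) → ℝ}
    (hc : HasCompactSupport ψ) (v : EuclideanSpace ℝ (Fin m)) :
    HasCompactSupport fun x => fderiv ℝ ψ x v :=
  (hc.fderiv (𝕜 := ℝ)).comp_left (g := fun L : EuclideanSpace ℝ (Fin m) →L[ℝ] ℝ => L v) (by simp)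

lemma tsupport_fderiv_apply_subset (ψ : EuclideanSpace ℝ (Fin m) → ℝ)
    (v : EuclideanSpace ℝ (Fin m)) :
    tsupport (fun x => fderiv ℝ ψ x v) ⊆ tsupport ψ := by
  refine closure_minimal (fun x hx => ?_) (isClosed_tsupport ψ)
  refine support_fderiv_subset ℝ fun h => hx ?_
  simp [h]

lemma continuous_fderiv_apply_of_contDiff {ψ : EuclideanSpace ℝ (Fin m) → ℝ}
    (hψ : ContDiff ℝ ∞ ψ) (v : EuclideanSpace ℝ (Fin m)) :
    Continuous fun x => fderiv ℝ ψ x v :=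
  (hψ.continuous_fderiv (by simp)).clm_apply continuous_const

/-- Weak derivatives are the classical ones for functions of class `C¹`. -/
lemma hasWeakFDerivOn_of_contDiffOn (hΩ : IsOpen Ω) (hf : ContDiffOn ℝ 1 f Ω) :
    HasWeakFDerivOn Ω f (fderiv ℝ f) := by
  have c1 : LocallyIntegrableOn f Ω := hf.continuousOn.locallyIntegrableOn hΩ.measurableSet
  have c2 : LocallyIntegrableOn (fderiv ℝ f) Ω :=
    (hf.continuousOn_fderiv_of_isOpen hΩ le_rfl).locallyIntegrableOn hΩ.measurableSet
  refine ⟨c1, c2, fun ψ hψ hc hs v => ?_⟩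
  have c3 : LocallyIntegrableOn (fun x => fderiv ℝ f x v) Ω :=
    (ContinuousLinearMap.apply ℝ F v).locallyIntegrableOn_comp c2
  rw [setIntegral_fderiv_smul_eq ψ hs, setIntegral_smul_eq ψ hs, eq_neg_iff_add_eq_zero, add_comm,
    ← eq_neg_iff_add_eq_zero]
  refine integral_smul_fderiv_eq_neg_fderiv_smul_of_integrable ?_ ?_ ?_ ?_ ?_
  · exact integrable_continuous_smul_of_tsupport_subset c1
      (continuous_fderiv_apply_of_contDiff hψ v) (hasCompactSupport_fderiv_apply hc v)
      ((tsupport_fderiv_apply_subset ψ v).trans hs)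
  · exact integrable_continuous_smul_of_tsupport_subset c3 hψ.continuous hc hs
  · exact integrable_continuous_smul_of_tsupport_subset c1 hψ.continuous hc hs
  · exact fun x _ => (hψ.differentiable (by simp)).differentiableAt
  · exact fun x hx => (hf.contDiffAt (hΩ.mem_nhds (hs hx))).differentiableAt (by simp)

lemma HasWeakFDerivOn.add (h : HasWeakFDerivOn Ω f f')
    (h' : HasWeakFDerivOn Ω g g') :
    HasWeakFDerivOn Ω (fun x => f x + g x) (fun x => f' x + g' x) where
  locallyIntegrableOn := by
    have := h.locallyIntegrableOn.add h'.locallyIntegrableOn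
    exact this
  locallyIntegrableOn_deriv := by
    have := h.locallyIntegrableOn_deriv.sub h'.locallyIntegrableOn_deriv.neg
    rw [sub_neg_eq_add] at this
    exact this
  integral_eq ψ hψ hc hs v := by
    have e1 := h.integral_eq ψ hψ hc hs v
    have e2 := h'.integral_eq ψ hψ hc hs v
    have i1 : ∀ k, LocallyIntegrableOn k Ω → Integrable fun x => fderiv ℝ ψ x v • (k x : F) :=
      fun k hk => integrable_continuous_smul_of_tsupport_subset hk
        (continuous_fderiv_apply_of_contDiff hψ v) (hasCompactSupport_fderiv_apply hc v)
        ((tsupport_fderiv_apply_subset ψ v).trans hs)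
    have i2 : ∀ k : EuclideanSpace ℝ (Fin m) → EuclideanSpace ℝ (Fin m) →L[ℝ] F,
        LocallyIntegrableOn k Ω → Integrable fun x => ψ x • k x v :=
      fun k hk => integrable_continuous_smul_of_tsupport_subset
        ((ContinuousLinearMap.apply ℝ F v).locallyIntegrableOn_comp hk) hψ.continuous hc hs
    simp only [smul_add, add_apply]
    rw [integral_add (i1 f h.locallyIntegrableOn).restrict (i1 g h'.locallyIntegrableOn).restrict,
      integral_add (i2 f' h.locallyIntegrableOn_deriv).restrict
        (i2 g' h'.locallyIntegrableOn_deriv).restrict, e1, e2, neg_add]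

lemma HasWeakFDerivOn.clm_comp [CompleteSpace F] {G : Type*} [NormedAddCommGroup G]
    [NormedSpace ℝ G] [CompleteSpace G]
    (h : HasWeakFDerivOn Ω f f') (L : F →L[ℝ] G) :
    HasWeakFDerivOn Ω (fun x => L (f x)) (fun x => L.comp (f' x)) where
  locallyIntegrableOn := L.locallyIntegrableOn_comp h.locallyIntegrableOn
  locallyIntegrableOn_deriv := by
    have := (ContinuousLinearMap.compL ℝ (EuclideanSpace ℝ (Fin m)) F G
      L).locallyIntegrableOn_comp h.locallyIntegrableOn_deriv
    exact this
  integral_eq ψ hψ hc hs v := by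
    have e1 := h.integral_eq ψ hψ hc hs v
    have i1 : Integrable fun x => fderiv ℝ ψ x v • f x :=
      integrable_continuous_smul_of_tsupport_subset h.locallyIntegrableOn
        (continuous_fderiv_apply_of_contDiff hψ v) (hasCompactSupport_fderiv_apply hc v)
        ((tsupport_fderiv_apply_subset ψ v).trans hs)
    have i2 : Integrable fun x => ψ x • f' x v :=
      integrable_continuous_smul_of_tsupport_subset
        ((ContinuousLinearMap.apply ℝ F v).locallyIntegrableOn_comp h.locallyIntegrableOn_deriv)
        hψ.continuous hc hs
    have := congrArg L e1
    rw [map_neg, ← L.integral_comp_comm i1.restrict, ← L.integral_comp_comm i2.restrict] at this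
    simpa using this

/-- The weak derivative is unique almost everywhere. -/
lemma HasWeakFDerivOn.ae_eq [CompleteSpace F] (hΩ : IsOpen Ω) (h : HasWeakFDerivOn Ω f f')
    (h' : HasWeakFDerivOn Ω f g') : f' =ᵐ[volume.restrict Ω] g' := by
  have hloc := h.locallyIntegrableOn_deriv.sub h'.locallyIntegrableOn_deriv
  have := hΩ.ae_eq_zero_of_integral_contDiff_smul_eq_zero hloc fun ψ hψ hc hs => by
    have i0 := integrable_continuous_smul_of_tsupport_subset hloc hψ.continuous hc hs
    ext v
    rw [ContinuousLinearMap.integral_apply i0]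
    have i2 : ∀ k : EuclideanSpace ℝ (Fin m) → EuclideanSpace ℝ (Fin m) →L[ℝ] F,
        LocallyIntegrableOn k Ω → Integrable fun x => ψ x • k x v :=
      fun k hk => integrable_continuous_smul_of_tsupport_subset
        ((ContinuousLinearMap.apply ℝ F v).locallyIntegrableOn_comp hk) hψ.continuous hc hs
    have e := (h.integral_eq ψ hψ hc hs v).symm.trans (h'.integral_eq ψ hψ hc hs v)
    rw [neg_inj, setIntegral_smul_eq ψ hs, setIntegral_smul_eq ψ hs] at e
    simp only [Pi.sub_apply, smul_apply, sub_apply,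
      smul_sub, zero_apply]
    rw [integral_sub (i2 _ h.locallyIntegrableOn_deriv) (i2 _ h'.locallyIntegrableOn_deriv), e,
      sub_self]
  rw [EventuallyEq, ae_restrict_iff' hΩ.measurableSet]
  filter_upwards [this] with x hx hxΩ
  exact sub_eq_zero.1 (hx hxΩ)

end Weak
end

/-! ### Smooth approximation and closedness of the weak derivative. -/

section
open scoped Convolution

section Approx

variable {m : ℕ} {F : Type*} [NormedAddCommGroup F] [NormedSpace ℝ F]
  {Ω Ω' : Set (EuclideanSpace ℝ (Fin m))} {f g : EuclideanSpace ℝ (Fin m) → F}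
  {f' g' : EuclideanSpace ℝ (Fin m) → EuclideanSpace ℝ (Fin m) →L[ℝ] F}

lemma integrable_indicator_of_locallyIntegrableOn {G : Type*} [NormedAddCommGroup G]
    {k : EuclideanSpace ℝ (Fin m) → G} (hk : LocallyIntegrableOn k Ω)
    {K : Set (EuclideanSpace ℝ (Fin m))} (hK : IsCompact K) (hKΩ : K ⊆ Ω) :
    Integrable (K.indicator k) :=
  (hk.integrableOn_compact_subset hKΩ hK).integrable_indicator hK.measurableSet

lemma lintegral_eq_setLIntegral_of_support_subset {X : Type*} [MeasurableSpace X] {μ : Measure X}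
    {k : X → ℝ≥0∞} {s : Set X} (hs : MeasurableSet s) (h : ∀ x ∉ s, k x = 0) :
    ∫⁻ x, k x ∂μ = ∫⁻ x in s, k x ∂μ := by
  rw [← lintegral_indicator hs, Set.indicator_eq_self.2 fun x hx => by
    by_contra hxs
    exact hx (h x hxs)]

open ContinuousLinearMap in
/-- Mollification commutes with weak differentiation away from the boundary. -/
lemma HasWeakFDerivOn.fderiv_convolution (h : HasWeakFDerivOn Ω f f')
    {K : Set (EuclideanSpace ℝ (Fin m))} (hK : IsCompact K) (hKΩ : K ⊆ Ω)
    (φ : ContDiffBump (0 : EuclideanSpace ℝ (Fin m))) {x : EuclideanSpace ℝ (Fin m)}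
    (hx : closedBall x φ.rOut ⊆ K) :
    fderiv ℝ (φ.normed volume ⋆[lsmul ℝ ℝ, volume] K.indicator f) x =
      (φ.normed volume ⋆[lsmul ℝ ℝ, volume] K.indicator f') x := by
  have i0 : Integrable (K.indicator f) :=
    (h.locallyIntegrableOn.integrableOn_compact_subset hKΩ hK).integrable_indicator
      hK.measurableSet
  have i1 : Integrable (K.indicator f') := 
    integrable_indicator_of_locallyIntegrableOn h.locallyIntegrableOn_deriv hK hKΩ
  have hφ : ContDiff ℝ 1 (φ.normed (volume : Measure (EuclideanSpace ℝ (Fin m)))) :=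
    φ.contDiff_normed
  have hd := (φ.hasCompactSupport_normed (μ := volume)).hasFDerivAt_convolution_left
    (lsmul ℝ ℝ : ℝ →L[ℝ] F →L[ℝ] F) hφ i0.locallyIntegrable x
  rw [hd.fderiv]
  have hc' : HasCompactSupport (fderiv ℝ (φ.normed (volume : Measure (EuclideanSpace ℝ (Fin m))))) :=
    (φ.hasCompactSupport_normed (μ := volume)).fderiv (𝕜 := ℝ)
  have ex1 : ConvolutionExistsAt (fderiv ℝ (φ.normed volume)) (K.indicator f) x
      ((lsmul ℝ ℝ : ℝ →L[ℝ] F →L[ℝ] F).precompL (EuclideanSpace ℝ (Fin m))) volume :=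
    hc'.convolutionExists_left _ (hφ.continuous_fderiv (by simp)) i0.locallyIntegrable x
  have ex2 : ConvolutionExistsAt (φ.normed volume) (K.indicator f') x
      (lsmul ℝ ℝ) volume :=
    φ.hasCompactSupport_normed.convolutionExists_left _ φ.continuous_normed
      i1.locallyIntegrable x
  ext v
  -- The reflected kernel centred at `x` is itself a test function: its support lies in `closedBall
  -- x φ.rOut`, hence in `K`, where truncation by the indicator changes nothing.
  let ψ : EuclideanSpace ℝ (Fin m) → ℝ := fun t => φ.normed volume (x - t)
  have hψ : ContDiff ℝ ∞ ψ := by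
    have : ContDiff ℝ ∞ (φ.normed (volume : Measure (EuclideanSpace ℝ (Fin m)))) :=
      φ.contDiff_normed
    exact this.comp (contDiff_const.sub contDiff_id)
  have hψs : tsupport ψ ⊆ closedBall x φ.rOut := by
    refine closure_minimal (fun t ht => ?_) isClosed_closedBall
    have : x - t ∈ Function.support (φ.normed volume) := ht
    rw [φ.support_normed_eq, mem_ball_zero_iff] at this
    rw [mem_closedBall, dist_comm, dist_eq_norm]
    exact this.le
  have hψc : HasCompactSupport ψ :=
    HasCompactSupport.of_support_subset_isCompact (isCompact_closedBall x φ.rOut)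
      ((subset_tsupport ψ).trans hψs)
  have hfd : ∀ t, fderiv ℝ ψ t v = -(fderiv ℝ (φ.normed volume) (x - t) v) := by
    intro t
    have h1 : HasFDerivAt (φ.normed volume) (fderiv ℝ (φ.normed volume) (x - t)) (x - t) :=
      (hφ.differentiable (by simp) _).hasFDerivAt
    have h2 : HasFDerivAt (fun t => x - t) (-ContinuousLinearMap.id ℝ
      (EuclideanSpace ℝ (Fin m))) t := (hasFDerivAt_id t).const_sub x
    have h3 : HasFDerivAt ψ _ t := h1.comp t h2
    rw [h3.fderiv]
    simp
  have e := h.integral_eq ψ hψ hψc (hψs.trans (hx.trans hKΩ)) v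
  rw [setIntegral_fderiv_smul_eq ψ (hψs.trans (hx.trans hKΩ)),
    setIntegral_smul_eq ψ (hψs.trans (hx.trans hKΩ))] at e
  have e1 : ((fderiv ℝ (φ.normed volume) ⋆[(lsmul ℝ ℝ : ℝ →L[ℝ] F →L[ℝ] F).precompL
      (EuclideanSpace ℝ (Fin m)), volume] K.indicator f) x) v = -∫ t, fderiv ℝ ψ t v • f t := by
    rw [convolution_eq_swap, ContinuousLinearMap.integral_apply, ← integral_neg]
    · refine integral_congr_ae (ae_of_all _ fun t => ?_)
      simp only [hfd, precompL_apply, lsmul_apply]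
      by_cases ht : t ∈ K
      · simp [ht]
      · have : fderiv ℝ (φ.normed volume) (x - t) = 0 := by
          by_contra hne
          have h3 := support_fderiv_subset ℝ hne
          rw [φ.tsupport_normed_eq, mem_closedBall_zero_iff] at h3
          refine ht (hx ?_)
          rwa [mem_closedBall, dist_comm, dist_eq_norm]
        simp [ht, this]
    · exact ex1.integrable_swap
  have e2 : ((φ.normed volume ⋆[lsmul ℝ ℝ, volume] K.indicator f') x) v =
      ∫ t, ψ t • f' t v := by
    rw [convolution_eq_swap, ContinuousLinearMap.integral_apply]
    · refine integral_congr_ae (ae_of_all _ fun t => ?_)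
      simp only [lsmul_apply, smul_apply]
      by_cases ht : t ∈ K
      · simp [ht, ψ]
      · have : ψ t = 0 := by
          by_contra hne
          exact ht (hx (hψs (subset_tsupport ψ hne)))
        simp [ht, this]
    · exact ex2.integrable_swap
  rw [e1, e2, e, neg_neg]

open ContinuousLinearMap in
/-- Weakly differentiable functions are locally limits of smooth functions. -/
lemma HasWeakFDerivOn.exists_contDiff_approx [CompleteSpace F] (hΩ : IsOpen Ω)
    (h : HasWeakFDerivOn Ω f f')
    {K : Set (EuclideanSpace ℝ (Fin m))} (hK : IsCompact K) (hKΩ : K ⊆ Ω) {ε : ℝ≥0∞}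
    (hε : ε ≠ 0) :
    ∃ g : EuclideanSpace ℝ (Fin m) → F, ContDiff ℝ ∞ g ∧ (∫⁻ x in K, ‖g x - f x‖ₑ ≤ ε) ∧
      (∫⁻ x in K, ‖fderiv ℝ g x - f' x‖ₑ ≤ ε) ∧
      ((∀ x ∈ Ω, f' x = 0) → ∀ x ∈ K, fderiv ℝ g x = 0) := by
  -- Truncating to a thickening of `K` that still lies in `Ω` makes the convolutions at points of
  -- `K` insensitive to the truncation, once the radius is below `δ`.
  obtain ⟨δ, hδ, hδΩ⟩ := hK.exists_cthickening_subset_open hΩ hKΩ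
  set K' := cthickening δ K with hK'
  have hK'c : IsCompact K' := hK.cthickening
  have hsub : K ⊆ K' := self_subset_cthickening K
  have i0 : Integrable (K'.indicator f) :=
    (h.locallyIntegrableOn.integrableOn_compact_subset hδΩ hK'c).integrable_indicator
      hK'c.measurableSet
  have i1 : Integrable (K'.indicator f') := 
    integrable_indicator_of_locallyIntegrableOn h.locallyIntegrableOn_deriv hK'c hδΩ
  obtain ⟨δ₁, hδ₁, H₁⟩ := exists_forall_lintegral_convolution_sub_le i0 hK.measure_lt_top.ne hε
  obtain ⟨δ₂, hδ₂, H₂⟩ := exists_forall_lintegral_convolution_sub_le i1 hK.measure_lt_top.ne hε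
  have hr : 0 < min δ (min δ₁ δ₂) := lt_min hδ (lt_min hδ₁ hδ₂)
  let φ : ContDiffBump (0 : EuclideanSpace ℝ (Fin m)) :=
    ⟨min δ (min δ₁ δ₂) / 4, min δ (min δ₁ δ₂) / 2, by positivity, by linarith⟩
  have hφ : φ.rOut < min δ (min δ₁ δ₂) := half_lt_self hr
  have hball : ∀ x ∈ K, closedBall x φ.rOut ⊆ K' := fun x hx =>
    (closedBall_subset_closedBall (hφ.le.trans (min_le_left _ _))).trans
      (closedBall_subset_cthickening hx δ)
  refine ⟨φ.normed volume ⋆[lsmul ℝ ℝ, volume] K'.indicator f, ?_, ?_, ?_, ?_⟩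
  · exact φ.hasCompactSupport_normed.contDiff_convolution_left _ φ.contDiff_normed
      i0.locallyIntegrable
  · refine le_trans (le_of_eq ?_) (H₁ φ (hφ.trans_le ((min_le_right _ _).trans (min_le_left _ _))))
    refine setLIntegral_congr_fun hK.measurableSet fun x hx => ?_
    simp only [indicator_of_mem (hsub hx)]
  · refine le_trans (le_of_eq ?_) (H₂ φ (hφ.trans_le ((min_le_right _ _).trans (min_le_right _ _))))
    refine setLIntegral_congr_fun hK.measurableSet fun x hx => ?_
    rw [h.fderiv_convolution hK'c hδΩ φ (hball x hx), indicator_of_mem (hsub hx)]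
  -- An exact statement, not an approximate one: the derivative of the mollification is the
  -- mollification of `f'`, hence zero. Constancy of functions with zero weak derivative relies on
  -- it.
  · intro h0 x hx
    rw [h.fderiv_convolution hK'c hδΩ φ (hball x hx)]
    have : K'.indicator f' = 0 := by
      ext1 y
      by_cases hy : y ∈ K'
      · rw [indicator_of_mem hy, h0 y (hδΩ hy)]; rfl
      · rw [indicator_of_notMem hy]; rfl
    rw [this, convolution_zero]
    rfl

/-- A function that is locally a limit of weakly differentiable functions, with convergence of the
derivatives, is weakly differentiable. -/
lemma hasWeakFDerivOn_of_approx (hf : LocallyIntegrableOn f Ω) (hf' : LocallyIntegrableOn f' Ω)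
    (H : ∀ K ⊆ Ω, IsCompact K → ∀ ε : ℝ≥0∞, ε ≠ 0 →
      ∃ (g : EuclideanSpace ℝ (Fin m) → F)
        (g' : EuclideanSpace ℝ (Fin m) → EuclideanSpace ℝ (Fin m) →L[ℝ] F),
        HasWeakFDerivOn Ω g g' ∧ (∫⁻ x in K, ‖g x - f x‖ₑ ≤ ε) ∧
          ∫⁻ x in K, ‖g' x - f' x‖ₑ ≤ ε) : HasWeakFDerivOn Ω f f' := by
  refine ⟨hf, hf', fun ψ hψ hc hs v => ?_⟩
  have c1 := continuous_fderiv_apply_of_contDiff hψ v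
  have hloc : ∀ k : EuclideanSpace ℝ (Fin m) → EuclideanSpace ℝ (Fin m) →L[ℝ] F,
      LocallyIntegrableOn k Ω → LocallyIntegrableOn (fun x => k x v) Ω :=
    fun k hk => (ContinuousLinearMap.apply ℝ F v).locallyIntegrableOn_comp hk
  have i1 : ∀ k, LocallyIntegrableOn k Ω → Integrable fun x => fderiv ℝ ψ x v • (k x : F) :=
    fun k hk => integrable_continuous_smul_of_tsupport_subset hk c1
      (hasCompactSupport_fderiv_apply hc v) ((tsupport_fderiv_apply_subset ψ v).trans hs)
  have i2 : ∀ k : EuclideanSpace ℝ (Fin m) → F,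
      LocallyIntegrableOn k Ω → Integrable fun x => ψ x • k x :=
    fun k hk => integrable_continuous_smul_of_tsupport_subset hk hψ.continuous hc hs
  obtain ⟨A, hA⟩ := c1.bounded_above_of_compact_support (hasCompactSupport_fderiv_apply hc v)
  obtain ⟨B, hB⟩ := hψ.continuous.bounded_above_of_compact_support hc
  set D : ℝ≥0∞ := ENNReal.ofReal A + ENNReal.ofReal B * ‖v‖ₑ with hD
  have hDtop : D ≠ ⊤ := by finiteness
  rw [setIntegral_fderiv_smul_eq ψ hs, setIntegral_smul_eq ψ hs, ← sub_eq_zero, sub_neg_eq_add,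
    ← enorm_eq_zero]
  refine le_antisymm (ENNReal.le_of_forall_pos_le_add fun ε hε _ => ?_) zero_le
  rw [zero_add]
  obtain ⟨η, hη0, hη⟩ := ENNReal.exists_nnreal_pos_mul_lt hDtop
    (ENNReal.coe_ne_zero.2 hε.ne')
  obtain ⟨g, g', hg, hgf, hgf'⟩ := H (tsupport ψ) hs hc η (ENNReal.coe_ne_zero.2 hη0.ne')
  have e := hg.integral_eq ψ hψ hc hs v
  rw [setIntegral_fderiv_smul_eq ψ hs, setIntegral_smul_eq ψ hs, ← add_eq_zero_iff_eq_neg] at e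
  -- The defect of integration by parts for `f` equals minus its value on the error `g - f`, because
  -- the defect of `g` is zero. Both errors are integrated over `tsupport ψ` only.
  have key : (∫ x, fderiv ℝ ψ x v • f x) + ∫ x, ψ x • f' x v =
      -((∫ x, fderiv ℝ ψ x v • (g x - f x)) + ∫ x, ψ x • (g' x v - f' x v)) := by
    simp only [smul_sub]
    rw [integral_sub (i1 _ hg.locallyIntegrableOn) (i1 _ hf),
      integral_sub (i2 _ (hloc _ hg.locallyIntegrableOn_deriv)) (i2 _ (hloc _ hf'))]
    rw [← sub_eq_zero]
    rw [← e]
    abel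
  have b1 : ‖∫ x, fderiv ℝ ψ x v • (g x - f x)‖ₑ ≤ ENNReal.ofReal A * η := by
    refine (enorm_integral_le_lintegral_enorm _).trans ?_
    calc ∫⁻ x, ‖fderiv ℝ ψ x v • (g x - f x)‖ₑ
        = ∫⁻ x in tsupport ψ, ‖fderiv ℝ ψ x v • (g x - f x)‖ₑ := by
          refine lintegral_eq_setLIntegral_of_support_subset (isClosed_tsupport ψ).measurableSet
            fun x hx => ?_
          rw [image_eq_zero_of_notMem_tsupport (f := fun x => fderiv ℝ ψ x v)
            fun h => hx (tsupport_fderiv_apply_subset ψ v h), zero_smul, enorm_zero]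
      _ ≤ ∫⁻ x in tsupport ψ, ENNReal.ofReal A * ‖g x - f x‖ₑ := by
          refine lintegral_mono fun x => ?_
          rw [enorm_smul]
          gcongr
          rw [← ofReal_norm]
          exact ENNReal.ofReal_le_ofReal (hA x)
      _ ≤ _ := by
          rw [lintegral_const_mul' _ _ ENNReal.ofReal_ne_top]
          gcongr
  have b2 : ‖∫ x, ψ x • (g' x v - f' x v)‖ₑ ≤ ENNReal.ofReal B * ‖v‖ₑ * η := by
    refine (enorm_integral_le_lintegral_enorm _).trans ?_
    calc ∫⁻ x, ‖ψ x • (g' x v - f' x v)‖ₑ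
        = ∫⁻ x in tsupport ψ, ‖ψ x • (g' x v - f' x v)‖ₑ := by
          refine lintegral_eq_setLIntegral_of_support_subset (isClosed_tsupport ψ).measurableSet
            fun x hx => ?_
          rw [image_eq_zero_of_notMem_tsupport hx, zero_smul, enorm_zero]
      _ ≤ ∫⁻ x in tsupport ψ, ENNReal.ofReal B * ‖v‖ₑ * ‖g' x - f' x‖ₑ := by
          refine lintegral_mono fun x => ?_
          rw [enorm_smul, mul_assoc]
          gcongr
          · rw [← ofReal_norm]
            exact ENNReal.ofReal_le_ofReal (hB x)
          · rw [← sub_apply, mul_comm]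
            exact (g' x - f' x).le_opENorm v
      _ ≤ _ := by
          rw [lintegral_const_mul' _ _ (by finiteness)]
          gcongr
  rw [key, enorm_neg]
  calc _ ≤ ENNReal.ofReal A * η + ENNReal.ofReal B * ‖v‖ₑ * η :=
        (enorm_add_le _ _).trans (add_le_add b1 b2)
    _ = η * D := by rw [hD]; ring
    _ ≤ ε := hη.le

end Approx
end

/-! ### Chain rule and locality. -/

section
open scoped Convolution

section ChainRule

variable {m : ℕ} {F : Type*} [NormedAddCommGroup F] [NormedSpace ℝ F]
  {Ω Ω' : Set (EuclideanSpace ℝ (Fin m))} {f g : EuclideanSpace ℝ (Fin m) → F}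
  {f' g' : EuclideanSpace ℝ (Fin m) → EuclideanSpace ℝ (Fin m) →L[ℝ] F}

/-- The pushforward of a measure on `K` lives on `Ψ '' K`. This confines error estimates to a
compact subset of the target, where local integrability applies. -/
lemma map_restrict_le_smul_restrict_image {X Y : Type*} [MeasurableSpace X] [MeasurableSpace Y]
    {μ : Measure X} {ν : Measure Y} {Ψ : X → Y} {K : Set X} {C : ℝ≥0∞} (hK : MeasurableSet K)
    (hΨ : AEMeasurable Ψ (μ.restrict K)) (hΨK : MeasurableSet (Ψ '' K))
    (h : (μ.restrict K).map Ψ ≤ C • ν) : (μ.restrict K).map Ψ ≤ C • ν.restrict (Ψ '' K) := by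
  refine Measure.le_iff.2 fun A hA => ?_
  have h1 := Measure.le_iff.1 h (A ∩ Ψ '' K) (hA.inter hΨK)
  rw [Measure.map_apply_of_aemeasurable hΨ (hA.inter hΨK), Measure.restrict_apply' hK] at h1
  rw [Measure.map_apply_of_aemeasurable hΨ hA, Measure.restrict_apply' hK, Measure.smul_apply,
    Measure.restrict_apply hA]
  refine le_trans (measure_mono ?_) h1
  rintro x ⟨hxA, hxK⟩
  exact ⟨⟨hxA, mem_image_of_mem Ψ hxK⟩, hxK⟩

/-- For smooth `f` this is the classical chain rule, and weakly differentiable functions are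
approximated by smooth ones on the compact image. The bound on pushforwards carries the `L¹` errors
back through `Ψ`; no invertibility of `Ψ` is needed beyond that. -/
lemma HasWeakFDerivOn.comp [CompleteSpace F] (hΩ : IsOpen Ω) (hΩ' : IsOpen Ω')
    (h : HasWeakFDerivOn Ω f f')
    {Ψ : EuclideanSpace ℝ (Fin m) → EuclideanSpace ℝ (Fin m)} (hΨ : ContDiffOn ℝ 1 Ψ Ω')
    (hmaps : MapsTo Ψ Ω' Ω)
    (hmeas : ∀ K ⊆ Ω', IsCompact K → ∃ C : ℝ≥0∞, C ≠ ⊤ ∧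
      (volume.restrict K).map Ψ ≤ C • volume) :
    HasWeakFDerivOn Ω' (fun x => f (Ψ x)) (fun x => (f' (Ψ x)).comp (fderiv ℝ Ψ x)) := by
  have hcont : ContinuousOn (fderiv ℝ Ψ) Ω' := hΨ.continuousOn_fderiv_of_isOpen hΩ' le_rfl
  have hmeas' : ∀ K ⊆ Ω', IsCompact K → ∃ C : ℝ≥0∞, C ≠ ⊤ ∧
      (volume.restrict K).map Ψ ≤ C • volume.restrict (Ψ '' K) := by
    intro K hK hKc
    obtain ⟨C, hC, h1⟩ := hmeas K hK hKc
    exact ⟨C, hC, map_restrict_le_smul_restrict_image hKc.measurableSet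
      ((hΨ.continuousOn.mono hK).aemeasurable hKc.measurableSet)
      (hKc.image_of_continuousOn (hΨ.continuousOn.mono hK)).measurableSet h1⟩
  have hint : ∀ {G : Type _} [NormedAddCommGroup G] [NormedSpace ℝ G]
      {k : EuclideanSpace ℝ (Fin m) → G}, LocallyIntegrableOn k Ω →
      ∀ K ⊆ Ω', IsCompact K → IntegrableOn (fun x => k (Ψ x)) K := by
    intro G _ _ k hk K hK hKc
    obtain ⟨C, hC, h1⟩ := hmeas' K hK hKc
    have h2 : Integrable k (volume.restrict (Ψ '' K)) :=
      hk.integrableOn_compact_subset (image_subset_iff.2 fun x hx => hmaps (hK hx))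
        (hKc.image_of_continuousOn (hΨ.continuousOn.mono hK))
    have h3 : Integrable k ((volume.restrict K).map Ψ) := (h2.smul_measure hC).mono_measure h1
    exact h3.comp_aemeasurable ((hΨ.continuousOn.mono hK).aemeasurable hKc.measurableSet)
  have hlint : ∀ K ⊆ Ω', ∀ hK : IsCompact K, ∀ C : ℝ≥0∞,
      (volume.restrict K).map Ψ ≤ C • volume.restrict (Ψ '' K) →
      ∀ k : EuclideanSpace ℝ (Fin m) → ℝ≥0∞, AEMeasurable k (volume.restrict (Ψ '' K)) →
      ∫⁻ x in K, k (Ψ x) ≤ C * ∫⁻ x in Ψ '' K, k x := by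
    intro K hK hKc C h1 k hk
    have hk' : AEMeasurable k ((volume.restrict K).map Ψ) := (hk.smul_measure C).mono_measure h1
    rw [← lintegral_map' hk' ((hΨ.continuousOn.mono hK).aemeasurable hKc.measurableSet),
      ← smul_eq_mul, ← lintegral_smul_measure]
    exact lintegral_mono' h1 le_rfl
  refine hasWeakFDerivOn_of_approx ?_ ?_ ?_
  · exact (locallyIntegrableOn_iff hΩ'.isLocallyClosed).2 fun K hK hKc =>
      hint h.locallyIntegrableOn K hK hKc
  · refine (locallyIntegrableOn_iff hΩ'.isLocallyClosed).2 fun K hK hKc => ?_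
    have h1 := hint h.locallyIntegrableOn_deriv K hK hKc
    obtain ⟨A, hA⟩ := hKc.exists_bound_of_continuousOn (hcont.mono hK)
    have hm : AEStronglyMeasurable (fun x => (f' (Ψ x)).comp (fderiv ℝ Ψ x))
        (volume.restrict K) := by
      have e1 : AEStronglyMeasurable (fderiv ℝ Ψ) (volume.restrict K) :=
        (hcont.mono hK).aestronglyMeasurable hKc.measurableSet
      exact (ContinuousLinearMap.compL ℝ (EuclideanSpace ℝ (Fin m)) (EuclideanSpace ℝ (Fin m))
        F).aestronglyMeasurable_comp₂ h1.1 e1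
    refine Integrable.mono' (h1.norm.mul_const A) hm ?_
    filter_upwards [ae_restrict_mem hKc.measurableSet] with x hx
    exact (ContinuousLinearMap.opNorm_comp_le _ _).trans
      (mul_le_mul_of_nonneg_left (hA x hx) (norm_nonneg _))
  · intro K hK hKc ε hε
    obtain ⟨C, hC, h1⟩ := hmeas' K hK hKc
    have hΨK : IsCompact (Ψ '' K) := hKc.image_of_continuousOn (hΨ.continuousOn.mono hK)
    have hΨKΩ : Ψ '' K ⊆ Ω := image_subset_iff.2 fun x hx => hmaps (hK hx)
    obtain ⟨A, hA⟩ := hKc.exists_bound_of_continuousOn (hcont.mono hK)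
    have hDtop : C * (1 + ENNReal.ofReal A) ≠ ⊤ := by finiteness
    obtain ⟨η, hη0, hη⟩ := ENNReal.exists_nnreal_pos_mul_lt hDtop hε
    obtain ⟨g, hg, hgf, hgf', -⟩ := h.exists_contDiff_approx hΩ hΨK hΨKΩ
      (ENNReal.coe_ne_zero.2 hη0.ne')
    have hg1 : ContDiff ℝ 1 g := hg.of_le (by norm_num)
    refine ⟨fun x => g (Ψ x), fderiv ℝ (fun x => g (Ψ x)),
      hasWeakFDerivOn_of_contDiffOn hΩ' (hg1.comp_contDiffOn hΨ), ?_, ?_⟩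
    · have m1 : AEMeasurable (fun x => ‖g x - f x‖ₑ) (volume.restrict (Ψ '' K)) :=
        (hg.continuous.aestronglyMeasurable.sub
          (h.locallyIntegrableOn.integrableOn_compact_subset hΨKΩ hΨK).1).enorm
      calc _ ≤ C * ∫⁻ x in Ψ '' K, ‖g x - f x‖ₑ := hlint K hK hKc C h1 _ m1
        _ ≤ C * η := by gcongr
        _ ≤ η * (C * (1 + ENNReal.ofReal A)) := by
          rw [mul_comm]; gcongr; exact le_mul_of_one_le_right zero_le le_self_add
        _ ≤ ε := hη.le
    · have m1 : AEMeasurable (fun x => ‖fderiv ℝ g x - f' x‖ₑ) (volume.restrict (Ψ '' K)) :=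
        ((hg.continuous_fderiv (by simp)).aestronglyMeasurable.sub
          (h.locallyIntegrableOn_deriv.integrableOn_compact_subset hΨKΩ hΨK).1).enorm
      calc ∫⁻ x in K, ‖fderiv ℝ (fun x => g (Ψ x)) x - (f' (Ψ x)).comp (fderiv ℝ Ψ x)‖ₑ
          ≤ ∫⁻ x in K, ‖fderiv ℝ g (Ψ x) - f' (Ψ x)‖ₑ * ENNReal.ofReal A := by
            refine setLIntegral_mono' hKc.measurableSet fun x hx => ?_
            have hd : DifferentiableAt ℝ Ψ x :=
              (hΨ.contDiffAt (hΩ'.mem_nhds (hK hx))).differentiableAt (by simp)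
            have e : fderiv ℝ (fun x => g (Ψ x)) x = (fderiv ℝ g (Ψ x)).comp (fderiv ℝ Ψ x) :=
              fderiv_comp x (hg1.differentiable (by simp) _) hd
            rw [e, ← ContinuousLinearMap.sub_comp, ← ofReal_norm, ← ofReal_norm,
              ← ENNReal.ofReal_mul (norm_nonneg _)]
            exact ENNReal.ofReal_le_ofReal ((ContinuousLinearMap.opNorm_comp_le _ _).trans
              (mul_le_mul_of_nonneg_left (hA x hx) (norm_nonneg _)))
        _ = (∫⁻ x in K, ‖fderiv ℝ g (Ψ x) - f' (Ψ x)‖ₑ) * ENNReal.ofReal A :=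
            lintegral_mul_const' _ _ ENNReal.ofReal_ne_top
        _ ≤ (C * ∫⁻ x in Ψ '' K, ‖fderiv ℝ g x - f' x‖ₑ) * ENNReal.ofReal A := by
            gcongr
            exact hlint K hK hKc C h1 (fun x => ‖fderiv ℝ g x - f' x‖ₑ) m1
        _ ≤ (C * η) * ENNReal.ofReal A := by gcongr
        _ = η * (C * ENNReal.ofReal A) := by ring
        _ ≤ η * (C * (1 + ENNReal.ofReal A)) := by gcongr; exact le_add_self
        _ ≤ ε := hη.le

/-- Being weakly differentiable is a local property. -/
lemma HasWeakFDerivOn.union {U V : Set (EuclideanSpace ℝ (Fin m))} (hU : IsOpen U) (hV : IsOpen V)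
    (hfU : HasWeakFDerivOn U f f') (hfV : HasWeakFDerivOn V f f') :
    HasWeakFDerivOn (U ∪ V) f f' := by
  have hloc : ∀ {G : Type _} [NormedAddCommGroup G] {k : EuclideanSpace ℝ (Fin m) → G},
      LocallyIntegrableOn k U → LocallyIntegrableOn k V → LocallyIntegrableOn k (U ∪ V) := by
    intro G _ k h1 h2 x hx
    rw [(hU.union hV).nhdsWithin_eq hx]
    rcases hx with hx | hx
    · rw [← hU.nhdsWithin_eq hx]; exact h1 x hx
    · rw [← hV.nhdsWithin_eq hx]; exact h2 x hx
  refine ⟨hloc hfU.locallyIntegrableOn hfV.locallyIntegrableOn,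
    hloc hfU.locallyIntegrableOn_deriv hfV.locallyIntegrableOn_deriv, fun ψ hψ hc hs v => ?_⟩
  -- A two-piece partition of unity: `η` equals one near the part of the support missed by `V` and
  -- vanishes off a compact thickening inside `U`, so `η ψ` is a test function in `U` and `(1 - η)
  -- ψ` one in `V`.
  have hK : IsCompact (tsupport ψ \ V) := hc.isCompact.diff hV
  obtain ⟨δ, hδ, hδU⟩ := hK.exists_cthickening_subset_open hU
    (fun x hx => (hs hx.1).resolve_right hx.2)
  have hint : tsupport ψ \ V ⊆ interior (cthickening δ (tsupport ψ \ V)) :=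
    (self_subset_thickening hδ _).trans
      (interior_maximal (thickening_subset_cthickening _ _) isOpen_thickening)
  obtain ⟨η, hη1, hη0, -⟩ := exists_contMDiffMap_one_nhds_of_subset_interior (n := (⊤ : ℕ∞))
    𝓘(ℝ, EuclideanSpace ℝ (Fin m)) hK.isClosed hint
  have hη : ContDiff ℝ ∞ η := η.contMDiff.contDiff
  have d1 : ContDiff ℝ ∞ fun x => η x * ψ x := hη.mul hψ
  have d2 : ContDiff ℝ ∞ fun x => (1 - η x) * ψ x := (contDiff_const.sub hη).mul hψ
  have c1 : HasCompactSupport fun x => η x * ψ x := hc.mul_left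
  have c2 : HasCompactSupport fun x => (1 - η x) * ψ x := hc.mul_left
  have s1 : tsupport (fun x => η x * ψ x) ⊆ U := by
    refine (closure_minimal (fun x hx => ?_) isClosed_cthickening).trans hδU
    by_contra hxt
    exact hx (by simp [hη0 x hxt])
  have s2 : tsupport (fun x => (1 - η x) * ψ x) ⊆ V := by
    intro x hx
    have hxψ : x ∈ tsupport ψ := tsupport_mul_subset_right hx
    by_contra hxV
    have h1 : ∀ᶠ y in 𝓝 x, η y = 1 := hη1.filter_mono 
      (nhds_le_nhdsSet (show x ∈ tsupport ψ \ V from ⟨hxψ, hxV⟩))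
    exact (notMem_tsupport_iff_eventuallyEq.2 (h1.mono fun y hy => by simp [hy])) hx
  have e1 := hfU.integral_eq _ d1 c1 s1 v
  have e2 := hfV.integral_eq _ d2 c2 s2 v
  have i1 : ∀ {χ : EuclideanSpace ℝ (Fin m) → ℝ} {W : Set (EuclideanSpace ℝ (Fin m))},
      HasWeakFDerivOn W f f' → ContDiff ℝ ∞ χ → HasCompactSupport χ → tsupport χ ⊆ W →
      (Integrable fun x => fderiv ℝ χ x v • f x) ∧ Integrable fun x => χ x • f' x v :=
    fun hW h1 h2 h3 => ⟨integrable_continuous_smul_of_tsupport_subset hW.locallyIntegrableOn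
      (continuous_fderiv_apply_of_contDiff h1 v) (hasCompactSupport_fderiv_apply h2 v)
      ((tsupport_fderiv_apply_subset _ v).trans h3),
      integrable_continuous_smul_of_tsupport_subset
        ((ContinuousLinearMap.apply ℝ F v).locallyIntegrableOn_comp hW.locallyIntegrableOn_deriv)
        h1.continuous h2 h3⟩
  rw [setIntegral_fderiv_smul_eq _ s1, setIntegral_smul_eq _ s1] at e1
  rw [setIntegral_fderiv_smul_eq _ s2, setIntegral_smul_eq _ s2] at e2
  rw [setIntegral_fderiv_smul_eq _ hs, setIntegral_smul_eq _ hs]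
  have hsum : ∀ x, ψ x = η x * ψ x + (1 - η x) * ψ x := fun x => by ring
  have hfd : ∀ x, fderiv ℝ ψ x v = fderiv ℝ (fun x => η x * ψ x) x v +
      fderiv ℝ (fun x => (1 - η x) * ψ x) x v := by
    intro x
    rw [← add_apply, ← fderiv_fun_add (d1.differentiable (by simp) _)
      (d2.differentiable (by simp) _)]
    simp only [← hsum]
  calc ∫ x, fderiv ℝ ψ x v • f x = (∫ x, fderiv ℝ (fun x => η x * ψ x) x v • f x) +
        ∫ x, fderiv ℝ (fun x => (1 - η x) * ψ x) x v • f x := by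
        rw [← integral_add (i1 hfU d1 c1 s1).1 (i1 hfV d2 c2 s2).1]
        simp only [hfd, add_smul]
    _ = -∫ x, ψ x • f' x v := by
        rw [e1, e2, ← neg_add, ← integral_add (i1 hfU d1 c1 s1).2 (i1 hfV d2 c2 s2).2]
        simp only [← add_smul, ← hsum]

end ChainRule
end

/-! ### Weakly differentiable phases and functions with zero derivative. -/

section
open scoped Convolution

section Lift

variable {m : ℕ} {F : Type*} [NormedAddCommGroup F] [NormedSpace ℝ F]
  {Ω : Set (EuclideanSpace ℝ (Fin m))}

lemma norm_coe_exp_sub_coe_exp_le (a b : ℝ) :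
    ‖(Circle.exp a : ℂ) - Circle.exp b‖ ≤ ‖a - b‖ := by
  have h : (Circle.exp a : ℂ) - Circle.exp b =
      Circle.exp b * (Complex.exp (Complex.I * ((a - b : ℝ) : ℂ)) - 1) := by
    rw [Circle.coe_exp, Circle.coe_exp, mul_sub, ← Complex.exp_add]
    congr 2
    · push_cast; ring
    · ring
  rw [h, norm_mul, Circle.norm_coe, one_mul]
  exact Real.norm_exp_I_mul_ofReal_sub_one_le

lemma hasDerivAt_coe_exp (a : ℝ) :
    HasDerivAt (fun t : ℝ => (Circle.exp t : ℂ)) (Complex.I * Circle.exp a) a := by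
  simp only [Circle.coe_exp]
  have h := ((Complex.ofRealCLM.hasDerivAt (x := a)).mul_const Complex.I).cexp
  convert! h using 1
  simp [mul_comm]

/-- The pointwise identity `|D exp (i φ)| = |Dφ|`, which makes the constant equal to one when `s =
1`. -/
lemma norm_smulRight_I_mul_coe {E : Type*} [NormedAddCommGroup E] [NormedSpace ℝ E]
    (L : E →L[ℝ] ℝ) (z : Circle) : ‖L.smulRight (Complex.I * z)‖ = ‖L‖ := by
  rw [ContinuousLinearMap.norm_smulRight_apply, norm_mul, Complex.norm_I, Circle.norm_coe,
    one_mul, mul_one]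

/-- The chain rule for `exp (i φ)` with `φ` weakly differentiable. -/
lemma HasWeakFDerivOn.circle_exp (hΩ : IsOpen Ω) {φ : EuclideanSpace ℝ (Fin m) → ℝ}
    {φ' : EuclideanSpace ℝ (Fin m) → EuclideanSpace ℝ (Fin m) →L[ℝ] ℝ}
    (h : HasWeakFDerivOn Ω φ φ') :
    HasWeakFDerivOn Ω (fun x => (Circle.exp (φ x) : ℂ))
      (fun x => (φ' x).smulRight (Complex.I * Circle.exp (φ x))) := by
  have hec : Continuous fun t : ℝ => (Circle.exp t : ℂ) := by fun_prop
  have mint : ∀ K ⊆ Ω, IsCompact K → AEStronglyMeasurable (fun x => (Circle.exp (φ x) : ℂ))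
      (volume.restrict K) := fun K hK hKc =>
    hec.comp_aestronglyMeasurable (h.locallyIntegrableOn.integrableOn_compact_subset hK hKc).1
  have mint' : ∀ K ⊆ Ω, IsCompact K → AEStronglyMeasurable
      (fun x => (φ' x).smulRight (Complex.I * Circle.exp (φ x))) (volume.restrict K) := by
    intro K hK hKc
    have h1 := (h.locallyIntegrableOn_deriv.integrableOn_compact_subset hK hKc).1
    exact (ContinuousLinearMap.smulRightL ℝ (EuclideanSpace ℝ (Fin m))
      ℂ).aestronglyMeasurable_comp₂ h1 ((mint K hK hKc).const_mul Complex.I)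
  refine hasWeakFDerivOn_of_approx ?_ ?_ ?_
  · refine (locallyIntegrableOn_iff hΩ.isLocallyClosed).2 fun K hK hKc => ?_
    refine Integrable.mono' (g := fun _ => (1 : ℝ))
      (by
        have := hKc.measure_lt_top (μ := volume)
        exact integrableOn_const this.ne) (mint K hK hKc) ?_
    exact ae_of_all _ fun x => by simp
  · refine (locallyIntegrableOn_iff hΩ.isLocallyClosed).2 fun K hK hKc => ?_
    refine Integrable.mono' (h.locallyIntegrableOn_deriv.integrableOn_compact_subset hK hKc).norm
      (mint' K hK hKc) ?_
    exact ae_of_all _ fun x => by rw [norm_smulRight_I_mul_coe]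
  · intro K hK hKc ε hε
    have i0 := h.locallyIntegrableOn.integrableOn_compact_subset hK hKc
    have i1 := h.locallyIntegrableOn_deriv.integrableOn_compact_subset hK hKc
    obtain ⟨ε', hε'0, hε'⟩ : ∃ ε' : ℝ, 0 < ε' ∧ 2 * ENNReal.ofReal ε' ≤ ε / 2 := by
      obtain ⟨η, hη0, hη⟩ := ENNReal.exists_nnreal_pos_mul_lt (a := 2) (by simp)
        (show ε / 2 ≠ 0 by simp [hε])
      exact ⟨η, by exact_mod_cast hη0, by rw [mul_comm]; simpa using hη.le⟩
    -- The error term `φ' (exp (i g) - exp (i φ))` pairs `φ'`, possibly unbounded, with a difference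
    -- that is small only in `L¹`. Where `|φ'| < R`, the Lipschitz bound on `exp` is used; where
    -- `|φ'| ≥ R`, the difference is at most two and `φ'` has small integral by uniform
    -- integrability.
    obtain ⟨R, hR0, hR⟩ := (memLp_one_iff_integrable.2 i1).integral_indicator_norm_ge_nonneg_le hε'0
    obtain ⟨η, hη0, hη⟩ := ENNReal.exists_nnreal_pos_mul_lt (a := 1 + ENNReal.ofReal R)
      (by finiteness) (show ε / 2 ≠ 0 by simp [hε])
    obtain ⟨g, hg, hgf, hgf', -⟩ := h.exists_contDiff_approx hΩ hKc hK
      (ENNReal.coe_ne_zero.2 hη0.ne')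
    have hg1 : ContDiff ℝ 1 g := hg.of_le (by norm_num)
    have hexp : ContDiff ℝ 1 fun t : ℝ => (Circle.exp t : ℂ) := by
      simp only [Circle.coe_exp]
      exact (Complex.ofRealCLM.contDiff.mul contDiff_const).cexp
    have hfd : ∀ x, fderiv ℝ (fun x => (Circle.exp (g x) : ℂ)) x =
        (fderiv ℝ g x).smulRight (Complex.I * Circle.exp (g x)) := by
      intro x
      have := (hasDerivAt_coe_exp (g x)).hasFDerivAt.comp x
        (hg1.differentiable (by simp) x).hasFDerivAt
      have h2 : HasFDerivAt (fun x => (Circle.exp (g x) : ℂ)) _ x := this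
      rw [h2.fderiv]
      ext v
      simp
    refine ⟨fun x => (Circle.exp (g x) : ℂ), fderiv ℝ fun x => (Circle.exp (g x) : ℂ),
      hasWeakFDerivOn_of_contDiffOn hΩ (hexp.comp hg1).contDiffOn, ?_, ?_⟩
    · calc _ ≤ ∫⁻ x in K, ‖g x - φ x‖ₑ := by
            refine lintegral_mono fun x => ?_
            rw [← ofReal_norm, ← ofReal_norm]
            exact ENNReal.ofReal_le_ofReal (norm_coe_exp_sub_coe_exp_le _ _)
        _ ≤ η := hgf
        _ ≤ η * (1 + ENNReal.ofReal R) := le_mul_of_one_le_right zero_le le_self_add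
        _ ≤ ε := hη.le.trans ENNReal.half_le_self
    · have key : ∀ x, ‖fderiv ℝ (fun x => (Circle.exp (g x) : ℂ)) x -
          (φ' x).smulRight (Complex.I * Circle.exp (φ x))‖ₑ ≤
          ‖fderiv ℝ g x - φ' x‖ₑ + ENNReal.ofReal R * ‖g x - φ x‖ₑ +
            2 * ‖{x | R ≤ ‖φ' x‖₊}.indicator φ' x‖ₑ := by
        intro x
        have e : fderiv ℝ (fun x => (Circle.exp (g x) : ℂ)) x -
            (φ' x).smulRight (Complex.I * Circle.exp (φ x)) =
            (fderiv ℝ g x - φ' x).smulRight (Complex.I * Circle.exp (g x)) +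
            (φ' x).smulRight (Complex.I * ((Circle.exp (g x) : ℂ) - Circle.exp (φ x))) := by
          rw [hfd]
          ext v
          simp
          ring
        have b1 : ‖(fderiv ℝ g x - φ' x).smulRight (Complex.I * Circle.exp (g x))‖ₑ =
            ‖fderiv ℝ g x - φ' x‖ₑ := by
          rw [← ofReal_norm, norm_smulRight_I_mul_coe, ofReal_norm]
        have b0 := enorm_add_le ((fderiv ℝ g x - φ' x).smulRight (Complex.I * Circle.exp (g x)))
          ((φ' x).smulRight (Complex.I * ((Circle.exp (g x) : ℂ) - Circle.exp (φ x))))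
        rw [e, add_assoc]
        rw [b1] at b0
        refine b0.trans ?_
        gcongr ‖fderiv ℝ g x - φ' x‖ₑ + ?_
        have b2 : ‖(φ' x).smulRight (Complex.I * ((Circle.exp (g x) : ℂ) - Circle.exp (φ x)))‖ₑ =
            ‖φ' x‖ₑ * ‖(Circle.exp (g x) : ℂ) - Circle.exp (φ x)‖ₑ := by
          rw [← ofReal_norm, ContinuousLinearMap.norm_smulRight_apply,
            ENNReal.ofReal_mul (norm_nonneg _), ofReal_norm, ofReal_norm, enorm_mul]
          simp [← ofReal_norm]
        rw [b2]
        by_cases hx : R ≤ ‖φ' x‖₊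
        · rw [indicator_of_mem (by exact hx), mul_comm]
          refine le_add_of_nonneg_of_le zero_le ?_
          gcongr
          rw [← ofReal_norm]
          refine ENNReal.ofReal_le_of_le_toReal ((norm_sub_le _ _).trans ?_)
          simp only [Circle.norm_coe, ENNReal.toReal_ofNat]
          norm_num
        · refine le_add_of_le_of_nonneg ?_ zero_le
          gcongr
          · rw [← ofReal_norm]
            exact ENNReal.ofReal_le_ofReal (le_of_not_ge hx)
          · rw [← ofReal_norm, ← ofReal_norm]
            exact ENNReal.ofReal_le_ofReal (norm_coe_exp_sub_coe_exp_le _ _)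
      have m1 : AEMeasurable (fun x => ‖fderiv ℝ g x - φ' x‖ₑ) (volume.restrict K) :=
        ((hg.continuous_fderiv (by simp)).aestronglyMeasurable.sub i1.1).enorm
      have m2 : AEMeasurable (fun x => ENNReal.ofReal R * ‖g x - φ x‖ₑ) (volume.restrict K) :=
        ((hg.continuous.aestronglyMeasurable.sub i0.1).enorm).const_mul _
      calc _ ≤ _ := lintegral_mono key
        _ = (∫⁻ x in K, ‖fderiv ℝ g x - φ' x‖ₑ) + ENNReal.ofReal R * (∫⁻ x in K, ‖g x - φ x‖ₑ) +
            2 * ∫⁻ x in K, ‖{x | R ≤ ‖φ' x‖₊}.indicator φ' x‖ₑ := by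
          rw [lintegral_add_left' (f := fun x => _ + _) (m1.add m2), lintegral_add_left' m1,
            lintegral_const_mul' _ _ ENNReal.ofReal_ne_top, lintegral_const_mul' _ _ (by simp)]
        _ ≤ (η + ENNReal.ofReal R * η) + 2 * ENNReal.ofReal ε' := by gcongr
        _ ≤ ε / 2 + ε / 2 := by
          gcongr
          calc (η : ℝ≥0∞) + ENNReal.ofReal R * η = η * (1 + ENNReal.ofReal R) := by ring
            _ ≤ ε / 2 := hη.le
        _ = ε := ENNReal.add_halves ε

/-- A function with vanishing weak derivative on a ball is constant there. -/
lemma HasWeakFDerivOn.exists_ae_eq_const [CompleteSpace F] {c : EuclideanSpace ℝ (Fin m)} {r : ℝ}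
    (hr : 0 < r) {f : EuclideanSpace ℝ (Fin m) → F} (h : HasWeakFDerivOn (ball c r) f 0) :
    ∃ a : F, ∀ᵐ x ∂(volume.restrict (ball c r)), f x = a := by
  have hK : ∀ n : ℕ, closedBall c (r * (1 - 1 / (n + 2))) ⊆ ball c r := by
    intro n
    refine closedBall_subset_ball ?_
    have : 0 < 1 / ((n : ℝ) + 2) := by positivity
    nlinarith
  have h1 : ∀ n : ℕ, ∀ᵐ x ∂(volume.restrict (closedBall c (r * (1 - 1 / (n + 2))))),
      ∀ᵐ y ∂(volume.restrict (closedBall c (r * (1 - 1 / (n + 2))))), f x = f y := by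
    intro n
    set K := closedBall c (r * (1 - 1 / ((n : ℝ) + 2))) with hKdef
    have hKc : IsCompact K := isCompact_closedBall _ _
    have i0 := h.locallyIntegrableOn.integrableOn_compact_subset (hK n) hKc
    have hm : AEMeasurable (Function.uncurry fun x y => ‖f x - f y‖ₑ)
        ((volume.restrict K).prod (volume.restrict K)) :=
      (i0.1.comp_fst.sub i0.1.comp_snd).enorm
    have hzero : ∫⁻ x in K, ∫⁻ y in K, ‖f x - f y‖ₑ = 0 := by
      refine le_antisymm (ENNReal.le_of_forall_pos_le_add fun ε hε _ => ?_) zero_le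
      rw [zero_add]
      have hvol : volume K ≠ ⊤ := hKc.measure_lt_top.ne
      obtain ⟨η, hη0, hη⟩ := ENNReal.exists_nnreal_pos_mul_lt (a := 2 * volume K)
        (by finiteness) (ENNReal.coe_ne_zero.2 hε.ne')
      obtain ⟨g, hg, hgf, -, hg0⟩ := h.exists_contDiff_approx isOpen_ball hKc (hK n)
        (ENNReal.coe_ne_zero.2 hη0.ne')
      have hg0 := hg0 fun x _ => rfl
      -- The approximant has exactly zero derivative on the convex set `K`, so it is constant there
      -- and `f x - f y` is a difference of two approximation errors.
      have hconst : ∀ x ∈ K, ∀ y ∈ K, g x = g y := by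
        intro x hx y hy
        have hconv : Convex ℝ K := convex_closedBall _ _
        have := hconv.norm_image_sub_le_of_norm_fderiv_le (f := g) (C := 0)
          (fun z _ => hg.differentiable (by simp) z)
          (fun z hz => by rw [hg0 z hz, norm_zero]) hy hx
        rw [zero_mul] at this
        exact sub_eq_zero.1 (norm_le_zero_iff.1 this)
      have m1 : AEMeasurable (fun x => ‖g x - f x‖ₑ) (volume.restrict K) :=
        (hg.continuous.aestronglyMeasurable.sub i0.1).enorm
      calc ∫⁻ x in K, ∫⁻ y in K, ‖f x - f y‖ₑ
          ≤ ∫⁻ x in K, ∫⁻ y in K, (‖g x - f x‖ₑ + ‖g y - f y‖ₑ) := by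
            refine setLIntegral_mono' hKc.measurableSet fun x hx => ?_
            refine setLIntegral_mono' hKc.measurableSet fun y hy => ?_
            have : f x - f y = -(g x - f x) + (g y - f y) := by
              rw [hconst x hx y hy]; abel
            rw [this]
            exact (enorm_add_le _ _).trans (by rw [enorm_neg])
        _ = ∫⁻ x in K, (‖g x - f x‖ₑ * volume K + ∫⁻ y in K, ‖g y - f y‖ₑ) := by
            refine lintegral_congr fun x => ?_
            rw [lintegral_add_left measurable_const, setLIntegral_const]
        _ = (∫⁻ x in K, ‖g x - f x‖ₑ) * volume K + (∫⁻ x in K, ‖g x - f x‖ₑ) * volume K := by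
            rw [lintegral_add_left' (m1.mul_const _), lintegral_mul_const' _ _ hvol,
              setLIntegral_const]
        _ ≤ η * volume K + η * volume K := by gcongr
        _ = η * (2 * volume K) := by ring
        _ ≤ ε := hη.le
    have hzero := (lintegral_eq_zero_iff' (by exact hm.lintegral_prod_right')).1 hzero
    have hmx : ∀ x, AEMeasurable (fun y => ‖f x - f y‖ₑ) (volume.restrict K) := fun x =>
      (aestronglyMeasurable_const.sub i0.1).enorm
    filter_upwards [hzero] with x hx
    have := (lintegral_eq_zero_iff' (hmx x)).1 hx
    filter_upwards [this] with y hy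
    exact sub_eq_zero.1 (enorm_eq_zero.1 hy)
  have h2 : ∀ᵐ x ∂(volume.restrict (ball c r)), ∀ n : ℕ,
      x ∈ closedBall c (r * (1 - 1 / (n + 2))) →
      ∀ᵐ y ∂(volume.restrict (closedBall c (r * (1 - 1 / (n + 2))))), f x = f y := by
    refine ae_restrict_of_ae (ae_all_iff.2 fun n => ?_)
    exact (ae_restrict_iff' measurableSet_closedBall).1 (h1 n)
  have hne : NeBot (ae (volume.restrict (ball c r))) := by
    rw [ae_neBot, Ne, Measure.restrict_eq_zero]
    exact (measure_ball_pos volume c hr).ne'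
  have hlim : ∀ x ∈ ball c r, ∃ N : ℕ, ∀ n ≥ N, x ∈ closedBall c (r * (1 - 1 / ((n : ℝ) + 2))) := by
    intro x hx
    have ht : Tendsto (fun n : ℕ => r * (1 - 1 / ((n : ℝ) + 2))) atTop (𝓝 (r * (1 - 0))) := by
      refine (tendsto_const_nhds.sub ?_).const_mul r
      have : Tendsto (fun n : ℕ => (n : ℝ) + 2) atTop atTop :=
        tendsto_atTop_add_const_right _ _ tendsto_natCast_atTop_atTop
      simp only [one_div]
      exact this.inv_tendsto_atTop
    rw [sub_zero, mul_one] at ht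
    obtain ⟨N, hN⟩ := eventually_atTop.1 (ht.eventually (lt_mem_nhds (mem_ball.1 hx)))
    exact ⟨N, fun n hn => (hN n hn).le⟩
  -- One point `x` that is good for all the exhausting balls at once supplies the constant `f x`.
  obtain ⟨x, hx, hxb⟩ := (h2.and (ae_restrict_mem measurableSet_ball)).exists
  refine ⟨f x, ?_⟩
  obtain ⟨N, hN⟩ := hlim x hxb
  have h3 : ∀ᵐ y, ∀ n ≥ N, y ∈ closedBall c (r * (1 - 1 / ((n : ℝ) + 2))) → f x = f y :=
    ae_all_iff.2 fun n => by
      by_cases hn : n ≥ N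
      · filter_upwards [(ae_restrict_iff' measurableSet_closedBall).1 (hx n (hN n hn))] with y hy _
        exact hy
      · exact ae_of_all _ fun y h => absurd h hn
  rw [ae_restrict_iff' measurableSet_ball]
  filter_upwards [h3] with y hy hyb
  obtain ⟨N', hN'⟩ := hlim y hyb
  exact (hy (max N N') (le_max_left _ _) (hN' _ (le_max_right _ _))).symm

end Lift
end

/-! ### Charts are locally bi-Lipschitz for the Riemannian distance. -/

section Local
attribute [local instance] normedAddCommGroupTangentSpaceVectorSpace
  normedSpaceTangentSpaceVectorSpace
variable {m : ℕ} {M : Type*} [EMetricSpace M]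
  [ChartedSpace (EuclideanSpace ℝ (Fin m)) M] [IsManifold (𝓡 m) ∞ M]
  [RiemannianBundle (fun x : M => TangentSpace (𝓡 m) x)]
  [IsContMDiffRiemannianBundle (𝓡 m) ∞ (EuclideanSpace ℝ (Fin m))
      (fun x : M => TangentSpace (𝓡 m) x)]
  [IsRiemannianManifold (𝓡 m) M]

lemma isContinuousRiemannianBundle_tangentSpace (m : ℕ) (M : Type*) [EMetricSpace M]
    [ChartedSpace (EuclideanSpace ℝ (Fin m)) M] [IsManifold (𝓡 m) ∞ M]
    [RiemannianBundle (fun x : M => TangentSpace (𝓡 m) x)]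
    [IsContMDiffRiemannianBundle (𝓡 m) ∞ (EuclideanSpace ℝ (Fin m))
      (fun x : M => TangentSpace (𝓡 m) x)] :
    IsContinuousRiemannianBundle (EuclideanSpace ℝ (Fin m))
      (fun x : M => TangentSpace (𝓡 m) x) := by
  obtain ⟨g, hg⟩ := IsContMDiffRiemannianBundle.exists_contMDiff (IB := 𝓡 m) (n := ∞)
    (F := EuclideanSpace ℝ (Fin m)) (E := fun x : M => TangentSpace (𝓡 m) x)
  have : IsManifold (𝓡 m) 1 M := IsManifold.of_le (n := ∞) (by norm_num)
  exact ⟨⟨g, hg.1.continuous, hg.2⟩⟩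

/-- The derivative of the inverse chart is bounded near the centre by continuity of the metric.
Balls are convex, so the image of a segment is an admissible path, whose Riemannian length bounds
the distance. -/
lemma exists_ball_edist_extChartAt_symm_le (x₀ : M) :
    ∃ ρ > (0 : ℝ), ∃ C : ℝ≥0, ball (extChartAt (𝓡 m) x₀ x₀) ρ ⊆ (extChartAt (𝓡 m) x₀).target ∧
      (∀ y ∈ ball (extChartAt (𝓡 m) x₀ x₀) ρ, ∀ v : EuclideanSpace ℝ (Fin m),
        ‖mfderiv 𝓘(ℝ, EuclideanSpace ℝ (Fin m)) (𝓡 m) (extChartAt (𝓡 m) x₀).symm y v‖ₑ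
          ≤ C * ‖v‖ₑ) ∧
      ∀ y ∈ ball (extChartAt (𝓡 m) x₀ x₀) ρ, ∀ z ∈ ball (extChartAt (𝓡 m) x₀ x₀) ρ,
        edist ((extChartAt (𝓡 m) x₀).symm y) ((extChartAt (𝓡 m) x₀).symm z) ≤ C * edist y z := by
  have := isContinuousRiemannianBundle_tangentSpace m M
  have : IsManifold (𝓡 m) 1 M := IsManifold.of_le (n := ∞) (by norm_num)
  rcases eventually_enorm_mfderivWithin_symm_extChartAt_lt (𝓡 m) x₀ with ⟨C, C_pos, hC⟩
  obtain ⟨r, r_pos, hr⟩ :=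
    mem_nhdsWithin_iff.1 (inter_mem (extChartAt_target_mem_nhdsWithin x₀) hC)
  have hr1 : ball (extChartAt (𝓡 m) x₀ x₀) r ⊆ (extChartAt (𝓡 m) x₀).target :=
    fun y hy => (hr ⟨hy, by simp⟩).1
  have hr2 : ∀ y ∈ ball (extChartAt (𝓡 m) x₀ x₀) r, ∀ v : EuclideanSpace ℝ (Fin m),
        ‖mfderiv 𝓘(ℝ, EuclideanSpace ℝ (Fin m)) (𝓡 m) (extChartAt (𝓡 m) x₀).symm y v‖ₑ
          ≤ C * ‖v‖ₑ := by
    intro y hy v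
    have h := (hr ⟨hy, by simp⟩).2
    have e : range (𝓡 m) = univ := by simp
    simp only [mem_ofPred_eq, e, mfderivWithin_univ] at h
    exact (ContinuousLinearMap.le_opENorm _ _).trans (mul_le_mul' h.le le_rfl)
  refine ⟨r, r_pos, C, hr1, hr2, ?_⟩
  intro y hy z hz
  rw [IsRiemannianManifold.out (I := 𝓡 m)]
  let η := ContinuousAffineMap.lineMap (R := ℝ) y z
  set γ := (extChartAt (𝓡 m) x₀).symm ∘ η with hγ
  have hη : Icc 0 1 ⊆ ⇑η ⁻¹' ball (extChartAt (𝓡 m) x₀ x₀) r := by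
    simp only [← image_subset_iff, ContinuousAffineMap.coe_lineMap_eq,
     ← segment_eq_image_lineMap, η]
    exact (convex_ball _ _).segment_subset hy hz
  have η_smooth : CMDiff[Icc 0 1] 1 η := by
    apply ContMDiff.contMDiffOn
    rw [contMDiff_iff_contDiff]
    exact ContinuousAffineMap.contDiff _
  have : riemannianEDist (𝓡 m) ((extChartAt (𝓡 m) x₀).symm y) ((extChartAt (𝓡 m) x₀).symm z)
      ≤ pathELength (𝓡 m) γ 0 1 := by
    apply riemannianEDist_le_pathELength _ _ _ zero_le_one
    · exact (contMDiffOn_extChartAt_symm x₀).comp η_smooth (hη.trans (preimage_mono hr1))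
    · simp [γ, η, ContinuousAffineMap.coe_lineMap_eq]
    · simp [γ, η, ContinuousAffineMap.coe_lineMap_eq]
  apply this.trans
  rw [← lintegral_fderiv_lineMap_eq_edist, pathELength_eq_lintegral_mfderivWithin_Icc,
    ← lintegral_const_mul' _ _ ENNReal.coe_ne_top]
  apply setLIntegral_mono' measurableSet_Icc (fun t ht ↦ ?_)
  have : mfderivWithin 𝓘(ℝ, ℝ) (𝓡 m) γ (Icc 0 1) t =
      (mfderiv 𝓘(ℝ, EuclideanSpace ℝ (Fin m)) (𝓡 m) (extChartAt (𝓡 m) x₀).symm (η t)) ∘L (mfderiv[Icc 0 1] η t) := by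
    apply mfderiv_comp_mfderivWithin
    · have := mdifferentiableWithinAt_extChartAt_symm (I := 𝓡 m) (hr1 (hη ht))
      rwa [show range (𝓡 m) = univ by simp, mdifferentiableWithinAt_univ] at this
    · exact η_smooth.mdifferentiableOn one_ne_zero t ht
    · rw [uniqueMDiffWithinAt_iff_uniqueDiffWithinAt]
      exact uniqueDiffOn_Icc zero_lt_one t ht
  have : mfderivWithin 𝓘(ℝ, ℝ) (𝓡 m) γ (Icc 0 1) t 1 =
      (mfderiv 𝓘(ℝ, EuclideanSpace ℝ (Fin m)) (𝓡 m) (extChartAt (𝓡 m) x₀).symm (η t)) (mfderiv[Icc 0 1] η t 1) := congr($this 1)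
  rw [this]
  refine (hr2 _ (hη ht) _).trans ?_
  gcongr
  simp only [mfderivWithin_eq_fderivWithin]
  exact le_of_eq rfl

/-- The chart is applied to a nearly minimizing path. The derivative is bounded only near `x₀`, so
the path has to be confined, which is achieved by taking the endpoints close to `x₀` relative to the
ball where the bound holds. -/
lemma exists_nhds_edist_extChartAt_le (x₀ : M) :
    ∃ V : Set M, IsOpen V ∧ x₀ ∈ V ∧ ∃ C : ℝ≥0, V ⊆ (extChartAt (𝓡 m) x₀).source ∧
      (∀ x ∈ V, ∀ v : TangentSpace (𝓡 m) x,
        ‖(mfderiv (𝓡 m) 𝓘(ℝ, EuclideanSpace ℝ (Fin m)) (extChartAt (𝓡 m) x₀) x v :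
          EuclideanSpace ℝ (Fin m))‖ₑ ≤ C * ‖v‖ₑ) ∧
      ∀ x ∈ V, ∀ y ∈ V,
        edist (extChartAt (𝓡 m) x₀ x) (extChartAt (𝓡 m) x₀ y) ≤ C * edist x y := by
  have := isContinuousRiemannianBundle_tangentSpace m M
  have : IsManifold (𝓡 m) 1 M := IsManifold.of_le (n := ∞) (by norm_num)
  rcases eventually_enorm_mfderiv_extChartAt_lt (𝓡 m) x₀ with ⟨C, C_pos, hC⟩
  obtain ⟨δ, δ_pos, hδ⟩ := EMetric.mem_nhds_iff.1
    (Filter.inter_mem hC (extChartAt_source_mem_nhds (I := 𝓡 m) x₀))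
  have hδ2 : ∀ x ∈ Metric.eball x₀ δ, ∀ v : TangentSpace (𝓡 m) x,
        ‖(mfderiv (𝓡 m) 𝓘(ℝ, EuclideanSpace ℝ (Fin m)) (extChartAt (𝓡 m) x₀) x v :
          EuclideanSpace ℝ (Fin m))‖ₑ ≤ C * ‖v‖ₑ := by
    intro x hx v
    have h := (hδ hx).1
    simp only [mem_ofPred_eq] at h
    exact (ContinuousLinearMap.le_opENorm _ _).trans (mul_le_mul' h.le le_rfl)
  have hsub : Metric.eball x₀ (δ / 4) ⊆ Metric.eball x₀ δ :=
    Metric.eball_subset_eball (ENNReal.div_le_of_le_mul (by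
      nth_rw 1 [← mul_one δ]; gcongr; norm_num))
  -- Two points within `δ / 4` of `x₀` are less than `δ / 2` apart; a path of length below `δ / 2`
  -- from one of them stays within `3 δ / 4` of `x₀`.
  refine ⟨Metric.eball x₀ (δ / 4), Metric.isOpen_eball, Metric.mem_eball_self
    (ENNReal.div_pos δ_pos.ne' (by simp)), C, fun x hx => (hδ (hsub hx)).2,
    fun x hx => hδ2 x (hsub hx), fun x hx y hy => ?_⟩
  have hxy : edist x y < δ / 4 + δ / 4 := (edist_triangle_right x y x₀).trans_lt
    (ENNReal.add_lt_add hx hy)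
  have hδ3 : δ / 4 + δ / 4 + δ / 4 ≤ δ := by
    calc δ / 4 + δ / 4 + δ / 4 = δ * (4⁻¹ + 4⁻¹ + 4⁻¹) := by
          simp only [div_eq_mul_inv, mul_add]
      _ ≤ δ * (4⁻¹ + 4⁻¹ + 4⁻¹ + 4⁻¹) := by gcongr; exact le_self_add
      _ = δ * 1 := by
          congr 1
          rw [show (4⁻¹ + 4⁻¹ + 4⁻¹ + 4⁻¹ : ℝ≥0∞) = 4 * 4⁻¹ by ring]
          exact ENNReal.mul_inv_cancel (by norm_num) (by norm_num)
      _ = δ := mul_one δ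
  rw [mul_comm, ← ENNReal.div_le_iff_le_mul (by simp [C_pos.ne']) (by simp)]
  refine le_of_forall_gt fun r hr => ?_
  have hr' : riemannianEDist (𝓡 m) x y < min r (δ / 4 + δ / 4) := by
    rw [← IsRiemannianManifold.out (I := 𝓡 m)]
    exact lt_min hr hxy
  rcases exists_lt_locally_constant_of_riemannianEDist_lt hr' zero_lt_one
    with ⟨γ, hγx, hγy, γ_smooth, hγ, -⟩
  have hmem : ∀ t ∈ Icc (0 : ℝ) 1, γ t ∈ Metric.eball x₀ δ := by
    intro t ht
    have h1 : edist (γ t) x < δ / 4 + δ / 4 := by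
      rw [edist_comm, IsRiemannianManifold.out (I := 𝓡 m)]
      refine (riemannianEDist_le_pathELength (γ_smooth.contMDiffOn (s := Icc 0 t)) hγx rfl
        ht.1).trans_lt (lt_of_le_of_lt (pathELength_mono le_rfl ht.2) (hγ.trans_le
          (min_le_right _ _)))
    exact (edist_triangle (γ t) x x₀).trans_lt ((ENNReal.add_lt_add h1 hx).trans_le hδ3)
  let γ' := extChartAt (𝓡 m) x₀ ∘ γ
  have hC' : ContMDiffOn 𝓘(ℝ, ℝ) 𝓘(ℝ, EuclideanSpace ℝ (Fin m)) 1 γ' (Icc 0 1) :=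
    contMDiffOn_extChartAt.comp (I' := 𝓡 m)
      (t := (chartAt (EuclideanSpace ℝ (Fin m)) x₀).source)
      γ_smooth.contMDiffOn (fun t' ht' ↦ by
        have := (hδ (hmem t' ht')).2
        rwa [extChartAt_source] at this)
  have key : ‖γ' 1 - γ' 0‖ₑ ≤ C * pathELength (𝓡 m) γ 0 1 := by
    calc
      ‖γ' 1 - γ' 0‖ₑ
      _ ≤ ∫⁻ t' in Icc 0 1, ‖derivWithin γ' (Icc 0 1) t'‖ₑ := by
        apply enorm_sub_le_lintegral_derivWithin_Icc_of_contDiffOn_Icc _ zero_le_one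
        rwa [← contMDiffOn_iff_contDiffOn]
      _ = ∫⁻ t' in Icc 0 1, ‖(mfderivWithin 𝓘(ℝ, ℝ) 𝓘(ℝ, EuclideanSpace ℝ (Fin m)) γ'
            (Icc 0 1) t' (1 : ℝ) : EuclideanSpace ℝ (Fin m))‖ₑ := by
        simp_rw [← fderivWithin_derivWithin, mfderivWithin_eq_fderivWithin]
        rfl
      _ ≤ ∫⁻ t' in Icc 0 1, C * ‖mfderivWithin 𝓘(ℝ, ℝ) (𝓡 m) γ (Icc 0 1) t' 1‖ₑ := by
        apply setLIntegral_mono' measurableSet_Icc (fun t' ht' ↦ ?_)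
        have : mfderivWithin 𝓘(ℝ, ℝ) 𝓘(ℝ, EuclideanSpace ℝ (Fin m)) γ' (Icc 0 1) t' =
            (mfderiv (𝓡 m) 𝓘(ℝ, EuclideanSpace ℝ (Fin m)) (extChartAt (𝓡 m) x₀) (γ t')) ∘L
              (mfderivWithin 𝓘(ℝ, ℝ) (𝓡 m) γ (Icc 0 1) t') := by
          apply mfderiv_comp_mfderivWithin
          · refine mdifferentiableAt_extChartAt ?_
            have := (hδ (hmem t' ht')).2
            simpa only [extChartAt_source] using this
          · exact (γ_smooth.mdifferentiable one_ne_zero).mdifferentiableOn _ ht'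
          · rw [uniqueMDiffWithinAt_iff_uniqueDiffWithinAt]
            exact uniqueDiffOn_Icc zero_lt_one _ ht'
        rw [this]
        exact hδ2 _ (hmem t' ht') _
      _ = C * pathELength (𝓡 m) γ 0 1 := by
        rw [lintegral_const_mul' _ _ ENNReal.coe_ne_top,
            pathELength_eq_lintegral_mfderivWithin_Icc]
  have key2 : edist (extChartAt (𝓡 m) x₀ x) (extChartAt (𝓡 m) x₀ y)
      ≤ C * pathELength (𝓡 m) γ 0 1 := by
    rw [edist_comm, edist_eq_enorm_sub, ← hγx, ← hγy]
    exact key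
  refine lt_of_le_of_lt ?_ (hγ.trans_le (min_le_left _ _))
  rwa [ENNReal.div_le_iff_le_mul (by simp [C_pos.ne']) (by simp), mul_comm]

lemma exists_bilipschitz_extChartAt (x₀ : M) :
    ∃ ρ > (0 : ℝ), ∃ C : ℝ≥0, ball (extChartAt (𝓡 m) x₀ x₀) ρ ⊆ (extChartAt (𝓡 m) x₀).target ∧
      (∀ y ∈ ball (extChartAt (𝓡 m) x₀ x₀) ρ, ∀ v : EuclideanSpace ℝ (Fin m),
        ‖mfderiv 𝓘(ℝ, EuclideanSpace ℝ (Fin m)) (𝓡 m) (extChartAt (𝓡 m) x₀).symm y v‖ₑ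
          ≤ C * ‖v‖ₑ) ∧
      (∀ y ∈ ball (extChartAt (𝓡 m) x₀ x₀) ρ, ∀ z ∈ ball (extChartAt (𝓡 m) x₀ x₀) ρ,
        edist ((extChartAt (𝓡 m) x₀).symm y) ((extChartAt (𝓡 m) x₀).symm z) ≤ C * edist y z) ∧
      (∀ x ∈ (extChartAt (𝓡 m) x₀).source ∩
          extChartAt (𝓡 m) x₀ ⁻¹' ball (extChartAt (𝓡 m) x₀ x₀) ρ,
        ∀ v : TangentSpace (𝓡 m) x,
        ‖(mfderiv (𝓡 m) 𝓘(ℝ, EuclideanSpace ℝ (Fin m)) (extChartAt (𝓡 m) x₀) x v :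
          EuclideanSpace ℝ (Fin m))‖ₑ ≤ C * ‖v‖ₑ) ∧
      (∀ x ∈ (extChartAt (𝓡 m) x₀).source ∩
          extChartAt (𝓡 m) x₀ ⁻¹' ball (extChartAt (𝓡 m) x₀ x₀) ρ,
        ∀ y ∈ (extChartAt (𝓡 m) x₀).source ∩
          extChartAt (𝓡 m) x₀ ⁻¹' ball (extChartAt (𝓡 m) x₀ x₀) ρ,
        edist (extChartAt (𝓡 m) x₀ x) (extChartAt (𝓡 m) x₀ y) ≤ C * edist x y) := by
  obtain ⟨ρ, hρ, C, h1, h2, h3⟩ := exists_ball_edist_extChartAt_symm_le (m := m) x₀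
  obtain ⟨V, hV, hxV, C', h4, h5, h6⟩ := exists_nhds_edist_extChartAt_le (m := m) x₀
  obtain ⟨ρ', hρ', hsub⟩ := Metric.mem_nhds_iff.1
    (extChartAt_preimage_mem_nhds (I := 𝓡 m) (hV.mem_nhds hxV))
  have hU : ∀ x ∈ (extChartAt (𝓡 m) x₀).source ∩
      extChartAt (𝓡 m) x₀ ⁻¹' ball (extChartAt (𝓡 m) x₀ x₀) (min ρ ρ'), x ∈ V := by
    intro x hx
    have := hsub (ball_subset_ball (min_le_right _ _) hx.2)
    rwa [mem_preimage, (extChartAt (𝓡 m) x₀).left_inv hx.1] at this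
  have hle : ball (extChartAt (𝓡 m) x₀ x₀) (min ρ ρ') ⊆ ball (extChartAt (𝓡 m) x₀ x₀) ρ :=
    ball_subset_ball (min_le_left _ _)
  refine ⟨min ρ ρ', lt_min hρ hρ', max C C', hle.trans h1, fun y hy v => ?_, fun y hy z hz => ?_,
    fun x hx v => ?_, fun x hx y hy => ?_⟩
  · exact (h2 y (hle hy) v).trans (by gcongr; exact le_max_left _ _)
  · exact (h3 y (hle hy) z (hle hz)).trans (by gcongr; exact le_max_left _ _)
  · exact (h5 x (hU x hx) v).trans (by gcongr; exact le_max_right _ _)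
  · exact (h6 x (hU x hx) y (hU y hy)).trans (by gcongr; exact le_max_right _ _)

end Local

/-! ### Hausdorff measure under Lipschitz maps. -/

section Measure

variable {X Y : Type*} [EMetricSpace X] [MeasurableSpace X] [BorelSpace X]
  [EMetricSpace Y] [MeasurableSpace Y] [BorelSpace Y]

lemma euclideanHausdorffMeasure_image_le {f : X → Y} {s : Set X} {C : ℝ≥0} (m : ℕ)
    (hf : ∀ x ∈ s, ∀ y ∈ s, edist (f x) (f y) ≤ C * edist x y) :
    μHE[m] (f '' s) ≤ (C : ℝ≥0∞) ^ m * μHE[m] s := by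
  have h : LipschitzOnWith C f s := fun x hx y hy => hf x hx y hy
  have := h.hausdorffMeasure_image_le (d := m) (by positivity)
  simp only [Measure.euclideanHausdorffMeasure_def, Measure.smul_apply]
  rw [mul_smul_comm]
  gcongr
  simpa using this

/-- The map `f` is injective on `s` with a `C`-Lipschitz inverse, and the preimage of a set is its
image under this inverse. -/
lemma map_restrict_euclideanHausdorffMeasure_le {f : X → Y} {s : Set X} {C : ℝ≥0} (m : ℕ)
    (hs : MeasurableSet s) (hfm : AEMeasurable f ((μHE[m] : Measure X).restrict s))
    (hf : ∀ x ∈ s, ∀ y ∈ s, edist x y ≤ C * edist (f x) (f y)) :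
    ((μHE[m] : Measure X).restrict s).map f ≤ ((C : ℝ≥0∞) ^ m) • (μHE[m] : Measure Y).restrict (f '' s) := by
  rcases s.eq_empty_or_nonempty with rfl | ⟨x₁, hx₁⟩
  · simp
  have : Nonempty X := ⟨x₁⟩
  refine Measure.le_iff.2 fun E hE => ?_
  rw [Measure.map_apply_of_aemeasurable hfm hE, Measure.restrict_apply' hs, Measure.smul_apply,
    Measure.restrict_apply hE]
  have hinj : InjOn f s := fun x hx y hy hxy => by
    have := hf x hx y hy
    rw [hxy, edist_self, mul_zero] at this
    exact edist_le_zero.1 this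
  have heq : f ⁻¹' E ∩ s = Function.invFunOn f s '' (E ∩ f '' s) := by
    ext x
    constructor
    · rintro ⟨hxE, hxs⟩
      exact ⟨f x, ⟨hxE, mem_image_of_mem f hxs⟩, hinj.leftInvOn_invFunOn hxs⟩
    · rintro ⟨_, ⟨hyE, z, hz, rfl⟩, rfl⟩
      rw [hinj.leftInvOn_invFunOn hz]
      exact ⟨hyE, hz⟩
  rw [heq]
  refine euclideanHausdorffMeasure_image_le m ?_
  rintro _ ⟨-, x, hx, rfl⟩ _ ⟨-, y, hy, rfl⟩
  rw [hinj.leftInvOn_invFunOn hx, hinj.leftInvOn_invFunOn hy]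
  exact hf x hx y hy

end Measure

/-! ### Tail integrals of the kernel in Euclidean space. -/

section Tail

variable {m : ℕ}

/-- Comparison with the integrable `(1 + |z|) ^ (-r)`, since `1 + |z| ≤ 2 |z|` when `|z| ≥ 1`. -/
lemma lintegral_inv_enorm_rpow_lt_top {r : ℝ} (hr : (m : ℝ) < r) :
    ∫⁻ z in {z : EuclideanSpace ℝ (Fin m) | 1 ≤ ‖z‖ₑ}, (‖z‖ₑ ^ r)⁻¹ < ⊤ := by
  have hr0 : 0 ≤ r := (Nat.cast_nonneg m).trans hr.le
  have h1 : Integrable fun z : EuclideanSpace ℝ (Fin m) => (1 + ‖z‖) ^ (-r) :=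
    integrable_one_add_norm (by simpa using hr)
  have h2 := h1.hasFiniteIntegral
  have hms : MeasurableSet {z : EuclideanSpace ℝ (Fin m) | 1 ≤ ‖z‖ₑ} :=
    measurableSet_le measurable_const measurable_enorm
  calc _ ≤ ∫⁻ z in {z : EuclideanSpace ℝ (Fin m) | 1 ≤ ‖z‖ₑ},
        ENNReal.ofReal (2 ^ r) * ‖(1 + ‖z‖) ^ (-r)‖ₑ := by
        refine setLIntegral_mono' hms fun z hz => ?_
        have hz1 : 1 ≤ ‖z‖ := by
          have h : 1 ≤ ‖z‖ₑ := hz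
          rw [← ofReal_norm, ← ENNReal.ofReal_one] at h
          exact (ENNReal.ofReal_le_ofReal_iff (norm_nonneg _)).1 h
        have hz0 : 0 < ‖z‖ := by linarith
        rw [← ofReal_norm, ENNReal.ofReal_rpow_of_pos hz0,
          ← ENNReal.ofReal_inv_of_pos (by positivity),
          Real.enorm_eq_ofReal (by positivity), ← ENNReal.ofReal_mul (by positivity)]
        refine ENNReal.ofReal_le_ofReal ?_
        rw [Real.rpow_neg (by positivity), ← div_eq_mul_inv, inv_eq_one_div,
          div_le_div_iff₀ (by positivity) (by positivity), one_mul,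
          ← Real.mul_rpow (by norm_num) hz0.le]
        exact Real.rpow_le_rpow (by positivity) (by linarith) hr0
    _ ≤ ∫⁻ z, ENNReal.ofReal (2 ^ r) * ‖(1 + ‖z‖) ^ (-r)‖ₑ := setLIntegral_le_lintegral _ _
    _ < ⊤ := by
        rw [lintegral_const_mul' _ _ ENNReal.ofReal_ne_top]
        exact ENNReal.mul_lt_top ENNReal.ofReal_lt_top h2

/-- The integral of `|z|⁻ʳ` outside of a ball, by scaling. -/
lemma lintegral_inv_enorm_rpow_eq {r : ℝ} {t : ℝ} (ht : 0 < t) :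
    ∫⁻ z in {z : EuclideanSpace ℝ (Fin m) | ENNReal.ofReal t ≤ ‖z‖ₑ}, (‖z‖ₑ ^ r)⁻¹ =
      ENNReal.ofReal t ^ ((m : ℝ) - r) *
        ∫⁻ z in {z : EuclideanSpace ℝ (Fin m) | 1 ≤ ‖z‖ₑ}, (‖z‖ₑ ^ r)⁻¹ := by
  have hms : ∀ a : ℝ≥0∞, MeasurableSet {z : EuclideanSpace ℝ (Fin m) | a ≤ ‖z‖ₑ} := fun a =>
    measurableSet_le measurable_const measurable_enorm
  set k : EuclideanSpace ℝ (Fin m) → ℝ≥0∞ :=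
    {z : EuclideanSpace ℝ (Fin m) | ENNReal.ofReal t ≤ ‖z‖ₑ}.indicator fun z => (‖z‖ₑ ^ r)⁻¹ with hk
  have hkm : Measurable k := ((measurable_enorm.pow_const r).inv).indicator (hms _)
  have ht0 : ENNReal.ofReal t ≠ 0 := by simpa using ht
  have htt : ENNReal.ofReal t ≠ ⊤ := ENNReal.ofReal_ne_top
  have h1 : ∫⁻ z, k (t • z) = ENNReal.ofReal (t ^ m)⁻¹ * ∫⁻ z, k z := by
    have := Measure.map_addHaar_smul (volume : Measure (EuclideanSpace ℝ (Fin m))) ht.ne'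
    rw [← lintegral_map hkm (measurable_const_smul t), this, lintegral_smul_measure,
      finrank_euclideanSpace_fin, abs_of_pos (by positivity), smul_eq_mul]
  have h2 : ∀ z, k (t • z) = ENNReal.ofReal t ^ (-r) *
      {z : EuclideanSpace ℝ (Fin m) | 1 ≤ ‖z‖ₑ}.indicator (fun z => (‖z‖ₑ ^ r)⁻¹) z := by
    intro z
    have e : ‖t • z‖ₑ = ENNReal.ofReal t * ‖z‖ₑ := by
      rw [enorm_smul, Real.enorm_eq_ofReal ht.le]
    have hiff : t • z ∈ {z : EuclideanSpace ℝ (Fin m) | ENNReal.ofReal t ≤ ‖z‖ₑ} ↔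
        z ∈ {z : EuclideanSpace ℝ (Fin m) | 1 ≤ ‖z‖ₑ} := by
      simp only [mem_ofPred_eq, e]
      nth_rw 1 [← mul_one (ENNReal.ofReal t)]
      exact ENNReal.mul_le_mul_iff_right ht0 htt
    by_cases hz : z ∈ {z : EuclideanSpace ℝ (Fin m) | 1 ≤ ‖z‖ₑ}
    · rw [hk, indicator_of_mem (hiff.2 hz), indicator_of_mem hz, e,
        ENNReal.mul_rpow_of_ne_top htt (by simp),
        ENNReal.mul_inv (Or.inl (by simp [ENNReal.rpow_eq_zero_iff, ht0, htt]))
          (Or.inl (by simp [ENNReal.rpow_eq_top_iff, ht0, htt])), ENNReal.rpow_neg]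
    · rw [hk, indicator_of_notMem (fun h => hz (hiff.1 h)), indicator_of_notMem hz, mul_zero]
  rw [← lintegral_indicator (hms _), ← lintegral_indicator (hms _), ← hk]
  simp only [h2] at h1
  rw [lintegral_const_mul' _ _ (ENNReal.rpow_ne_top_of_ne_zero ht0 htt)] at h1
  have hpow : ENNReal.ofReal (t ^ m)⁻¹ = (ENNReal.ofReal t ^ (m : ℝ))⁻¹ := by
    rw [ENNReal.ofReal_inv_of_pos (by positivity), ENNReal.ofReal_pow ht.le, ENNReal.rpow_natCast]
  have ha0 : ENNReal.ofReal t ^ (m : ℝ) ≠ 0 :=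
    (ENNReal.rpow_pos (pos_iff_ne_zero.2 ht0) htt).ne'
  have hat : ENNReal.ofReal t ^ (m : ℝ) ≠ ⊤ := ENNReal.rpow_ne_top_of_ne_zero ht0 htt
  rw [hpow] at h1
  rw [sub_eq_add_neg, ENNReal.rpow_add _ _ ht0 htt, mul_assoc, h1, ← mul_assoc,
    ENNReal.mul_inv_cancel ha0 hat, one_mul]

end Tail

/-! ### Measure and tail bounds on the manifold. -/

section Manifold

variable {m : ℕ} {M : Type*} [EMetricSpace M] [MeasurableSpace M] [BorelSpace M]
  [ChartedSpace (EuclideanSpace ℝ (Fin m)) M] [IsManifold (𝓡 m) ∞ M]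
  [RiemannianBundle (fun x : M => TangentSpace (𝓡 m) x)]
  [IsContMDiffRiemannianBundle (𝓡 m) ∞ (EuclideanSpace ℝ (Fin m))
      (fun x : M => TangentSpace (𝓡 m) x)]
  [IsRiemannianManifold (𝓡 m) M]

/-- A small chart ball has measure at most `C ^ m` times its Euclidean volume. In particular a
compact manifold has finite volume. -/
lemma isLocallyFiniteMeasure_euclideanHausdorffMeasure (m : ℕ) (M : Type*) [EMetricSpace M]
    [MeasurableSpace M] [BorelSpace M]
    [ChartedSpace (EuclideanSpace ℝ (Fin m)) M] [IsManifold (𝓡 m) ∞ M]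
    [RiemannianBundle (fun x : M => TangentSpace (𝓡 m) x)]
    [IsContMDiffRiemannianBundle (𝓡 m) ∞ (EuclideanSpace ℝ (Fin m))
      (fun x : M => TangentSpace (𝓡 m) x)]
    [IsRiemannianManifold (𝓡 m) M] : IsLocallyFiniteMeasure (μHE[m] : Measure M) := by
  refine ⟨fun x₀ => ?_⟩
  obtain ⟨ρ, hρ, C, hsub, -, h3, -⟩ := exists_bilipschitz_extChartAt (m := m) x₀
  refine ⟨(extChartAt (𝓡 m) x₀).symm '' ball (extChartAt (𝓡 m) x₀ x₀) ρ, ?_, ?_⟩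
  · have h1 : (extChartAt (𝓡 m) x₀).source ∩
        extChartAt (𝓡 m) x₀ ⁻¹' ball (extChartAt (𝓡 m) x₀ x₀) ρ ∈ 𝓝 x₀ :=
      inter_mem (extChartAt_source_mem_nhds x₀)
        ((continuousAt_extChartAt x₀).preimage_mem_nhds (ball_mem_nhds _ hρ))
    refine mem_of_superset h1 fun x hx => ⟨_, hx.2, (extChartAt (𝓡 m) x₀).left_inv hx.1⟩
  · refine (euclideanHausdorffMeasure_image_le m h3).trans_lt ?_
    rw [EuclideanSpace.euclideanHausdorffMeasure_eq_volume]
    exact ENNReal.mul_lt_top (by finiteness) measure_ball_lt_top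

/-- The manifolds under consideration are second countable, and the singular kernel is uniformly
integrable away from the diagonal. -/
lemma exists_tail_bound (hM : CompactSpace M ∨
      ∃ Φ : M ≃ₘ⟮𝓡 m, 𝓡 m⟯ EuclideanSpace ℝ (Fin m), Isometry Φ) :
    SecondCountableTopology M ∧ SFinite (μHE[m] : Measure M) ∧
      ∀ r : ℝ, (m : ℝ) < r → ∀ δ : ℝ, 0 < δ → ∃ A : ℝ≥0∞, A ≠ ⊤ ∧ ∀ x : M,
        ∫⁻ y in {y | ENNReal.ofReal δ ≤ edist x y}, (edist x y ^ r)⁻¹ ∂μHE[m] ≤ A := by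
  have := isLocallyFiniteMeasure_euclideanHausdorffMeasure m M
  rcases hM with hM | ⟨Φ, hΦ⟩
  -- Compact case: the kernel is at most `δ ^ (-r)` and the total volume is finite.
  · refine ⟨inferInstance, inferInstance, fun r hr δ hδ => ?_⟩
    have hr0 : 0 ≤ r := (Nat.cast_nonneg m).trans hr.le
    have hδ0 : ENNReal.ofReal δ ≠ 0 := by simpa using hδ
    refine ⟨(ENNReal.ofReal δ ^ r)⁻¹ * (μHE[m] : Measure M) univ, ?_, fun x => ?_⟩
    · refine ENNReal.mul_ne_top ?_ (measure_ne_top _ _)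
      simp [ENNReal.rpow_eq_zero_iff, hδ0]
    · have hms : MeasurableSet {y | ENNReal.ofReal δ ≤ edist x y} :=
        (isClosed_le continuous_const (continuous_const.edist continuous_id)).measurableSet
      calc _ ≤ ∫⁻ y in {y | ENNReal.ofReal δ ≤ edist x y}, (ENNReal.ofReal δ ^ r)⁻¹ ∂μHE[m] := by
            refine setLIntegral_mono' hms fun y hy => ?_
            exact ENNReal.inv_le_inv.2 (ENNReal.rpow_le_rpow hy hr0)
        _ ≤ _ := by
            rw [setLIntegral_const]
            gcongr
            exact subset_univ _
  -- Euclidean case: the isometry and a translation reduce every `x` to the same tail integral in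
  -- `ℝᵐ`.
  · let e : M ≃ᵢ EuclideanSpace ℝ (Fin m) := ⟨Φ.toEquiv, hΦ⟩
    have hmp : MeasurePreserving e (μHE[m] : Measure M) volume := by
      have := e.measurePreserving_euclideanHausdorffMeasure m
      rwa [EuclideanSpace.euclideanHausdorffMeasure_eq_volume] at this
    have hsc : SecondCountableTopology M := e.toHomeomorph.secondCountableTopology
    refine ⟨hsc, inferInstance, fun r hr δ hδ => ?_⟩
    refine ⟨_, (ENNReal.mul_lt_top (lt_top_iff_ne_top.2 (ENNReal.rpow_ne_top_of_ne_zero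
      (y := (m : ℝ) - r) (by simpa using hδ) ENNReal.ofReal_ne_top))
      (lintegral_inv_enorm_rpow_lt_top (m := m) hr)).ne, fun x => ?_⟩
    rw [← lintegral_inv_enorm_rpow_eq hδ]
    have hms : MeasurableSet {z : EuclideanSpace ℝ (Fin m) | ENNReal.ofReal δ ≤ ‖z‖ₑ} :=
      measurableSet_le measurable_const measurable_enorm
    have hms' : MeasurableSet {y | ENNReal.ofReal δ ≤ edist x y} :=
      (isClosed_le continuous_const (continuous_const.edist continuous_id)).measurableSet
    have hkm : Measurable ({z : EuclideanSpace ℝ (Fin m) | ENNReal.ofReal δ ≤ ‖z‖ₑ}.indicator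
        fun z => (‖z‖ₑ ^ r)⁻¹) := ((measurable_enorm.pow_const r).inv).indicator hms
    rw [← lintegral_indicator hms', ← lintegral_indicator hms]
    have e1 : ∀ y, {y | ENNReal.ofReal δ ≤ edist x y}.indicator (fun y => (edist x y ^ r)⁻¹) y =
        {z : EuclideanSpace ℝ (Fin m) | ENNReal.ofReal δ ≤ ‖z‖ₑ}.indicator
          (fun z => (‖z‖ₑ ^ r)⁻¹) (e x - e y) := by
      intro y
      have e2 : ‖e x - e y‖ₑ = edist x y := by
        rw [← edist_eq_enorm_sub]; exact e.isometry x y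
      simp only [indicator, mem_ofPred_eq, e2]
    simp only [e1]
    rw [hmp.lintegral_comp (f := fun z => {z : EuclideanSpace ℝ (Fin m) | ENNReal.ofReal δ ≤
      ‖z‖ₑ}.indicator (fun z => (‖z‖ₑ ^ r)⁻¹) (e x - z)) (hkm.comp (measurable_const.sub
        measurable_id))]
    rw [lintegral_sub_left_eq_self]

end Manifold

/-! ### Bi-Lipschitz charts and pulling functions back to the ball. -/

section Chart

/-- A ball in a chart on which the chart is bi-Lipschitz for the Riemannian distance. -/
structure LipschitzChart (m : ℕ) (M : Type*) [EMetricSpace M]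
    [ChartedSpace (EuclideanSpace ℝ (Fin m)) M] [IsManifold (𝓡 m) ∞ M]
    [RiemannianBundle (fun x : M => TangentSpace (𝓡 m) x)] where
  /-- the point at which the chart is centered -/
  x₀ : M
  /-- the radius of the ball in the chart -/
  ρ : ℝ
  /-- the Lipschitz constant -/
  C : ℝ≥0
  ρ_pos : 0 < ρ
  ball_subset : ball (extChartAt (𝓡 m) x₀ x₀) ρ ⊆ (extChartAt (𝓡 m) x₀).target
  enorm_mfderiv_symm_le : ∀ y ∈ ball (extChartAt (𝓡 m) x₀ x₀) ρ, ∀ v : EuclideanSpace ℝ (Fin m),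
    ‖mfderiv 𝓘(ℝ, EuclideanSpace ℝ (Fin m)) (𝓡 m) (extChartAt (𝓡 m) x₀).symm y v‖ₑ ≤ C * ‖v‖ₑ
  edist_symm_le : ∀ y ∈ ball (extChartAt (𝓡 m) x₀ x₀) ρ,
    ∀ z ∈ ball (extChartAt (𝓡 m) x₀ x₀) ρ,
    edist ((extChartAt (𝓡 m) x₀).symm y) ((extChartAt (𝓡 m) x₀).symm z) ≤ C * edist y z
  enorm_mfderiv_le : ∀ x ∈ (extChartAt (𝓡 m) x₀).source ∩
      extChartAt (𝓡 m) x₀ ⁻¹' ball (extChartAt (𝓡 m) x₀ x₀) ρ, ∀ v : TangentSpace (𝓡 m) x,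
    enorm (E := EuclideanSpace ℝ (Fin m))
      (mfderiv (𝓡 m) 𝓘(ℝ, EuclideanSpace ℝ (Fin m)) (extChartAt (𝓡 m) x₀) x v) ≤ C * ‖v‖ₑ
  edist_le : ∀ x ∈ (extChartAt (𝓡 m) x₀).source ∩
      extChartAt (𝓡 m) x₀ ⁻¹' ball (extChartAt (𝓡 m) x₀ x₀) ρ,
    ∀ y ∈ (extChartAt (𝓡 m) x₀).source ∩
      extChartAt (𝓡 m) x₀ ⁻¹' ball (extChartAt (𝓡 m) x₀ x₀) ρ,
    edist (extChartAt (𝓡 m) x₀ x) (extChartAt (𝓡 m) x₀ y) ≤ C * edist x y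

namespace LipschitzChart

variable {m : ℕ} {M : Type*} [EMetricSpace M]
  [ChartedSpace (EuclideanSpace ℝ (Fin m)) M] [IsManifold (𝓡 m) ∞ M]
  [RiemannianBundle (fun x : M => TangentSpace (𝓡 m) x)] (Γ : LipschitzChart m M)

/-- The chart. -/
abbrev χ : M → EuclideanSpace ℝ (Fin m) := extChartAt (𝓡 m) Γ.x₀

/-- The inverse of the chart. -/
abbrev κ : EuclideanSpace ℝ (Fin m) → M := (extChartAt (𝓡 m) Γ.x₀).symm

/-- The center of the ball in the chart. -/
abbrev center : EuclideanSpace ℝ (Fin m) := extChartAt (𝓡 m) Γ.x₀ Γ.x₀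

/-- The ball in the chart. -/
abbrev B : Set (EuclideanSpace ℝ (Fin m)) := ball Γ.center Γ.ρ

/-- The domain in the manifold. -/
def dom : Set M := (extChartAt (𝓡 m) Γ.x₀).source ∩ Γ.χ ⁻¹' Γ.B

lemma isOpen_dom : IsOpen Γ.dom :=
  (continuousOn_extChartAt Γ.x₀).isOpen_inter_preimage (isOpen_extChartAt_source Γ.x₀) isOpen_ball

lemma mapsTo_κ : MapsTo Γ.κ Γ.B Γ.dom := fun y hy =>
  ⟨(extChartAt (𝓡 m) Γ.x₀).map_target (Γ.ball_subset hy), by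
    have h := (extChartAt (𝓡 m) Γ.x₀).right_inv (Γ.ball_subset hy)
    exact mem_preimage.2 (h.symm ▸ hy : extChartAt (𝓡 m) Γ.x₀ (Γ.κ y) ∈ Γ.B)⟩

lemma χ_κ {y : EuclideanSpace ℝ (Fin m)} (hy : y ∈ Γ.B) : Γ.χ (Γ.κ y) = y :=
  (extChartAt (𝓡 m) Γ.x₀).right_inv (Γ.ball_subset hy)

lemma κ_χ {x : M} (hx : x ∈ Γ.dom) : Γ.κ (Γ.χ x) = x := (extChartAt (𝓡 m) Γ.x₀).left_inv hx.1

lemma χ_mem {x : M} (hx : x ∈ Γ.dom) : Γ.χ x ∈ Γ.B := hx.2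

lemma continuousOn_κ : ContinuousOn Γ.κ Γ.B :=
  (continuousOn_extChartAt_symm Γ.x₀).mono Γ.ball_subset

lemma continuousOn_χ : ContinuousOn Γ.χ Γ.dom :=
  (continuousOn_extChartAt Γ.x₀).mono inter_subset_left

variable [MeasurableSpace M] [BorelSpace M]

lemma aemeasurable_κ : AEMeasurable Γ.κ (volume.restrict Γ.B) :=
  Γ.continuousOn_κ.aemeasurable measurableSet_ball

lemma aemeasurable_χ : AEMeasurable Γ.χ ((μHE[m] : Measure M).restrict Γ.dom) :=
  Γ.continuousOn_χ.aemeasurable Γ.isOpen_dom.measurableSet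

/-- The volume compression of `κ` is governed by the Lipschitz constant of its inverse `χ`. -/
lemma map_κ_le : (volume.restrict Γ.B).map Γ.κ ≤ ((Γ.C : ℝ≥0∞) ^ m) • (μHE[m] : Measure M) := by
  have h := map_restrict_euclideanHausdorffMeasure_le (f := Γ.κ) (s := Γ.B) (C := Γ.C) m
    measurableSet_ball
    (by rw [EuclideanSpace.euclideanHausdorffMeasure_eq_volume]; exact Γ.aemeasurable_κ)
    (fun x hx y hy => by
      have : edist (Γ.χ (Γ.κ x)) (Γ.χ (Γ.κ y)) ≤ _ :=
        Γ.edist_le _ (Γ.mapsTo_κ hx) _ (Γ.mapsTo_κ hy)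
      rwa [Γ.χ_κ hx, Γ.χ_κ hy] at this)
  rw [EuclideanSpace.euclideanHausdorffMeasure_eq_volume] at h
  refine h.trans ?_
  gcongr
  exact Measure.restrict_le_self

lemma map_χ_le : ((μHE[m] : Measure M).restrict Γ.dom).map Γ.χ ≤
    ((Γ.C : ℝ≥0∞) ^ m) • volume.restrict Γ.B := by
  have h := map_restrict_euclideanHausdorffMeasure_le (f := Γ.χ) (s := Γ.dom) (C := Γ.C) m
    Γ.isOpen_dom.measurableSet Γ.aemeasurable_χ
    (fun x hx y hy => by
      have : edist (Γ.κ (Γ.χ x)) (Γ.κ (Γ.χ y)) ≤ _ :=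
        Γ.edist_symm_le _ (Γ.χ_mem hx) _ (Γ.χ_mem hy)
      rwa [Γ.κ_χ hx, Γ.κ_χ hy] at this)
  rw [EuclideanSpace.euclideanHausdorffMeasure_eq_volume] at h
  refine h.trans ?_
  gcongr
  exact image_subset_iff.2 fun x hx => hx.2

lemma ae_κ {P : M → Prop} (h : ∀ᵐ x ∂(μHE[m] : Measure M), P x) :
    ∀ᵐ y ∂(volume.restrict Γ.B), P (Γ.κ y) :=
  ae_of_ae_map Γ.aemeasurable_κ (((Measure.absolutelyContinuous_of_le Γ.map_κ_le).trans
    Measure.smul_absolutelyContinuous) h)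

lemma quasiMeasurePreserving_χ : (((μHE[m] : Measure M).restrict Γ.dom).map Γ.χ) ≪
    volume.restrict Γ.B :=
  (Measure.absolutelyContinuous_of_le Γ.map_χ_le).trans Measure.smul_absolutelyContinuous

lemma lintegral_χ_le {k : EuclideanSpace ℝ (Fin m) → ℝ≥0∞}
    (hk : AEMeasurable k (volume.restrict Γ.B)) :
    ∫⁻ x in Γ.dom, k (Γ.χ x) ∂μHE[m] ≤ (Γ.C : ℝ≥0∞) ^ m * ∫⁻ y in Γ.B, k y := by
  rw [← lintegral_map' (hk.mono_ac Γ.quasiMeasurePreserving_χ) Γ.aemeasurable_χ, ← smul_eq_mul,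
    ← lintegral_smul_measure]
  exact lintegral_mono' Γ.map_χ_le le_rfl

/-- The ball is the image of `Γ.dom` under the Lipschitz map `χ`, so Lebesgue measure on it is
dominated by the pushforward by `χ`. -/
lemma lintegral_le_lintegral_χ {k : EuclideanSpace ℝ (Fin m) → ℝ≥0∞}
    (hk : AEMeasurable k (volume.restrict Γ.B)) :
    ∫⁻ y in Γ.B, k y ≤ (Γ.C : ℝ≥0∞) ^ m * ∫⁻ x in Γ.dom, k (Γ.χ x) ∂μHE[m] := by
  have h1 : volume.restrict Γ.B ≤ ((Γ.C : ℝ≥0∞) ^ m) •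
      ((μHE[m] : Measure M).restrict Γ.dom).map Γ.χ := by
    refine Measure.le_iff.2 fun A hA => ?_
    rw [Measure.restrict_apply hA, Measure.smul_apply,
      Measure.map_apply_of_aemeasurable Γ.aemeasurable_χ hA,
      Measure.restrict_apply' Γ.isOpen_dom.measurableSet]
    have e : A ∩ Γ.B = Γ.χ '' (Γ.χ ⁻¹' A ∩ Γ.dom) := by
      ext y
      constructor
      · rintro ⟨hyA, hyB⟩
        exact ⟨Γ.κ y, ⟨by rw [mem_preimage, Γ.χ_κ hyB]; exact hyA, Γ.mapsTo_κ hyB⟩, Γ.χ_κ hyB⟩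
      · rintro ⟨x, ⟨hxA, hxd⟩, rfl⟩
        exact ⟨hxA, hxd.2⟩
    rw [e, ← EuclideanSpace.euclideanHausdorffMeasure_eq_volume]
    exact euclideanHausdorffMeasure_image_le m fun x hx y hy => Γ.edist_le x hx.2 y hy.2
  calc ∫⁻ y in Γ.B, k y = ∫⁻ y in Γ.B, hk.mk k y := lintegral_congr_ae hk.ae_eq_mk
    _ ≤ ∫⁻ y, hk.mk k y ∂(((Γ.C : ℝ≥0∞) ^ m) •
        ((μHE[m] : Measure M).restrict Γ.dom).map Γ.χ) := lintegral_mono' h1 le_rfl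
    _ = (Γ.C : ℝ≥0∞) ^ m * ∫⁻ x in Γ.dom, hk.mk k (Γ.χ x) ∂μHE[m] := by
      rw [lintegral_smul_measure, lintegral_map' hk.measurable_mk.aemeasurable Γ.aemeasurable_χ,
        smul_eq_mul]
    _ = _ := by
      congr 1
      refine lintegral_congr_ae ?_
      filter_upwards [ae_of_ae_map Γ.aemeasurable_χ
        (Γ.quasiMeasurePreserving_χ hk.ae_eq_mk)] with x hx
      exact hx.symm

/-- Fractional Sobolev functions on the manifold are so in the chart. -/
lemma memRealSobolevOn_comp_κ [SecondCountableTopology M] [SFinite (μHE[m] : Measure M)]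
    {s p : ℝ} (hs₀ : 0 ≤ s) (hs₁ : s ≠ 1) (hp : 0 < p) {φ : M → ℝ} (h : MemRealSobolev m s p φ) :
    MemRealSobolevOn Γ.B s p (φ ∘ Γ.κ) := by
  have hac : (volume.restrict Γ.B).map Γ.κ ≪ (μHE[m] : Measure M) :=
    (Measure.absolutelyContinuous_of_le Γ.map_κ_le).trans Measure.smul_absolutelyContinuous
  refine ⟨(h.1.mono_ac hac).comp_aemeasurable Γ.aemeasurable_κ, ?_⟩
  have h2 := h.2
  rw [realEnergy, if_neg hs₁] at h2
  rw [realEnergyOn, if_neg hs₁]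
  refine (gagliardoEnergy_comp_le (L := Γ.C) (by simp) hs₀ hp Γ.aemeasurable_κ Γ.map_κ_le ?_
    h.1).trans_lt ?_
  · filter_upwards [ae_restrict_mem measurableSet_ball] with y hy
    filter_upwards [ae_restrict_mem measurableSet_ball] with z hz
    exact Γ.edist_symm_le y hy z hz
  · refine ENNReal.mul_lt_top (lt_top_iff_ne_top.2 (ENNReal.mul_ne_top ?_ (by finiteness))) h2
    exact ENNReal.rpow_ne_top_of_nonneg (by positivity) (by simp)

/-- Weakly differentiable functions on the manifold are so in the chart. -/
lemma memRealSobolevOn_one_comp_κ {q : ℝ} (hq : 0 ≤ q) {φ : M → ℝ}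
    (h : MemRealSobolev m 1 q φ) : MemRealSobolevOn Γ.B 1 q (φ ∘ Γ.κ) := by
  have hac : (volume.restrict Γ.B).map Γ.κ ≪ (μHE[m] : Measure M) :=
    (Measure.absolutelyContinuous_of_le Γ.map_κ_le).trans Measure.smul_absolutelyContinuous
  refine ⟨(h.1.mono_ac hac).comp_aemeasurable Γ.aemeasurable_κ, ?_⟩
  have h2 := h.2
  simp only [realEnergy, realEnergyOn, if_true, dirichletEnergy, dirichletEnergyOn,
    iInf_lt_iff] at h2 ⊢
  obtain ⟨φ', hφ', hfin⟩ := h2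
  refine ⟨_, (hφ' Γ.x₀).mono Γ.ball_subset, ?_⟩
  set k : EuclideanSpace ℝ (Fin m) → EuclideanSpace ℝ (Fin m) →L[ℝ] ℝ := fun y =>
    (φ' (Γ.κ y)).comp (mfderiv 𝓘(ℝ, EuclideanSpace ℝ (Fin m)) (𝓡 m) Γ.κ y) with hk
  have hkm : AEMeasurable (fun y => ENNReal.ofReal ‖k y‖ ^ q) (volume.restrict Γ.B) := by
    have := ((hφ' Γ.x₀).locallyIntegrableOn_deriv.mono_set Γ.ball_subset).aestronglyMeasurable
    exact (this.norm.aemeasurable.ennreal_ofReal).pow_const q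
  have hC : (Γ.C : ℝ≥0∞) ^ q ≠ ⊤ := ENNReal.rpow_ne_top_of_nonneg hq (by simp)
  have hb : ∀ y ∈ Γ.B, ENNReal.ofReal ‖k y‖ ≤ Γ.C * ENNReal.ofReal ‖φ' (Γ.κ y)‖ := by
    intro y hy
    rw [← ENNReal.ofReal_coe_nnreal, ← ENNReal.ofReal_mul (by positivity)]
    refine ENNReal.ofReal_le_ofReal (ContinuousLinearMap.opNorm_le_bound _ (by positivity)
      fun v => ?_)
    have h1 := Γ.enorm_mfderiv_symm_le _ hy v
    rw [← ofReal_norm, ← ofReal_norm, ← ENNReal.ofReal_coe_nnreal,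
      ← ENNReal.ofReal_mul (by positivity), ENNReal.ofReal_le_ofReal_iff (by positivity)] at h1
    calc ‖k y v‖ ≤ ‖φ' (Γ.κ y)‖ *
          ‖mfderiv 𝓘(ℝ, EuclideanSpace ℝ (Fin m)) (𝓡 m) (extChartAt (𝓡 m) Γ.x₀).symm y v‖ :=
          (φ' (Γ.κ y)).le_opNorm
            (mfderiv 𝓘(ℝ, EuclideanSpace ℝ (Fin m)) (𝓡 m) (extChartAt (𝓡 m) Γ.x₀).symm y v)
      _ ≤ ‖φ' (Γ.κ y)‖ * (Γ.C * ‖v‖) := by gcongr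
      _ = Γ.C * ‖φ' (Γ.κ y)‖ * ‖v‖ := by ring
  refine (Γ.lintegral_le_lintegral_χ hkm).trans_lt (ENNReal.mul_lt_top (by finiteness) ?_)
  calc _ ≤ ∫⁻ x in Γ.dom, (Γ.C : ℝ≥0∞) ^ q * ENNReal.ofReal ‖φ' x‖ ^ q ∂μHE[m] := by
        refine setLIntegral_mono' Γ.isOpen_dom.measurableSet fun x hx => ?_
        rw [← ENNReal.mul_rpow_of_nonneg _ _ hq]
        gcongr
        refine (hb _ (Γ.χ_mem hx)).trans_eq ?_
        exact congrArg (fun z => (Γ.C : ℝ≥0∞) * ENNReal.ofReal ‖φ' z‖) (Γ.κ_χ hx)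
    _ = (Γ.C : ℝ≥0∞) ^ q * ∫⁻ x in Γ.dom, ENNReal.ofReal ‖φ' x‖ ^ q ∂μHE[m] :=
        lintegral_const_mul' _ _ hC
    _ < ⊤ := ENNReal.mul_lt_top (lt_top_iff_ne_top.2 hC)
        ((setLIntegral_le_lintegral _ _).trans_lt hfin)

end LipschitzChart

lemma nonempty_lipschitzChart (m : ℕ) (M : Type*) [Nonempty M] [EMetricSpace M]
    [ChartedSpace (EuclideanSpace ℝ (Fin m)) M] [IsManifold (𝓡 m) ∞ M]
    [RiemannianBundle (fun x : M => TangentSpace (𝓡 m) x)]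
    [IsContMDiffRiemannianBundle (𝓡 m) ∞ (EuclideanSpace ℝ (Fin m))
      (fun x : M => TangentSpace (𝓡 m) x)]
    [IsRiemannianManifold (𝓡 m) M] : Nonempty (LipschitzChart m M) := by
  obtain ⟨ρ, hρ, C, h1, h2, h3, h4, h5⟩ :=
    exists_bilipschitz_extChartAt (m := m) (Classical.arbitrary M)
  exact ⟨⟨_, ρ, C, hρ, h1, h2, h3, h4, h5⟩⟩

end Chart

/-- `w` has a lifting in `W^{s,p} + W^{1,sp}` on `Ω`. -/
def HasSobolevLifting {m : ℕ} (Ω : Set (EuclideanSpace ℝ (Fin m))) (s p : ℝ)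
    (w : EuclideanSpace ℝ (Fin m) → Circle) : Prop :=
  ∃ φ₁ φ₂ : EuclideanSpace ℝ (Fin m) → ℝ, MemRealSobolevOn Ω s p φ₁ ∧
    MemRealSobolevOn Ω 1 (s * p) φ₂ ∧
    ∀ᵐ x ∂(volume.restrict Ω), w x = Circle.exp (φ₁ x + φ₂ x)

/-! ### Energy of maps that are constant off a compact set. -/

section Split

instance : MeasurableSpace Circle := borel Circle

instance : BorelSpace Circle := ⟨rfl⟩

variable {X : Type*} [EMetricSpace X] [MeasurableSpace X] [BorelSpace X]
  [SecondCountableTopology X] {μ : Measure X} [SFinite μ]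

lemma measurable_coe_circle : Measurable fun z : Circle => (z : ℂ) := by
  have : Continuous fun z : Circle => (z : ℂ) := by fun_prop
  exact this.measurable

lemma edist_circle_le_two (z w : Circle) : edist z w ≤ 2 := by
  have h : dist z w ≤ 2 := by
    rw [show dist z w = ‖(z : ℂ) - w‖ by rw [← dist_eq_norm]; rfl]
    refine (norm_sub_le _ _).trans ?_
    simp only [Circle.norm_coe]
    norm_num
  rw [edist_dist]
  exact (ENNReal.ofReal_le_ofReal h).trans (by simp)

/-- The energy of a map that is constant off `K` is essentially its energy on a neighborhood
of `K`. -/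
lemma gagliardoEnergy_le_of_eq_one_off {m : ℕ} {s p : ℝ} (hp : 0 < p) {U K : Set X}
    (hU : MeasurableSet U) (hK : MeasurableSet K) (hKU : K ⊆ U) {u : X → Circle}
    (hu : Measurable u) (h1 : ∀ x ∉ K, u x = 1) {δ A : ℝ≥0∞}
    (hδ : ∀ x ∈ K, ∀ y ∉ U, δ ≤ edist x y)
    (hA : ∀ x ∈ K, ∫⁻ y in {y | δ ≤ edist x y}, (edist x y ^ ((m : ℝ) + s * p))⁻¹ ∂μ ≤ A) :
    gagliardoEnergy edist m s p μ u ≤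
      gagliardoEnergy edist m s p (μ.restrict U) u + 2 * (2 ^ p * A * μ K) := by
  set F : X → X → ℝ≥0∞ := fun x y => edist (u x) (u y) ^ p / edist x y ^ ((m : ℝ) + s * p) with hF
  have hFm : Measurable (Function.uncurry F) := measurable_gagliardo_integrand m hu
  have hsymm : ∀ x y, F x y = F y x := fun x y => by
    simp only [hF, edist_comm (u x), edist_comm x]
  set b : X → ℝ≥0∞ := fun x => ∫⁻ y in Uᶜ, F x y ∂μ with hb
  set a : X → ℝ≥0∞ := fun x => ∫⁻ y in U, F x y ∂μ with ha
  have ham : Measurable a := hFm.lintegral_prod_right'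
  have e1 : ∫⁻ x, ∫⁻ y, F x y ∂μ ∂μ = ∫⁻ x, (a x + b x) ∂μ :=
    lintegral_congr fun x => (lintegral_add_compl _ hU).symm
  have e2 : ∫⁻ x in Uᶜ, a x ∂μ = ∫⁻ x in U, b x ∂μ := by
    rw [ha, lintegral_lintegral_swap hFm.aemeasurable]
    exact lintegral_congr fun x => lintegral_congr fun y => hsymm _ _
  have e3 : ∫⁻ x in Uᶜ, b x ∂μ = 0 := by
    rw [setLIntegral_congr_fun hU.compl (g := 0)]
    · simp
    · intro x hx
      simp only [hb, Pi.zero_apply]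
      rw [setLIntegral_congr_fun hU.compl (g := 0)]
      · simp
      · intro y hy
        simp only [hF, h1 x fun h => hx (hKU h), h1 y fun h => hy (hKU h), edist_self,
          ENNReal.zero_rpow_of_pos hp, ENNReal.zero_div, Pi.zero_apply]
  -- Interaction across the boundary of `U` comes only from `x ∈ K`, since the map equals one
  -- elsewhere. There the points are at least `δ` apart and the values at most two apart, so the
  -- tail bound applies. By symmetry the other mixed term is the same, which gives the factor two.
  have e4 : ∫⁻ x in U, b x ∂μ ≤ 2 ^ p * A * μ K := by
    calc ∫⁻ x in U, b x ∂μ ≤ ∫⁻ x in U, K.indicator (fun _ => 2 ^ p * A) x ∂μ := by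
          refine setLIntegral_mono' hU fun x hx => ?_
          by_cases hxK : x ∈ K
          · rw [indicator_of_mem hxK]
            calc b x ≤ ∫⁻ y in Uᶜ, 2 ^ p * (edist x y ^ ((m : ℝ) + s * p))⁻¹ ∂μ := by
                  refine lintegral_mono fun y => ?_
                  simp only [hF, div_eq_mul_inv]
                  gcongr
                  exact edist_circle_le_two _ _
              _ ≤ ∫⁻ y in {y | δ ≤ edist x y}, 2 ^ p * (edist x y ^ ((m : ℝ) + s * p))⁻¹ ∂μ :=
                  lintegral_mono_set fun y hy => hδ x hxK y hy
              _ = 2 ^ p * ∫⁻ y in {y | δ ≤ edist x y}, (edist x y ^ ((m : ℝ) + s * p))⁻¹ ∂μ :=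
                  lintegral_const_mul' _ _ (by finiteness)
              _ ≤ _ := by gcongr; exact hA x hxK
          · rw [indicator_of_notMem hxK]
            have : b x = 0 := by
              simp only [hb]
              rw [setLIntegral_congr_fun hU.compl (g := 0)]
              · simp
              · intro y hy
                simp only [hF, h1 x hxK, h1 y fun h => hy (hKU h), edist_self,
                  ENNReal.zero_rpow_of_pos hp, ENNReal.zero_div, Pi.zero_apply]
            exact this.le
      _ ≤ ∫⁻ x, K.indicator (fun _ => 2 ^ p * A) x ∂μ := setLIntegral_le_lintegral _ _
      _ = _ := by rw [lintegral_indicator_const hK]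
  calc gagliardoEnergy edist m s p μ u = ∫⁻ x, a x ∂μ + ∫⁻ x, b x ∂μ := by
        rw [← lintegral_add_left ham, ← e1]; rfl
    _ = ((∫⁻ x in U, a x ∂μ) + ∫⁻ x in Uᶜ, a x ∂μ) +
          ((∫⁻ x in U, b x ∂μ) + ∫⁻ x in Uᶜ, b x ∂μ) := by
        rw [lintegral_add_compl _ hU, lintegral_add_compl _ hU]
    _ = (∫⁻ x in U, a x ∂μ) + 2 * ∫⁻ x in U, b x ∂μ := by rw [e2, e3]; ring
    _ ≤ _ := by gcongr; exact le_rfl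

end Split

/-! ### Transplanting fractional maps to the manifold. -/

section Transfer

variable {m : ℕ} {M : Type*} [EMetricSpace M]
  [ChartedSpace (EuclideanSpace ℝ (Fin m)) M] [IsManifold (𝓡 m) ∞ M]
  [RiemannianBundle (fun x : M => TangentSpace (𝓡 m) x)]

namespace LipschitzChart

variable (Γ : LipschitzChart m M)

open Classical in
/-- The extension by `1` to the manifold of a map in the chart. -/
def push (w : EuclideanSpace ℝ (Fin m) → Circle) (x : M) : Circle :=
  if x ∈ Γ.dom then w (Γ.χ x) else 1

lemma push_κ (w : EuclideanSpace ℝ (Fin m) → Circle) {y : EuclideanSpace ℝ (Fin m)}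
    (hy : y ∈ Γ.B) : Γ.push w (Γ.κ y) = w y := by
  have h := Γ.χ_κ hy
  simp only [push, Γ.mapsTo_κ hy, if_true]
  exact congrArg w h

lemma isCompact_image_closedBall {r : ℝ} (hr : r < Γ.ρ) :
    IsCompact (Γ.κ '' closedBall Γ.center r) :=
  (isCompact_closedBall _ _).image_of_continuousOn
    (Γ.continuousOn_κ.mono (closedBall_subset_ball hr))

lemma image_closedBall_subset {r : ℝ} (hr : r < Γ.ρ) :
    Γ.κ '' closedBall Γ.center r ⊆ Γ.dom :=
  (Γ.mapsTo_κ.mono_left (closedBall_subset_ball hr)).image_subset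

lemma push_eq_one {w : EuclideanSpace ℝ (Fin m) → Circle} {r : ℝ}
    (h1 : ∀ y ∉ ball Γ.center r, w y = 1) {x : M} (hx : x ∉ Γ.κ '' closedBall Γ.center r) :
    Γ.push w x = 1 := by
  by_cases hd : x ∈ Γ.dom
  · simp only [push, hd, if_true]
    refine h1 _ fun h => hx ⟨Γ.χ x, ball_subset_closedBall h, Γ.κ_χ hd⟩
  · simp only [push, hd, if_false]

variable [MeasurableSpace M] [BorelSpace M]

lemma measurable_push {w : EuclideanSpace ℝ (Fin m) → Circle} (hw : Measurable w) :
    Measurable (Γ.push w) := by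
  classical
  have hd : MeasurableSet Γ.dom := Γ.isOpen_dom.measurableSet
  have h1 : Measurable (Γ.dom.piecewise Γ.χ fun _ => 0) :=
    Γ.continuousOn_χ.measurable_piecewise continuousOn_const hd
  have h2 : Γ.push w = Γ.dom.piecewise (fun x => w (Γ.dom.piecewise Γ.χ (fun _ => 0) x))
      fun _ => 1 := by
    funext x
    by_cases hx : x ∈ Γ.dom <;> simp [push, hx]
  rw [h2]
  exact Measurable.piecewise hd (hw.comp h1) measurable_const

variable [IsContMDiffRiemannianBundle (𝓡 m) ∞ (EuclideanSpace ℝ (Fin m))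
      (fun x : M => TangentSpace (𝓡 m) x)] [IsRiemannianManifold (𝓡 m) M]

/-- The lifting property on the manifold yields the lifting property on a ball for maps of
fractional regularity that are constant off the ball. -/
lemma hasSobolevLifting_of_lt_one (hM : CompactSpace M ∨
      ∃ Φ : M ≃ₘ⟮𝓡 m, 𝓡 m⟯ EuclideanSpace ℝ (Fin m), Isometry Φ)
    {s p : ℝ} (hs₀ : 0 < s) (hs₁ : s < 1) (hp : 0 < p)
    (hlift : ∀ u : M → Circle, MemCircleSobolev m s p u →
      ∃ φ₁ φ₂ : M → ℝ, MemRealSobolev m s p φ₁ ∧ MemRealSobolev m 1 (s * p) φ₂ ∧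
        ∀ᵐ x ∂(μHE[m] : Measure M), u x = Circle.exp (φ₁ x + φ₂ x))
    {w : EuclideanSpace ℝ (Fin m) → Circle} (hw : Measurable w)
    (h1 : ∀ y ∉ ball Γ.center (Γ.ρ / 2), w y = 1)
    (hE : gagliardoEnergy edist m s p volume w < ⊤) :
    HasSobolevLifting Γ.B s p w := by
  obtain ⟨hsec, hsf, htail⟩ := exists_tail_bound (m := m) hM
  have hr : Γ.ρ / 2 < Γ.ρ := half_lt_self Γ.ρ_pos
  set K := Γ.κ '' closedBall Γ.center (Γ.ρ / 2) with hK
  have hKc : IsCompact K := Γ.isCompact_image_closedBall hr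
  have hKU : K ⊆ Γ.dom := Γ.image_closedBall_subset hr
  have hdm : MeasurableSet Γ.dom := Γ.isOpen_dom.measurableSet
  -- Compactness of `K` inside the open set `Γ.dom` gives a positive gap to the complement, the one
  -- at which the tail bound is used.
  obtain ⟨δ, hδ, hδ'⟩ := Metric.exists_pos_forall_lt_edist hKc Γ.isOpen_dom.isClosed_compl
    (disjoint_compl_right.mono_left hKU)
  have hmsp : (m : ℝ) < m + s * p := by have := mul_pos hs₀ hp; linarith
  obtain ⟨A, hA, hA'⟩ := htail _ hmsp δ (by exact_mod_cast hδ)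
  have hKfin : (μHE[m] : Measure M) K < ⊤ := by
    refine (euclideanHausdorffMeasure_image_le m fun y hy z hz => Γ.edist_symm_le y
      (closedBall_subset_ball hr hy) z (closedBall_subset_ball hr hz)).trans_lt ?_
    rw [EuclideanSpace.euclideanHausdorffMeasure_eq_volume]
    exact ENNReal.mul_lt_top (by finiteness) measure_closedBall_lt_top
  have hum := Γ.measurable_push hw
  have hEu : gagliardoEnergy edist m s p (μHE[m] : Measure M) (Γ.push w) < ⊤ := by
    refine (gagliardoEnergy_le_of_eq_one_off hp hdm hKc.measurableSet hKU hum
      (fun x hx => Γ.push_eq_one h1 hx) (δ := ENNReal.ofReal δ) (A := A)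
      (fun x hx y hy => ?_) fun x _ => hA' x).trans_lt ?_
    · simpa using (hδ' x hx y hy).le
    · refine ENNReal.add_lt_top.2 ⟨?_, by finiteness⟩
      have e : gagliardoEnergy edist m s p ((μHE[m] : Measure M).restrict Γ.dom) (Γ.push w) =
          gagliardoEnergy edist m s p ((μHE[m] : Measure M).restrict Γ.dom) (w ∘ Γ.χ) := by
        refine gagliardoEnergy_congr ?_
        filter_upwards [ae_restrict_mem hdm] with x hx
        simp [push, hx]
      rw [e]
      refine (gagliardoEnergy_comp_le (L := Γ.C) (by simp) hs₀.le hp Γ.aemeasurable_χ Γ.map_χ_le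
        ?_ hw.aemeasurable).trans_lt ?_
      · filter_upwards [ae_restrict_mem hdm] with x hx
        filter_upwards [ae_restrict_mem hdm] with y hy
        exact Γ.edist_le x hx y hy
      · refine ENNReal.mul_lt_top (lt_top_iff_ne_top.2 (ENNReal.mul_ne_top
          (ENNReal.rpow_ne_top_of_nonneg (by positivity) (by simp)) (by finiteness)))
          ((gagliardoEnergy_mono_measure Measure.restrict_le_self _).trans_lt hE)
  -- The hypothesis is stated with the geodesic distance on the circle; finiteness passes from the
  -- chordal one at the price of a factor `(π / 2) ^ p`.
  obtain ⟨φ₁, φ₂, hφ₁, hφ₂, hφ⟩ := hlift (Γ.push w)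
    ⟨(measurable_coe_circle.comp hum).aemeasurable, by
      rw [circleEnergy, if_neg hs₁.ne]
      refine (gagliardoEnergy_mono_dist hp.le ENNReal.ofReal_ne_top circleDist_le_edist _).trans_lt
        (ENNReal.mul_lt_top (by finiteness) hEu)⟩
  refine ⟨φ₁ ∘ Γ.κ, φ₂ ∘ Γ.κ, Γ.memRealSobolevOn_comp_κ hs₀.le hs₁.ne hp hφ₁,
    Γ.memRealSobolevOn_one_comp_κ (by positivity) hφ₂, ?_⟩
  filter_upwards [Γ.ae_κ hφ, ae_restrict_mem measurableSet_ball] with y hy hyB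
  rw [← Γ.push_κ w hyB, hy]
  rfl

end LipschitzChart
end Transfer

/-! ### Transplanting weakly differentiable maps to the manifold. -/

lemma norm_le_of_enorm_le {E F : Type*} [NormedAddCommGroup E] [NormedAddCommGroup F] {a : E}
    {b : F} {C : ℝ≥0} (h : ‖a‖ₑ ≤ C * ‖b‖ₑ) : ‖a‖ ≤ C * ‖b‖ := by
  rwa [← ofReal_norm, ← ofReal_norm, ← ENNReal.ofReal_coe_nnreal,
    ← ENNReal.ofReal_mul (by positivity), ENNReal.ofReal_le_ofReal_iff (by positivity)] at h

lemma hasWeakFDerivOn_const {m : ℕ} {F : Type*} [NormedAddCommGroup F] [NormedSpace ℝ F]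
    {Ω : Set (EuclideanSpace ℝ (Fin m))} (hΩ : IsOpen Ω) (c : F) :
    HasWeakFDerivOn Ω (fun _ => c) 0 := by
  have h := hasWeakFDerivOn_of_contDiffOn hΩ (contDiffOn_const (c := c) (𝕜 := ℝ) (n := 1))
  have e : fderiv ℝ (fun _ : EuclideanSpace ℝ (Fin m) => c) = 0 := by
    funext x
    simp
  rwa [e] at h

/-- Maps with a left inverse of class `C¹` compress volumes by a bounded factor on compact sets. -/
lemma exists_map_restrict_le_smul_of_leftInvOn {m : ℕ}
    {Ψ Θ : EuclideanSpace ℝ (Fin m) → EuclideanSpace ℝ (Fin m)}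
    {U V K : Set (EuclideanSpace ℝ (Fin m))} (hV : IsOpen V) (hΨ : ContinuousOn Ψ U)
    (hmaps : MapsTo Ψ U V) (hΘ : ContDiffOn ℝ 1 Θ V) (hleft : LeftInvOn Θ Ψ U)
    (hK : K ⊆ U) (hKc : IsCompact K) :
    ∃ C : ℝ≥0∞, C ≠ ⊤ ∧ (volume.restrict K).map Ψ ≤ C • volume := by
  have hΨK : IsCompact (Ψ '' K) := hKc.image_of_continuousOn (hΨ.mono hK)
  have hsub : Ψ '' K ⊆ V := (hmaps.mono_left hK).image_subset
  have hcont : ContinuousOn (fun y => (fderiv ℝ Θ y).det) (Ψ '' K) :=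
    ContinuousLinearMap.continuous_det.comp_continuousOn
      ((hΘ.continuousOn_fderiv_of_isOpen hV le_rfl).mono hsub)
  obtain ⟨C, hC⟩ := hΨK.exists_bound_of_continuousOn hcont
  refine ⟨ENNReal.ofReal C, ENNReal.ofReal_ne_top, Measure.le_iff.2 fun A hA => ?_⟩
  rw [Measure.map_apply_of_aemeasurable ((hΨ.mono hK).aemeasurable hKc.measurableSet) hA,
    Measure.restrict_apply' hKc.measurableSet]
  -- The left inverse turns preimages into images, whose volume is bounded by the integral of the
  -- Jacobian of `Θ`, bounded on the compact set `Ψ '' K`.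
  have e : Ψ ⁻¹' A ∩ K = Θ '' (A ∩ Ψ '' K) := by
    ext x
    constructor
    · rintro ⟨hxA, hxK⟩
      exact ⟨Ψ x, ⟨hxA, mem_image_of_mem _ hxK⟩, hleft (hK hxK)⟩
    · rintro ⟨_, ⟨hyA, z, hz, rfl⟩, rfl⟩
      rw [hleft (hK hz)]
      exact ⟨hyA, hz⟩
  have hm : MeasurableSet (A ∩ Ψ '' K) := hA.inter hΨK.measurableSet
  rw [e]
  calc volume (Θ '' (A ∩ Ψ '' K)) ≤ ∫⁻ y in A ∩ Ψ '' K, ENNReal.ofReal |(fderiv ℝ Θ y).det| :=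
        addHaar_image_le_lintegral_abs_det_fderiv volume hm fun y hy =>
          ((hΘ.differentiableOn one_ne_zero).differentiableAt
            (hV.mem_nhds (hsub hy.2))).hasFDerivAt.hasFDerivWithinAt
    _ ≤ ∫⁻ _ in A ∩ Ψ '' K, ENNReal.ofReal C :=
        setLIntegral_mono' hm fun y hy => ENNReal.ofReal_le_ofReal (hC y hy.2)
    _ = ENNReal.ofReal C * volume (A ∩ Ψ '' K) := setLIntegral_const _ _
    _ ≤ _ := by
        rw [Measure.smul_apply, smul_eq_mul]
        gcongr
        exact inter_subset_left

namespace LipschitzChart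

variable {m : ℕ} {M : Type*} [EMetricSpace M]
  [ChartedSpace (EuclideanSpace ℝ (Fin m)) M] [IsManifold (𝓡 m) ∞ M]
  [RiemannianBundle (fun x : M => TangentSpace (𝓡 m) x)] (Γ : LipschitzChart m M)

open Classical in
/-- The extension by `0` to the manifold of a derivative in the chart. -/
def pushDeriv (w' : EuclideanSpace ℝ (Fin m) → EuclideanSpace ℝ (Fin m) →L[ℝ] ℂ) (x : M) :
    TangentSpace (𝓡 m) x →L[ℝ] ℂ :=
  if x ∈ Γ.dom then
    (w' (Γ.χ x)).comp (mfderiv (𝓡 m) 𝓘(ℝ, EuclideanSpace ℝ (Fin m)) (extChartAt (𝓡 m) Γ.x₀) x)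
  else 0

lemma ofReal_norm_pushDeriv_le
    (w' : EuclideanSpace ℝ (Fin m) → EuclideanSpace ℝ (Fin m) →L[ℝ] ℂ) (x : M) :
    ENNReal.ofReal ‖Γ.pushDeriv w' x‖ ≤
      Γ.dom.indicator (fun x => Γ.C * ENNReal.ofReal ‖w' (Γ.χ x)‖) x := by
  by_cases hx : x ∈ Γ.dom
  · simp only [pushDeriv, hx, if_true, indicator_of_mem]
    rw [← ENNReal.ofReal_coe_nnreal, ← ENNReal.ofReal_mul (by positivity)]
    refine ENNReal.ofReal_le_ofReal (ContinuousLinearMap.opNorm_le_bound _ (by positivity)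
      fun v => ?_)
    have h1 := norm_le_of_enorm_le (E := EuclideanSpace ℝ (Fin m)) (Γ.enorm_mfderiv_le x hx v)
    refine ((w' (Γ.χ x)).le_opNorm (mfderiv (𝓡 m) 𝓘(ℝ, EuclideanSpace ℝ (Fin m))
      (extChartAt (𝓡 m) Γ.x₀) x v)).trans ?_
    calc _ ≤ ‖w' (Γ.χ x)‖ * (Γ.C * ‖v‖) := by gcongr
      _ = _ := by ring
  · simp only [pushDeriv, hx, if_false, indicator_of_notMem, not_false_eq_true]
    rw [ContinuousLinearMap.opNorm_zero, ENNReal.ofReal_zero]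

/-- The domain of an arbitrary chart is covered by two open sets: the points mapped into `Γ.dom`,
where the extension is `w` composed with a smooth transition map, and the points mapped off `K`,
where it is constant. Locality of weak derivatives joins the two. -/
lemma hasWeakMFDeriv_push {w : EuclideanSpace ℝ (Fin m) → Circle}
    {w' : EuclideanSpace ℝ (Fin m) → EuclideanSpace ℝ (Fin m) →L[ℝ] ℂ} {r : ℝ} (hr : r < Γ.ρ)
    (h : HasWeakFDerivOn Γ.B (fun y => (w y : ℂ)) w') (h1 : ∀ y ∉ ball Γ.center r, w y = 1)
    (h2 : ∀ y ∉ closedBall Γ.center r, w' y = 0) :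
    HasWeakMFDeriv m (fun x => (Γ.push w x : ℂ)) (Γ.pushDeriv w') := by
  intro x₁
  set K := Γ.κ '' closedBall Γ.center r with hK
  have hKc : IsCompact K := Γ.isCompact_image_closedBall hr
  have hKU : K ⊆ Γ.dom := Γ.image_closedBall_subset hr
  set e := extChartAt (𝓡 m) x₁ with he
  have het : IsOpen e.target := isOpen_extChartAt_target x₁
  have hU : IsOpen (e.target ∩ e.symm ⁻¹' Γ.dom) :=
    (continuousOn_extChartAt_symm x₁).isOpen_inter_preimage het Γ.isOpen_dom
  have hV : IsOpen (e.target ∩ e.symm ⁻¹' Kᶜ) :=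
    (continuousOn_extChartAt_symm x₁).isOpen_inter_preimage het hKc.isClosed.isOpen_compl
  have hUV : e.target = (e.target ∩ e.symm ⁻¹' Γ.dom) ∪ (e.target ∩ e.symm ⁻¹' Kᶜ) := by
    rw [← inter_union_distrib_left, ← preimage_union, eq_comm, inter_eq_left]
    intro y hy
    by_cases hyK : e.symm y ∈ K
    · exact Or.inl (hKU hyK)
    · exact Or.inr hyK
  rw [hUV]
  refine HasWeakFDerivOn.union hU hV ?_ ?_
  · set Ψ : EuclideanSpace ℝ (Fin m) → EuclideanSpace ℝ (Fin m) := fun y => Γ.χ (e.symm y) with hΨ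
    set Θ : EuclideanSpace ℝ (Fin m) → EuclideanSpace ℝ (Fin m) := fun y => e (Γ.κ y) with hΘ
    have hW : IsOpen (Γ.B ∩ Γ.κ ⁻¹' e.source) :=
      Γ.continuousOn_κ.isOpen_inter_preimage isOpen_ball (isOpen_extChartAt_source x₁)
    have s1 : ContDiffOn ℝ ∞ Ψ (e.target ∩ e.symm ⁻¹' Γ.dom) := by
      rw [← contMDiffOn_iff_contDiffOn]
      exact (contMDiffOn_extChartAt (I := 𝓡 m) (x := Γ.x₀) (n := ∞)).comp
        ((contMDiffOn_extChartAt_symm x₁).mono inter_subset_left)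
        fun y hy => by have := hy.2.1; rwa [extChartAt_source] at this
    have s2 : ContDiffOn ℝ ∞ Θ (Γ.B ∩ Γ.κ ⁻¹' e.source) := by
      rw [← contMDiffOn_iff_contDiffOn]
      exact (contMDiffOn_extChartAt (I := 𝓡 m) (x := x₁) (n := ∞)).comp
        ((contMDiffOn_extChartAt_symm Γ.x₀).mono (inter_subset_left.trans Γ.ball_subset))
        fun y hy => by have := hy.2; rwa [mem_preimage, extChartAt_source] at this
    have hk : ∀ y ∈ e.target ∩ e.symm ⁻¹' Γ.dom, Γ.κ (Ψ y) = e.symm y := fun y hy => Γ.κ_χ hy.2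
    have hmaps : MapsTo Ψ (e.target ∩ e.symm ⁻¹' Γ.dom) (Γ.B ∩ Γ.κ ⁻¹' e.source) := fun y hy =>
      ⟨Γ.χ_mem hy.2, by rw [mem_preimage, hk y hy]; exact e.map_target hy.1⟩
    have hleft : LeftInvOn Θ Ψ (e.target ∩ e.symm ⁻¹' Γ.dom) := fun y hy => by
      simp only [hΘ]
      rw [hk y hy]
      exact e.right_inv hy.1
    refine (HasWeakFDerivOn.comp isOpen_ball hU h (s1.of_le (by norm_num))
      (fun y hy => (hmaps hy).1) fun K hK hKc => exists_map_restrict_le_smul_of_leftInvOn hW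
        s1.continuousOn hmaps (s2.of_le (by norm_num)) hleft hK hKc).congr_ae ?_ ?_
    · filter_upwards [ae_restrict_mem hU.measurableSet] with y hy
      have : e.symm y ∈ Γ.dom := hy.2
      simp [push, this, hΨ]
    · filter_upwards [ae_restrict_mem hU.measurableSet] with y hy
      have hyd : e.symm y ∈ Γ.dom := hy.2
      have hc : fderiv ℝ Ψ y = (mfderiv (𝓡 m) 𝓘(ℝ, EuclideanSpace ℝ (Fin m))
          (extChartAt (𝓡 m) Γ.x₀) (e.symm y)).comp
          (mfderiv 𝓘(ℝ, EuclideanSpace ℝ (Fin m)) (𝓡 m) e.symm y) := by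
        rw [← mfderiv_eq_fderiv]
        refine mfderiv_comp y (mdifferentiableAt_extChartAt ?_) ?_
        · have := hyd.1
          rwa [extChartAt_source] at this
        · have := mdifferentiableWithinAt_extChartAt_symm (I := 𝓡 m) hy.1
          rwa [show range (𝓡 m) = univ by simp, mdifferentiableWithinAt_univ] at this
      simp only [pushDeriv, hyd, if_true]
      rw [hc]
      rfl
  · refine (hasWeakFDerivOn_const hV (1 : ℂ)).congr_ae ?_ ?_
    · filter_upwards [ae_restrict_mem hV.measurableSet] with y hy
      rw [Γ.push_eq_one h1 hy.2, Circle.coe_one]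
    · filter_upwards [ae_restrict_mem hV.measurableSet] with y hy
      by_cases hd : e.symm y ∈ Γ.dom
      · have : w' (Γ.χ (e.symm y)) = 0 := h2 _ fun hc => hy.2 ⟨_, hc, Γ.κ_χ hd⟩
        simp only [pushDeriv, hd, if_true]
        rw [this]
        rfl
      · simp only [pushDeriv, hd, if_false]
        rfl

variable [MeasurableSpace M] [BorelSpace M]

/-- The lifting property on the manifold yields the lifting property on a ball for weakly
differentiable maps that are constant off the ball. -/
lemma hasSobolevLifting_one {p : ℝ} (hp : 0 < p)
    (hlift : ∀ u : M → Circle, MemCircleSobolev m 1 p u →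
      ∃ φ₁ φ₂ : M → ℝ, MemRealSobolev m 1 p φ₁ ∧ MemRealSobolev m 1 (1 * p) φ₂ ∧
        ∀ᵐ x ∂(μHE[m] : Measure M), u x = Circle.exp (φ₁ x + φ₂ x))
    {w : EuclideanSpace ℝ (Fin m) → Circle} (hw : Measurable w)
    (h1 : ∀ y ∉ ball Γ.center (Γ.ρ / 2), w y = 1)
    {w' : EuclideanSpace ℝ (Fin m) → EuclideanSpace ℝ (Fin m) →L[ℝ] ℂ}
    (h : HasWeakFDerivOn Γ.B (fun y => (w y : ℂ)) w')
    (hE : ∫⁻ y in Γ.B, ENNReal.ofReal ‖w' y‖ ^ p < ⊤) :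
    HasSobolevLifting Γ.B 1 p w := by
  have hr : Γ.ρ / 2 < Γ.ρ := half_lt_self Γ.ρ_pos
  -- A weak derivative of `w` vanishes off the smaller ball only almost everywhere. The truncated
  -- representative vanishes there pointwise, as the extension by zero requires.
  set w₁ := (closedBall Γ.center (Γ.ρ / 2)).indicator w' with hw₁
  have hV : IsOpen (Γ.B \ closedBall Γ.center (Γ.ρ / 2)) := isOpen_ball.sdiff isClosed_closedBall
  have hz : ∀ᵐ y ∂(volume.restrict (Γ.B \ closedBall Γ.center (Γ.ρ / 2))), w' y = 0 := by
    refine HasWeakFDerivOn.ae_eq hV (h.mono sdiff_subset) ((hasWeakFDerivOn_const hV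
      (1 : ℂ)).congr_ae ?_ EventuallyEq.rfl)
    filter_upwards [ae_restrict_mem hV.measurableSet] with y hy
    rw [h1 y fun hc => hy.2 (ball_subset_closedBall hc), Circle.coe_one]
  have hww : w' =ᵐ[volume.restrict Γ.B] w₁ := by
    rw [ae_restrict_iff' hV.measurableSet] at hz
    filter_upwards [ae_restrict_of_ae hz, ae_restrict_mem measurableSet_ball] with y hy hyB
    by_cases hc : y ∈ closedBall Γ.center (Γ.ρ / 2)
    · rw [hw₁, indicator_of_mem hc]
    · rw [hw₁, indicator_of_notMem hc, hy ⟨hyB, hc⟩]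
  have hd := Γ.hasWeakMFDeriv_push hr (h.congr_ae EventuallyEq.rfl hww) h1
    fun y hy => indicator_of_notMem hy _
  have hum := Γ.measurable_push hw
  have hm : AEMeasurable (fun y => ENNReal.ofReal ‖w₁ y‖ ^ p) (volume.restrict Γ.B) := by
    have := (h.locallyIntegrableOn_deriv.aestronglyMeasurable.congr hww)
    exact (this.norm.aemeasurable.ennreal_ofReal).pow_const p
  have hC : (Γ.C : ℝ≥0∞) ^ p ≠ ⊤ := ENNReal.rpow_ne_top_of_nonneg hp.le (by simp)
  have hEu : ∫⁻ x, ENNReal.ofReal ‖Γ.pushDeriv w₁ x‖ ^ p ∂(μHE[m] : Measure M) < ⊤ := by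
    calc _ ≤ ∫⁻ x, Γ.dom.indicator
          (fun x => (Γ.C : ℝ≥0∞) ^ p * ENNReal.ofReal ‖w₁ (Γ.χ x)‖ ^ p) x ∂μHE[m] := by
          refine lintegral_mono fun x => ?_
          refine (ENNReal.rpow_le_rpow (Γ.ofReal_norm_pushDeriv_le w₁ x) hp.le).trans ?_
          by_cases hx : x ∈ Γ.dom
          · rw [indicator_of_mem hx, indicator_of_mem hx, ENNReal.mul_rpow_of_nonneg _ _ hp.le]
          · rw [indicator_of_notMem hx, indicator_of_notMem hx, ENNReal.zero_rpow_of_pos hp]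
      _ = (Γ.C : ℝ≥0∞) ^ p * ∫⁻ x in Γ.dom, ENNReal.ofReal ‖w₁ (Γ.χ x)‖ ^ p ∂μHE[m] := by
          rw [lintegral_indicator Γ.isOpen_dom.measurableSet, lintegral_const_mul' _ _ hC]
      _ ≤ (Γ.C : ℝ≥0∞) ^ p * ((Γ.C : ℝ≥0∞) ^ m * ∫⁻ y in Γ.B, ENNReal.ofReal ‖w₁ y‖ ^ p) := by
          gcongr
          exact Γ.lintegral_χ_le hm
      _ < ⊤ := by
          have : ∫⁻ y in Γ.B, ENNReal.ofReal ‖w₁ y‖ ^ p < ⊤ := by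
            rwa [← lintegral_congr_ae (f := fun y => ENNReal.ofReal ‖w' y‖ ^ p)
              (hww.mono fun y hy => by simp only [hy])]
          exact ENNReal.mul_lt_top (lt_top_iff_ne_top.2 hC)
            (ENNReal.mul_lt_top (by finiteness) this)
  obtain ⟨φ₁, φ₂, hφ₁, hφ₂, hφ⟩ := hlift (Γ.push w)
    ⟨(measurable_coe_circle.comp hum).aemeasurable, by
      simp only [circleEnergy, if_true, dirichletEnergy, iInf_lt_iff]
      exact ⟨_, hd, hEu⟩⟩
  refine ⟨φ₁ ∘ Γ.κ, φ₂ ∘ Γ.κ, Γ.memRealSobolevOn_one_comp_κ hp.le hφ₁,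
    Γ.memRealSobolevOn_one_comp_κ (by linarith) hφ₂, ?_⟩
  filter_upwards [Γ.ae_κ hφ, ae_restrict_mem measurableSet_ball] with y hy hyB
  rw [← Γ.push_κ w hyB, hy]
  rfl

end LipschitzChart

/-! ### Opening maps and generic centres for weak differentiability. -/

section Opening

variable {m : ℕ}

/-- The map that is a constant far from `a` and the identity near `a`, depending on a cutoff
function. -/
def openingMap (lam : ContDiffBump (0 : EuclideanSpace ℝ (Fin m)))
    (a x : EuclideanSpace ℝ (Fin m)) : EuclideanSpace ℝ (Fin m) := lam (x - a) • (x - a) + a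

variable (lam : ContDiffBump (0 : EuclideanSpace ℝ (Fin m)))

lemma contDiff_smul_self : ContDiff ℝ ∞ fun y => lam y • y := lam.contDiff.smul contDiff_id

lemma hasCompactSupport_smul_self : HasCompactSupport fun y => lam y • y :=
  lam.hasCompactSupport.smul_right

lemma norm_smul_self_le (y : EuclideanSpace ℝ (Fin m)) : ‖lam y • y‖ ≤ lam.rOut := by
  by_cases hy : y ∈ ball 0 lam.rOut
  · rw [norm_smul, Real.norm_of_nonneg lam.nonneg]
    have h1 : ‖y‖ < lam.rOut := by simpa using hy
    nlinarith [lam.le_one (x := y), lam.nonneg (x := y), norm_nonneg y]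
  · rw [lam.zero_of_le_dist (by simpa using hy), zero_smul, norm_zero]
    exact lam.rOut_pos.le

lemma openingMap_mem_closedBall {ε : ℝ} {a : EuclideanSpace ℝ (Fin m)} (ha : a ∈ ball 0 ε)
    (x : EuclideanSpace ℝ (Fin m)) : openingMap lam a x ∈ closedBall 0 (lam.rOut + ε) := by
  rw [mem_closedBall_zero_iff]
  refine (norm_add_le _ _).trans (add_le_add (norm_smul_self_le lam _) ?_)
  simpa using (mem_ball.1 ha).le

lemma openingMap_eq_self {a x : EuclideanSpace ℝ (Fin m)} (h : x - a ∈ closedBall 0 lam.rIn) :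
    openingMap lam a x = x := by
  rw [openingMap, lam.one_of_mem_closedBall h, one_smul, sub_add_cancel]

lemma openingMap_eq_center {a x : EuclideanSpace ℝ (Fin m)} (h : lam.rOut ≤ ‖x - a‖) :
    openingMap lam a x = a := by
  rw [openingMap, lam.zero_of_le_dist (by simpa using h), zero_smul, zero_add]

lemma measurable_openingMap : Measurable fun q : EuclideanSpace ℝ (Fin m) ×
    EuclideanSpace ℝ (Fin m) => openingMap lam q.1 q.2 := by
  unfold openingMap
  have := (contDiff_smul_self lam).continuous
  exact ((this.comp (continuous_snd.sub continuous_fst)).add continuous_fst).measurable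

lemma contDiff_openingMap (a : EuclideanSpace ℝ (Fin m)) : ContDiff ℝ ∞ (openingMap lam a) :=
  ((contDiff_smul_self lam).comp (contDiff_id.sub contDiff_const)).add contDiff_const

/-- Averaging over the center of an opening. -/
lemma lintegral_lintegral_openingMap_le {k : EuclideanSpace ℝ (Fin m) → ℝ≥0∞} (hk : Measurable k)
    {A X Y : Set (EuclideanSpace ℝ (Fin m))} (hA : MeasurableSet A) (hX : MeasurableSet X)
    (hY : MeasurableSet Y) (hXAY : ∀ x ∈ X, ∀ a ∈ A, x - a ∈ Y) :
    ∫⁻ a in A, ∫⁻ x in X, k (openingMap lam a x) ≤ volume Y * ∫⁻ z, k z := by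
  set φ : EuclideanSpace ℝ (Fin m) → EuclideanSpace ℝ (Fin m) := fun y => lam y • y with hφ
  have hφm : Measurable φ := (contDiff_smul_self lam).continuous.measurable
  calc ∫⁻ a in A, ∫⁻ x in X, k (openingMap lam a x)
      ≤ ∫⁻ a in A, ∫⁻ x, Y.indicator (fun y => k (φ y + a)) (x - a) := by
        refine setLIntegral_mono' hA fun a ha => ?_
        rw [← lintegral_indicator hX]
        refine lintegral_mono fun x => ?_
        by_cases hx : x ∈ X
        · rw [indicator_of_mem hx, indicator_of_mem (hXAY x hx a ha)]
          rfl
        · rw [indicator_of_notMem hx]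
          exact zero_le
    _ ≤ ∫⁻ a, ∫⁻ x, Y.indicator (fun y => k (φ y + a)) (x - a) := setLIntegral_le_lintegral _ _
    -- After the substitution `y = x - a`, the argument of `k` is a translate of `a` for fixed `y`.
    -- Integrating in `a` first therefore removes the non-injective map `y ↦ lam y • y`.
    _ = ∫⁻ a, ∫⁻ y, Y.indicator (fun y => k (φ y + a)) y := by
        refine lintegral_congr fun a => ?_
        exact lintegral_sub_right_eq_self (Y.indicator fun y => k (φ y + a)) a
    _ = ∫⁻ a, ∫⁻ y in Y, k (φ y + a) := by simp_rw [lintegral_indicator hY]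
    _ = ∫⁻ y in Y, ∫⁻ a, k (φ y + a) := by
        refine lintegral_lintegral_swap (Measurable.aemeasurable ?_)
        exact hk.comp ((hφm.comp measurable_snd).add measurable_fst)
    _ = ∫⁻ y in Y, ∫⁻ z, k z :=
        lintegral_congr fun y => lintegral_add_left_eq_self k (φ y)
    _ = _ := by rw [setLIntegral_const, mul_comm]

/-- The opening map takes values in a fixed closed ball, so only `k` on that ball enters. For a
radius below one this ball is compact in the unit ball, where local integrability can be used. -/
lemma lintegral_lintegral_openingMap_ball_le {k : EuclideanSpace ℝ (Fin m) → ℝ≥0∞}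
    (hk : Measurable k) {ε : ℝ} :
    ∫⁻ a in ball 0 ε, ∫⁻ x in ball 0 2, k (openingMap lam a x) ≤
      volume (ball (0 : EuclideanSpace ℝ (Fin m)) (2 + ε)) *
        ∫⁻ z in closedBall 0 (lam.rOut + ε), k z := by
  set K : Set (EuclideanSpace ℝ (Fin m)) := closedBall 0 (lam.rOut + ε) with hK
  rw [← lintegral_indicator measurableSet_closedBall]
  refine le_trans ?_ (lintegral_lintegral_openingMap_le lam
    (A := ball 0 ε) (X := ball 0 2) (Y := ball 0 (2 + ε)) (hk.indicator measurableSet_closedBall)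
    measurableSet_ball measurableSet_ball measurableSet_ball fun x hx a ha => ?_)
  · refine setLIntegral_mono' measurableSet_ball fun a ha => ?_
    refine lintegral_mono fun x => ?_
    rw [indicator_of_mem (openingMap_mem_closedBall lam ha x)]
  · have h1 : ‖x‖ < 2 := by simpa using hx
    have h2 : ‖a‖ < ε := by simpa using ha
    rw [mem_ball_zero_iff]
    exact (norm_sub_le _ _).trans_lt (add_lt_add h1 h2)

variable {F : Type*} [NormedAddCommGroup F] [NormedSpace ℝ F] [CompleteSpace F]

/-- For a generic center, the composition of a weakly differentiable function with the opening
map is weakly differentiable. -/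
lemma HasWeakFDerivOn.exists_openingMap {u : EuclideanSpace ℝ (Fin m) → F}
    {u' : EuclideanSpace ℝ (Fin m) → EuclideanSpace ℝ (Fin m) →L[ℝ] F}
    (hu : StronglyMeasurable u) (hu' : StronglyMeasurable u')
    (h : HasWeakFDerivOn (ball 0 1) u u') {p : ℝ} (hp : 0 ≤ p)
    (hE : ∫⁻ x in ball 0 1, ENNReal.ofReal ‖u' x‖ ^ p < ⊤) {ε : ℝ} (hε : 0 < ε)
    (hlam : lam.rOut + ε < 1) :
    ∃ a ∈ ball (0 : EuclideanSpace ℝ (Fin m)) ε,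
      HasWeakFDerivOn (ball 0 2) (fun x => u (openingMap lam a x))
        (fun x => (u' (openingMap lam a x)).comp (fderiv ℝ (openingMap lam a) x)) ∧
      ∫⁻ x in ball 0 2, ENNReal.ofReal
        ‖(u' (openingMap lam a x)).comp (fderiv ℝ (openingMap lam a) x)‖ ^ p < ⊤ := by
  set K : Set (EuclideanSpace ℝ (Fin m)) := closedBall 0 (lam.rOut + ε) with hK
  have hKc : IsCompact K := isCompact_closedBall _ _
  have hK1 : K ⊆ ball 0 1 := closedBall_subset_ball hlam
  have happ : ∀ n : ℕ, ∃ g : EuclideanSpace ℝ (Fin m) → F, ContDiff ℝ ∞ g ∧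
      (∫⁻ x in K, ‖g x - u x‖ₑ ≤ 2⁻¹ ^ n) ∧ (∫⁻ x in K, ‖fderiv ℝ g x - u' x‖ₑ ≤ 2⁻¹ ^ n) := by
    intro n
    obtain ⟨g, h1, h2, h3, -⟩ := h.exists_contDiff_approx isOpen_ball hKc hK1
      (ε := 2⁻¹ ^ n) (by simp)
    exact ⟨g, h1, h2, h3⟩
  choose g hg hg1 hg2 using happ
  have hgc : ∀ n, Continuous (fderiv ℝ (g n)) := fun n => (hg n).continuous_fderiv (by simp)
  set T : ℕ → EuclideanSpace ℝ (Fin m) → ℝ≥0∞ := fun n x =>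
    ‖g n x - u x‖ₑ + ‖fderiv ℝ (g n) x - u' x‖ₑ with hT
  have m1 : ∀ n, Measurable fun x => ‖g n x - u x‖ₑ := fun n =>
    ((hg n).continuous.stronglyMeasurable.sub hu).enorm
  have m2 : ∀ n, Measurable fun x => ‖fderiv ℝ (g n) x - u' x‖ₑ := fun n =>
    ((hgc n).stronglyMeasurable.sub hu').enorm
  have mT : ∀ n, Measurable (T n) := fun n => (m1 n).add (m2 n)
  have mp : Measurable fun x => ENNReal.ofReal ‖u' x‖ ^ p :=
    (hu'.norm.measurable.ennreal_ofReal).pow_const p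
  -- All that has to be finite after composition is collected in one function: size, derivative,
  -- energy density and a summable series of approximation errors. A single averaging then treats
  -- everything at once. The chain rule for maps with bounded compression does not apply, as the
  -- opening map collapses the exterior to a point.
  set k : EuclideanSpace ℝ (Fin m) → ℝ≥0∞ := fun x =>
    ((‖u x‖ₑ + ‖u' x‖ₑ) + ENNReal.ofReal ‖u' x‖ ^ p) + ∑' n, T n x with hk
  have mk : Measurable k := (((hu.enorm).add hu'.enorm).add mp).add (Measurable.tsum mT)
  have hkfin : ∫⁻ x in K, k x < ⊤ := by
    have e : ∫⁻ x in K, k x = ((∫⁻ x in K, ‖u x‖ₑ) + (∫⁻ x in K, ‖u' x‖ₑ) +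
        ∫⁻ x in K, ENNReal.ofReal ‖u' x‖ ^ p) + ∑' n, ∫⁻ x in K, T n x := by
      rw [← lintegral_tsum fun n => (mT n).aemeasurable, ← lintegral_add_left hu.enorm,
        ← lintegral_add_left (f := fun x => ‖u x‖ₑ + ‖u' x‖ₑ) (hu.enorm.add hu'.enorm),
        ← lintegral_add_left (f := fun x => ‖u x‖ₑ + ‖u' x‖ₑ + ENNReal.ofReal ‖u' x‖ ^ p)
          ((hu.enorm.add hu'.enorm).add mp)]
    rw [e]
    refine ENNReal.add_lt_top.2 ⟨ENNReal.add_lt_top.2 ⟨ENNReal.add_lt_top.2 ⟨?_, ?_⟩, ?_⟩, ?_⟩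
    · exact (h.locallyIntegrableOn.integrableOn_compact_subset hK1 hKc).2
    · exact (h.locallyIntegrableOn_deriv.integrableOn_compact_subset hK1 hKc).2
    · exact (lintegral_mono_set hK1).trans_lt hE
    · calc ∑' n, ∫⁻ x in K, T n x ≤ ∑' n : ℕ, (2⁻¹ ^ n + 2⁻¹ ^ n : ℝ≥0∞) := by
            refine ENNReal.tsum_le_tsum fun n => ?_
            rw [hT, lintegral_add_left (m1 n)]
            exact add_le_add (hg1 n) (hg2 n)
        _ < ⊤ := by
            rw [ENNReal.tsum_add, ENNReal.tsum_geometric]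
            simp
  have hfin : ∫⁻ a in ball 0 ε, ∫⁻ x in ball 0 2, k (openingMap lam a x) < ⊤ :=
    (lintegral_lintegral_openingMap_ball_le lam mk).trans_lt
      (ENNReal.mul_lt_top measure_ball_lt_top hkfin)
  have hne : (ae (volume.restrict (ball (0 : EuclideanSpace ℝ (Fin m)) ε))).NeBot :=
    ae_restrict_neBot.2 (measure_ball_pos _ _ hε).ne'
  have mka : Measurable fun a => ∫⁻ x in ball 0 2, k (openingMap lam a x) :=
    (mk.comp (measurable_openingMap lam)).lintegral_prod_right'
  obtain ⟨a, hak, ha⟩ := ((ae_lt_top mka hfin.ne).and (ae_restrict_mem measurableSet_ball)).exists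
  refine ⟨a, ha, ?_⟩
  have mΦ : Measurable (openingMap lam a) := (contDiff_openingMap lam a).continuous.measurable
  set D := fderiv ℝ (openingMap lam a) with hD
  have hDc : Continuous D := (contDiff_openingMap lam a).continuous_fderiv (by simp)
  obtain ⟨L, hL⟩ := (isCompact_closedBall (0 : EuclideanSpace ℝ (Fin m)) 2).exists_bound_of_continuousOn
    hDc.continuousOn
  have hL2 : ∀ x ∈ ball (0 : EuclideanSpace ℝ (Fin m)) 2, ‖D x‖ₑ ≤ ENNReal.ofReal L := fun x hx => by
    rw [← ofReal_norm]
    exact ENNReal.ofReal_le_ofReal (hL x (ball_subset_closedBall hx))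
  have hcomp : ∀ (S : EuclideanSpace ℝ (Fin m) →L[ℝ] F), ∀ x ∈ ball (0 : EuclideanSpace ℝ (Fin m)) 2,
      ‖S.comp (D x)‖ₑ ≤ ENNReal.ofReal L * ‖S‖ₑ := fun S x hx => by
    calc ‖S.comp (D x)‖ₑ ≤ ‖S‖ₑ * ‖D x‖ₑ := by
          rw [← ofReal_norm, ← ofReal_norm, ← ofReal_norm, ← ENNReal.ofReal_mul (norm_nonneg _)]
          exact ENNReal.ofReal_le_ofReal (ContinuousLinearMap.opNorm_comp_le _ _)
      _ ≤ ‖S‖ₑ * ENNReal.ofReal L := by gcongr; exact hL2 x hx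
      _ = _ := mul_comm _ _
  have smf : StronglyMeasurable fun x => u (openingMap lam a x) := hu.comp_measurable mΦ
  have smf' : StronglyMeasurable fun x => (u' (openingMap lam a x)).comp (D x) :=
    (isBoundedBilinearMap_comp (𝕜 := ℝ)).continuous.comp_stronglyMeasurable
      ((hu'.comp_measurable mΦ).prodMk hDc.stronglyMeasurable)
  have f1 : ∫⁻ x in ball 0 2, ‖u (openingMap lam a x)‖ₑ < ⊤ :=
    (lintegral_mono fun x => (le_self_add.trans le_self_add).trans le_self_add).trans_lt hak
  have f2 : ∫⁻ x in ball 0 2, ‖u' (openingMap lam a x)‖ₑ < ⊤ :=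
    (lintegral_mono fun x => (le_add_self.trans le_self_add).trans le_self_add).trans_lt hak
  have f3 : ∫⁻ x in ball 0 2, ENNReal.ofReal ‖u' (openingMap lam a x)‖ ^ p < ⊤ :=
    (lintegral_mono fun x => le_add_self.trans le_self_add).trans_lt hak
  have f4 : ∑' n, ∫⁻ x in ball 0 2, T n (openingMap lam a x) < ⊤ := by
    rw [← lintegral_tsum (f := fun n x => T n (openingMap lam a x))
      fun n => ((mT n).comp mΦ).aemeasurable]
    exact (lintegral_mono fun x => le_add_self).trans_lt hak
  constructor
  · refine hasWeakFDerivOn_of_approx ?_ ?_ ?_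
    · exact IntegrableOn.locallyIntegrableOn ⟨smf.aestronglyMeasurable, f1⟩
    · refine IntegrableOn.locallyIntegrableOn ⟨smf'.aestronglyMeasurable, ?_⟩
      calc _ ≤ ∫⁻ x in ball 0 2, ENNReal.ofReal L * ‖u' (openingMap lam a x)‖ₑ :=
            setLIntegral_mono' measurableSet_ball fun x hx => hcomp _ x hx
        _ < ⊤ := by
            rw [lintegral_const_mul' _ _ ENNReal.ofReal_ne_top]
            exact ENNReal.mul_lt_top ENNReal.ofReal_lt_top f2
    · intro K₂ hK₂ hK₂c η hη
      -- Summability of the composed errors makes them tend to zero along the whole sequence for the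
      -- chosen centre.
      have ht := ENNReal.tendsto_atTop_zero_of_tsum_ne_top f4.ne
      have ht' : Tendsto (fun n => (1 + ENNReal.ofReal L) *
          ∫⁻ x in ball 0 2, T n (openingMap lam a x)) atTop (𝓝 0) := by
        have := ENNReal.Tendsto.const_mul (a := 1 + ENNReal.ofReal L) ht
          (Or.inr (by finiteness))
        simpa using this
      obtain ⟨n, hn⟩ := (ht'.eventually_lt_const (pos_iff_ne_zero.2 hη)).exists
      refine ⟨fun x => g n (openingMap lam a x),
        fun x => (fderiv ℝ (g n) (openingMap lam a x)).comp (D x), ?_, ?_, ?_⟩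
      · have hc : ContDiff ℝ 1 (fun x => g n (openingMap lam a x)) :=
          ((hg n).comp (contDiff_openingMap lam a)).of_le (by norm_num)
        have := hasWeakFDerivOn_of_contDiffOn (isOpen_ball (x := (0 : EuclideanSpace ℝ (Fin m)))
          (ε := 2)) hc.contDiffOn
        convert this using 2 with x
        rw [hD, ← fderiv_comp]
        · rfl
        · exact (hg n).differentiable (by simp) _
        · exact (contDiff_openingMap lam a).differentiable (by simp) _
      · calc _ ≤ ∫⁻ x in ball 0 2, T n (openingMap lam a x) :=
              (lintegral_mono_set hK₂).trans (lintegral_mono fun x => le_self_add)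
          _ ≤ (1 + ENNReal.ofReal L) * ∫⁻ x in ball 0 2, T n (openingMap lam a x) := by
              nth_rw 1 [← one_mul (∫⁻ x in ball 0 2, T n (openingMap lam a x))]
              gcongr
              exact le_self_add
          _ ≤ η := hn.le
      · calc _ ≤ ∫⁻ x in ball 0 2, ENNReal.ofReal L * T n (openingMap lam a x) := by
              refine (lintegral_mono_set hK₂).trans
                (setLIntegral_mono' measurableSet_ball fun x hx => ?_)
              rw [← ContinuousLinearMap.sub_comp]
              refine (hcomp _ x hx).trans ?_
              gcongr
              exact le_add_self
          _ = ENNReal.ofReal L * ∫⁻ x in ball 0 2, T n (openingMap lam a x) :=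
              lintegral_const_mul' _ _ ENNReal.ofReal_ne_top
          _ ≤ (1 + ENNReal.ofReal L) * ∫⁻ x in ball 0 2, T n (openingMap lam a x) := by
              gcongr
              exact le_add_self
          _ ≤ η := hn.le
  · have hL' : ENNReal.ofReal L ^ p ≠ ⊤ := ENNReal.rpow_ne_top_of_nonneg hp ENNReal.ofReal_ne_top
    calc _ ≤ ∫⁻ x in ball 0 2, ENNReal.ofReal L ^ p *
          ENNReal.ofReal ‖u' (openingMap lam a x)‖ ^ p := by
          refine setLIntegral_mono' measurableSet_ball fun x hx => ?_
          rw [← ENNReal.mul_rpow_of_nonneg _ _ hp, ofReal_norm, ofReal_norm]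
          gcongr
          exact hcomp _ x hx
      _ < ⊤ := by
          rw [lintegral_const_mul' _ _ hL']
          exact ENNReal.mul_lt_top (lt_top_iff_ne_top.2 hL') f3

end Opening

/-! ### Scaling of the energies. -/

section Dilation

variable {m : ℕ}

/-- The dilation with translation `x ↦ c + r x`. -/
def dilation (c : EuclideanSpace ℝ (Fin m)) (r : ℝ) (x : EuclideanSpace ℝ (Fin m)) :
    EuclideanSpace ℝ (Fin m) := c + r • x

variable (c : EuclideanSpace ℝ (Fin m)) {r : ℝ}

lemma contDiff_dilation {n : WithTop ℕ∞} : ContDiff ℝ n (dilation c r) :=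
  contDiff_const.add (contDiff_const_smul r)

lemma measurable_dilation : Measurable (dilation c r) :=
  (contDiff_dilation (n := 0) c).continuous.measurable

lemma fderiv_dilation (x : EuclideanSpace ℝ (Fin m)) :
    fderiv ℝ (dilation c r) x = r • ContinuousLinearMap.id ℝ _ := by
  have h : HasFDerivAt (dilation c r) (r • ContinuousLinearMap.id ℝ _) x :=
    ((hasFDerivAt_id x).const_smul r).const_add c
  exact h.fderiv

lemma edist_dilation (hr : 0 < r) (x y : EuclideanSpace ℝ (Fin m)) :
    edist (dilation c r x) (dilation c r y) = ENNReal.ofReal r * edist x y := by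
  rw [dilation, dilation, edist_add_left, edist_eq_enorm_sub, ← smul_sub, enorm_smul,
    Real.enorm_eq_ofReal hr.le, edist_eq_enorm_sub]

lemma map_dilation (hr : 0 < r) : (volume : Measure (EuclideanSpace ℝ (Fin m))).map (dilation c r) =
    (ENNReal.ofReal r ^ m)⁻¹ • volume := by
  have h1 : dilation c r = (fun x => c + x) ∘ fun x => r • x := rfl
  rw [h1, ← Measure.map_map (measurable_const_add c) (measurable_const_smul r),
    Measure.map_addHaar_smul volume hr.ne', finrank_euclideanSpace_fin, Measure.map_smul,
    map_add_left_eq_self, abs_of_pos (by positivity), ENNReal.ofReal_inv_of_pos (by positivity),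
    ENNReal.ofReal_pow hr.le]

lemma map_restrict_dilation (hr : 0 < r) {Ω : Set (EuclideanSpace ℝ (Fin m))}
    (hΩ : MeasurableSet Ω) : (volume.restrict (dilation c r ⁻¹' Ω)).map (dilation c r) =
      (ENNReal.ofReal r ^ m)⁻¹ • volume.restrict Ω := by
  rw [← Measure.restrict_map (measurable_dilation c) hΩ, map_dilation c hr, Measure.restrict_smul]

lemma preimage_dilation_ball (hr : 0 < r) (t : ℝ) :
    dilation c r ⁻¹' ball c (r * t) = ball 0 t := by
  ext x
  simp only [dilation, mem_preimage, mem_ball_iff_norm, add_sub_cancel_left, norm_smul,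
    Real.norm_of_nonneg hr.le, sub_zero]
  exact mul_lt_mul_iff_right₀ hr

variable {F : Type*} [NormedAddCommGroup F] [NormedSpace ℝ F] [CompleteSpace F]

lemma HasWeakFDerivOn.comp_dilation (hr : 0 < r) {Ω : Set (EuclideanSpace ℝ (Fin m))}
    (hΩ : IsOpen Ω) {f : EuclideanSpace ℝ (Fin m) → F}
    {f' : EuclideanSpace ℝ (Fin m) → EuclideanSpace ℝ (Fin m) →L[ℝ] F}
    (h : HasWeakFDerivOn Ω f f') :
    HasWeakFDerivOn (dilation c r ⁻¹' Ω) (fun x => f (dilation c r x))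
      (fun x => r • f' (dilation c r x)) := by
  have := HasWeakFDerivOn.comp hΩ (hΩ.preimage (contDiff_dilation (n := 0) c).continuous) h
    (contDiff_dilation c).contDiffOn (mapsTo_preimage _ _) fun K _ _ =>
      ⟨(ENNReal.ofReal r ^ m)⁻¹, by simp [hr], by
        rw [← map_dilation c hr]
        exact Measure.map_mono Measure.restrict_le_self (measurable_dilation c)⟩
  convert this using 2 with x
  rw [fderiv_dilation, ContinuousLinearMap.comp_smul, ContinuousLinearMap.comp_id]

/-- The gradient contributes `r ^ q` and the volume `r ^ (-m)`. -/
lemma dirichletEnergyOn_comp_dilation_le (hr : 0 < r) {Ω : Set (EuclideanSpace ℝ (Fin m))}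
    (hΩ : IsOpen Ω) {q : ℝ} (hq : 0 ≤ q) (f : EuclideanSpace ℝ (Fin m) → F) :
    dirichletEnergyOn (dilation c r ⁻¹' Ω) q (f ∘ dilation c r) ≤
      ENNReal.ofReal r ^ (q - m) * dirichletEnergyOn Ω q f := by
  have hr0 : ENNReal.ofReal r ≠ 0 := by simpa using hr
  have h0 : ENNReal.ofReal r ^ (q - m) ≠ 0 := by
    simp [ENNReal.rpow_eq_zero_iff, hr0, ENNReal.ofReal_ne_top]
  have ht : ENNReal.ofReal r ^ (q - m) ≠ ⊤ :=
    ENNReal.rpow_ne_top_of_ne_zero hr0 ENNReal.ofReal_ne_top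
  rw [dirichletEnergyOn, dirichletEnergyOn, ENNReal.mul_iInf_of_ne h0 ht]
  refine le_iInf fun f' => ?_
  rw [ENNReal.mul_iInf_of_ne h0 ht]
  refine le_iInf fun h => ?_
  refine (iInf₂_le _ (h.comp_dilation c hr hΩ)).trans (le_of_eq ?_)
  have hm : AEMeasurable (fun x => ENNReal.ofReal ‖f' x‖ ^ q) (volume.restrict Ω) :=
    (h.locallyIntegrableOn_deriv.aestronglyMeasurable.norm.aemeasurable.ennreal_ofReal).pow_const q
  have e1 : ∀ x, ENNReal.ofReal ‖r • f' (dilation c r x)‖ ^ q =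
      ENNReal.ofReal r ^ q * ENNReal.ofReal ‖f' (dilation c r x)‖ ^ q := fun x => by
    rw [norm_smul, Real.norm_of_nonneg hr.le, ENNReal.ofReal_mul hr.le,
      ENNReal.mul_rpow_of_nonneg _ _ hq]
  simp_rw [e1]
  rw [lintegral_const_mul' _ _ (ENNReal.rpow_ne_top_of_nonneg hq ENNReal.ofReal_ne_top),
    ← lintegral_map' (f := fun x => ENNReal.ofReal ‖f' x‖ ^ q)
      (by rw [map_restrict_dilation c hr hΩ.measurableSet]; exact hm.smul_measure _)
      (measurable_dilation c).aemeasurable, map_restrict_dilation c hr hΩ.measurableSet,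
    lintegral_smul_measure, smul_eq_mul, ← mul_assoc, ENNReal.rpow_sub _ _ hr0 ENNReal.ofReal_ne_top,
    ENNReal.rpow_natCast, div_eq_mul_inv]

/-- The kernel contributes `r ^ (m + s p)` and each of the two volumes `r ^ (-m)`. This is the
scaling of the Dirichlet energy with exponent `s p`, so both parts of a lifting scale alike. -/
lemma gagliardoEnergy_comp_dilation_le {N : Type*} [EMetricSpace N] [MeasurableSpace N]
    [OpensMeasurableSpace N] [SecondCountableTopology N] (hr : 0 < r)
    {Ω : Set (EuclideanSpace ℝ (Fin m))} (hΩ : MeasurableSet Ω) {s p : ℝ} (hs : 0 ≤ s)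
    (hp : 0 < p) {u : EuclideanSpace ℝ (Fin m) → N} (hu : AEMeasurable u (volume.restrict Ω)) :
    gagliardoEnergy edist m s p (volume.restrict (dilation c r ⁻¹' Ω)) (u ∘ dilation c r) ≤
      ENNReal.ofReal r ^ (s * p - m) * gagliardoEnergy edist m s p (volume.restrict Ω) u := by
  have hr0 : ENNReal.ofReal r ≠ 0 := by simpa using hr
  refine (gagliardoEnergy_comp_le (L := ENNReal.ofReal r) ENNReal.ofReal_ne_top hs hp
    (measurable_dilation c).aemeasurable (map_restrict_dilation c hr hΩ).le
    (ae_of_all _ fun x => ae_of_all _ fun y => (edist_dilation c hr x y).le) hu).trans_eq ?_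
  congr 1
  have e : (ENNReal.ofReal r ^ m)⁻¹ = ENNReal.ofReal r ^ (-(m : ℝ)) := by
    rw [ENNReal.rpow_neg, ENNReal.rpow_natCast]
  rw [e, ← ENNReal.rpow_add _ _ hr0 ENNReal.ofReal_ne_top,
    ← ENNReal.rpow_add _ _ hr0 ENNReal.ofReal_ne_top]
  congr 1
  ring

end Dilation

/-! ### The case `s = 1`: local liftings, gluing, energy identity. -/

section OrderOne

variable {m : ℕ}

lemma measurableEmbedding_coe_circle : MeasurableEmbedding fun z : Circle => (z : ℂ) := by
  have hc : Continuous fun z : Circle => (z : ℂ) := by fun_prop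
  exact (hc.isClosedEmbedding fun a b h => Circle.ext h).measurableEmbedding

lemma aemeasurable_of_coe_circle {X : Type*} [MeasurableSpace X] {μ : Measure X} {u : X → Circle}
    (hu : AEMeasurable (fun x => (u x : ℂ)) μ) : AEMeasurable u μ :=
  measurableEmbedding_coe_circle.aemeasurable_comp_iff.1 hu

/-- Opening with a generic centre leaves `u` unchanged on the ball of radius `r` and makes it
constant off the unit ball. After a rotation of the values and a dilation, it is a map in the chart
that extends by `1` to the manifold, where it lifts. -/
lemma HasWeakFDerivOn.exists_local_lifting {M : Type*} [EMetricSpace M]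
    [ChartedSpace (EuclideanSpace ℝ (Fin m)) M] [IsManifold (𝓡 m) ∞ M]
    [RiemannianBundle (fun x : M => TangentSpace (𝓡 m) x)] [MeasurableSpace M] [BorelSpace M]
    (Γ : LipschitzChart m M) {p : ℝ} (hp : 0 < p)
    (hlift : ∀ u : M → Circle, MemCircleSobolev m 1 p u →
      ∃ φ₁ φ₂ : M → ℝ, MemRealSobolev m 1 p φ₁ ∧ MemRealSobolev m 1 (1 * p) φ₂ ∧
        ∀ᵐ x ∂(μHE[m] : Measure M), u x = Circle.exp (φ₁ x + φ₂ x))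
    {u : EuclideanSpace ℝ (Fin m) → Circle}
    {u' : EuclideanSpace ℝ (Fin m) → EuclideanSpace ℝ (Fin m) →L[ℝ] ℂ}
    (h : HasWeakFDerivOn (ball 0 1) (fun x => (u x : ℂ)) u')
    (hE : ∫⁻ x in ball 0 1, ENNReal.ofReal ‖u' x‖ ^ p < ⊤) {r : ℝ} (hr : 0 < r) (hr1 : r < 1) :
    ∃ (φ : EuclideanSpace ℝ (Fin m) → ℝ)
      (φ' : EuclideanSpace ℝ (Fin m) → EuclideanSpace ℝ (Fin m) →L[ℝ] ℝ),
      HasWeakFDerivOn (ball 0 r) φ φ' ∧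
        ∀ᵐ x ∂(volume.restrict (ball 0 r)), u x = Circle.exp (φ x) := by
  have hu := aemeasurable_of_coe_circle h.locallyIntegrableOn.aestronglyMeasurable.aemeasurable
  have hu' := h.locallyIntegrableOn_deriv.aestronglyMeasurable
  set v := hu.mk u with hv
  set v' := hu'.mk u' with hv'
  have hvm : Measurable v := hu.measurable_mk
  have hvv : StronglyMeasurable fun x => (v x : ℂ) :=
    (measurable_coe_circle.comp hvm).stronglyMeasurable
  have hd : HasWeakFDerivOn (ball 0 1) (fun x => (v x : ℂ)) v' := h.congr_ae
    (hu.ae_eq_mk.mono fun x hx => by simp only [hx, hv]) hu'.ae_eq_mk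
  have hE' : ∫⁻ x in ball 0 1, ENNReal.ofReal ‖v' x‖ ^ p < ⊤ := by
    rwa [← lintegral_congr_ae (f := fun x => ENNReal.ofReal ‖u' x‖ ^ p)
      (hu'.ae_eq_mk.mono fun x hx => by simp only [hv', ← hx])]
  -- With `|a| < d`, the inner radius `r + d` covers the ball of radius `r`, and the outer radius `r
  -- + 2 d` leaves both `rOut + |a| < 1` and constancy for `|x| ≥ 1`.
  set d := (1 - r) / 4 with hdd
  have hd0 : 0 < d := by rw [hdd]; linarith
  have hrd : r + 4 * d = 1 := by rw [hdd]; ring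
  let lam : ContDiffBump (0 : EuclideanSpace ℝ (Fin m)) :=
    ⟨r + d, r + 2 * d, by linarith, by linarith⟩
  have hin : lam.rIn = r + d := rfl
  have hout : lam.rOut = r + 2 * d := rfl
  obtain ⟨a, ha, hW, hWE⟩ := hd.exists_openingMap lam hvv hu'.stronglyMeasurable_mk hp.le hE' hd0
    (by rw [hout]; linarith)
  have ha' : ‖a‖ < d := by simpa using ha
  set w₁ : EuclideanSpace ℝ (Fin m) → Circle := fun x => (v a)⁻¹ * v (openingMap lam a x) with hw₁
  have hw₁m : Measurable w₁ := by
    have h1 : Measurable fun x => v (openingMap lam a x) :=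
      hvm.comp (contDiff_openingMap lam a).continuous.measurable
    exact (continuous_const_mul ((v a)⁻¹)).measurable.comp h1
  have hw₁one : ∀ x ∉ ball (0 : EuclideanSpace ℝ (Fin m)) 1, w₁ x = 1 := fun x hx => by
    have h1 : 1 ≤ ‖x‖ := by simpa using hx
    have h2 : lam.rOut ≤ ‖x - a‖ := by
      have := norm_sub_norm_le x a
      rw [hout]
      linarith
    simp only [hw₁, openingMap_eq_center lam h2, inv_mul_cancel]
  have hw₁E : dirichletEnergyOn (ball 0 2) p (fun x => (w₁ x : ℂ)) < ⊤ := by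
    have h1 := hW.clm_comp (ContinuousLinearMap.mul ℝ ℂ ((v a : ℂ)⁻¹))
    refine (iInf₂_le _ (h1.congr_ae (ae_of_all _ fun x => ?_) EventuallyEq.rfl)).trans_lt ?_
    · simp [hw₁]
    · refine (lintegral_mono fun x => ?_).trans_lt hWE
      gcongr
      refine (ContinuousLinearMap.opNorm_comp_le _ _).trans ?_
      have : ‖ContinuousLinearMap.mul ℝ ℂ ((v a : ℂ)⁻¹)‖ ≤ 1 :=
        (ContinuousLinearMap.opNorm_mul_apply_le _ _ _).trans
          (by rw [norm_inv, Circle.norm_coe, inv_one])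
      exact mul_le_of_le_one_left (norm_nonneg _) this
  -- This scale sends the unit ball to the half ball of the chart and the ball of radius two onto
  -- the whole chart ball.
  set t := Γ.ρ / 2 with ht
  have ht0 : 0 < t := half_pos Γ.ρ_pos
  set δ := dilation (-(t⁻¹ • Γ.center)) t⁻¹ with hδ
  have hδe : ∀ y, δ y = t⁻¹ • (y - Γ.center) := fun y => by
    rw [hδ, dilation, smul_sub, sub_eq_add_neg, add_comm]
  have hδn : ∀ y, ‖δ y‖ = t⁻¹ * ‖y - Γ.center‖ := fun y => by
    rw [hδe, norm_smul, Real.norm_of_nonneg (inv_pos.2 ht0).le]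
  have hδd : ∀ x, δ (dilation Γ.center t x) = x := fun x => by
    rw [hδe, dilation, add_sub_cancel_left, smul_smul, inv_mul_cancel₀ ht0.ne', one_smul]
  have hB : Γ.B ⊆ δ ⁻¹' ball 0 2 := fun y hy => by
    rw [mem_preimage, mem_ball_zero_iff, hδn, inv_mul_lt_iff₀ ht0, ← dist_eq_norm]
    have := mem_ball.1 hy
    rw [ht]
    linarith
  have hB' : dilation Γ.center t ⁻¹' Γ.B = ball 0 2 := by
    rw [← preimage_dilation_ball Γ.center ht0, ht, div_mul_cancel₀ _ two_ne_zero]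
  have hwE := (dirichletEnergyOn_comp_dilation_le (-(t⁻¹ • Γ.center)) (inv_pos.2 ht0)
    isOpen_ball hp.le (fun x => (w₁ x : ℂ))).trans_lt (ENNReal.mul_lt_top (lt_top_iff_ne_top.2
      (ENNReal.rpow_ne_top_of_ne_zero (by simpa using ht0) ENNReal.ofReal_ne_top)) hw₁E)
  simp only [dirichletEnergyOn, iInf_lt_iff] at hwE
  obtain ⟨w', hw', hw'E⟩ := hwE
  obtain ⟨φ₁, φ₂, ⟨-, hφ₁⟩, ⟨-, hφ₂⟩, hφ⟩ := Γ.hasSobolevLifting_one (w := fun y => w₁ (δ y)) hp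
    hlift (hw₁m.comp (measurable_dilation _))
    (fun y hy => hw₁one _ fun hc => hy (by
      rw [mem_ball_zero_iff, hδn, inv_mul_lt_iff₀ ht0, mul_one, ← dist_eq_norm] at hc
      exact hc)) (hw'.mono hB) ((lintegral_mono_set hB).trans_lt hw'E)
  simp only [realEnergyOn, if_true, dirichletEnergyOn, iInf_lt_iff] at hφ₁ hφ₂
  obtain ⟨φ₁', hφ₁', -⟩ := hφ₁
  obtain ⟨φ₂', hφ₂', -⟩ := hφ₂
  have hsum := ((hφ₁'.add hφ₂').comp_dilation Γ.center ht0 isOpen_ball)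
  rw [hB'] at hsum
  -- The argument of `v a`, added as a constant to the lifting, undoes the rotation in `w₁`.
  have hβ : Circle.exp (Complex.arg (v a)) = v a := Circle.exp_arg _
  have hadd := hsum.add (hasWeakFDerivOn_const isOpen_ball (Complex.arg (v a)))
  have hr2 : ball (0 : EuclideanSpace ℝ (Fin m)) r ⊆ ball 0 2 := ball_subset_ball (by linarith)
  refine ⟨_, _, hadd.mono hr2, ?_⟩
  have hae : ∀ᵐ x ∂(volume.restrict (ball (0 : EuclideanSpace ℝ (Fin m)) 2)),
      w₁ (δ (dilation Γ.center t x)) =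
        Circle.exp (φ₁ (dilation Γ.center t x) + φ₂ (dilation Γ.center t x)) := by
    refine ae_of_ae_map (p := fun y => w₁ (δ y) = Circle.exp (φ₁ y + φ₂ y))
      (measurable_dilation Γ.center (r := t)).aemeasurable ?_
    rw [← hB', map_restrict_dilation Γ.center ht0 measurableSet_ball]
    exact Measure.smul_absolutelyContinuous hφ
  have hr1' : ball (0 : EuclideanSpace ℝ (Fin m)) r ⊆ ball 0 1 := ball_subset_ball hr1.le
  filter_upwards [ae_restrict_of_ae_restrict_of_subset hr2 hae,
    ae_restrict_of_ae_restrict_of_subset hr1' hu.ae_eq_mk, ae_restrict_mem measurableSet_ball]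
    with x hx1 hx2 hx3
  have hxr : ‖x‖ < r := by simpa using hx3
  have hid : openingMap lam a x = x := openingMap_eq_self lam (by
    rw [mem_closedBall_zero_iff, hin]
    exact (norm_sub_le _ _).trans (by linarith))
  rw [hδd] at hx1
  simp only [hw₁, hid] at hx1
  rw [Circle.exp_add, ← hx1, hβ, hx2, mul_comm, mul_inv_cancel_left]

/-- A family of weakly differentiable functions on balls that increase to the unit ball, that are
compatible up to null sets, can be glued. -/
lemma exists_hasWeakFDerivOn_of_compatible {ρ : ℕ → ℝ} (hρ : Monotone ρ)
    (hρ1 : ∀ r < 1, ∃ n, r < ρ n) {f : ℕ → EuclideanSpace ℝ (Fin m) → ℝ}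
    {f' : ℕ → EuclideanSpace ℝ (Fin m) → EuclideanSpace ℝ (Fin m) →L[ℝ] ℝ}
    (h : ∀ n, HasWeakFDerivOn (ball 0 (ρ n)) (f n) (f' n))
    (hc : ∀ n k, n ≤ k → f k =ᵐ[volume.restrict (ball 0 (ρ n))] f n) :
    ∃ g g', HasWeakFDerivOn (ball 0 1) g g' ∧
      ∀ n, g =ᵐ[volume.restrict (ball 0 (ρ n))] f n := by
  classical
  have hsub : ∀ {n k}, n ≤ k → ball (0 : EuclideanSpace ℝ (Fin m)) (ρ n) ⊆ ball 0 (ρ k) :=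
    fun hnk => ball_subset_ball (hρ hnk)
  have hc' : ∀ n k, n ≤ k → f' k =ᵐ[volume.restrict (ball 0 (ρ n))] f' n := fun n k hnk =>
    HasWeakFDerivOn.ae_eq isOpen_ball
      (((h k).mono (hsub hnk)).congr_ae (hc n k hnk) EventuallyEq.rfl) (h n)
  -- The glued function takes at `x` the value of the first member of the family whose ball contains
  -- `x`.
  set N : EuclideanSpace ℝ (Fin m) → ℕ := fun x =>
    if hx : ∃ n, x ∈ ball (0 : EuclideanSpace ℝ (Fin m)) (ρ n) then Nat.find hx else 0 with hN
  have key : ∀ {G : Type} (k : ℕ → EuclideanSpace ℝ (Fin m) → G),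
      (∀ n j, n ≤ j → k j =ᵐ[volume.restrict (ball 0 (ρ n))] k n) →
      ∀ n, (fun x => k (N x) x) =ᵐ[volume.restrict (ball 0 (ρ n))] k n := by
    intro G k hk n
    have h1 : ∀ j, ∀ᵐ x ∂(volume : Measure (EuclideanSpace ℝ (Fin m))),
        x ∈ ball (0 : EuclideanSpace ℝ (Fin m)) (ρ j) → j ≤ n → k n x = k j x := fun j => by
      by_cases hj : j ≤ n
      · filter_upwards [(ae_restrict_iff' measurableSet_ball).1 (hk j n hj)] with x hx hxj _
        exact hx hxj
      · exact ae_of_all _ fun x _ h => absurd h hj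
    filter_upwards [ae_restrict_of_ae (ae_all_iff.2 h1), ae_restrict_mem measurableSet_ball]
      with x hx hxn
    have hex : ∃ n, x ∈ ball (0 : EuclideanSpace ℝ (Fin m)) (ρ n) := ⟨n, hxn⟩
    have hNx : N x = Nat.find hex := by simp only [hN, dif_pos hex]
    rw [hNx]
    exact (hx _ (Nat.find_spec hex) (Nat.find_min' hex hxn)).symm
  have hg : ∀ n, HasWeakFDerivOn (ball 0 (ρ n)) (fun x => f (N x) x) (fun x => f' (N x) x) :=
    fun n => (h n).congr_ae (key f hc n).symm (key f' hc' n).symm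
  have hloc : ∀ {G : Type} [NormedAddCommGroup G] {k : EuclideanSpace ℝ (Fin m) → G},
      (∀ n, LocallyIntegrableOn k (ball 0 (ρ n))) → LocallyIntegrableOn k (ball 0 1) := by
    intro G _ k hk x hx
    obtain ⟨n, hn⟩ := hρ1 ‖x‖ (by simpa using hx)
    have hxn : x ∈ ball (0 : EuclideanSpace ℝ (Fin m)) (ρ n) := by simpa using hn
    have h1 := hk n x hxn
    rw [isOpen_ball.nhdsWithin_eq hxn] at h1
    rwa [isOpen_ball.nhdsWithin_eq hx]
  refine ⟨_, _, ⟨hloc fun n => (hg n).locallyIntegrableOn,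
    hloc fun n => (hg n).locallyIntegrableOn_deriv, fun ψ hψ hψc hψs v => ?_⟩, key f hc⟩
  obtain ⟨n, hn⟩ : ∃ n, tsupport ψ ⊆ ball 0 (ρ n) := by
    rcases (tsupport ψ).eq_empty_or_nonempty with he | hne
    · exact ⟨0, by simp [he]⟩
    obtain ⟨x, hx, hmax⟩ := hψc.isCompact.exists_isMaxOn hne continuous_norm.continuousOn
    obtain ⟨n, hn⟩ := hρ1 ‖x‖ (by simpa using hψs hx)
    exact ⟨n, fun y hy => by simpa using (hmax hy).trans_lt hn⟩
  have := (hg n).integral_eq ψ hψ hψc hn v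
  rwa [setIntegral_fderiv_smul_eq ψ hn, setIntegral_smul_eq ψ hn,
    ← setIntegral_fderiv_smul_eq ψ hψs, ← setIntegral_smul_eq ψ hψs] at this

/-- Two weakly differentiable liftings on a ball differ by a constant. -/
lemma HasWeakFDerivOn.exists_ae_eq_add_const {r : ℝ} (hr : 0 < r)
    {φ ψ : EuclideanSpace ℝ (Fin m) → ℝ}
    {φ' ψ' : EuclideanSpace ℝ (Fin m) → EuclideanSpace ℝ (Fin m) →L[ℝ] ℝ}
    (hφ : HasWeakFDerivOn (ball 0 r) φ φ') (hψ : HasWeakFDerivOn (ball 0 r) ψ ψ')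
    (h : ∀ᵐ x ∂(volume.restrict (ball 0 r)), Circle.exp (φ x) = Circle.exp (ψ x)) :
    ∃ a : ℝ, ∀ᵐ x ∂(volume.restrict (ball 0 r)), φ x = ψ x + a := by
  have h1 := HasWeakFDerivOn.ae_eq isOpen_ball (hφ.circle_exp isOpen_ball)
    ((hψ.circle_exp isOpen_ball).congr_ae (h.mono fun x hx => by simp only [hx])
      EventuallyEq.rfl)
  have h2 : (fun x => φ' x + (-ContinuousLinearMap.id ℝ ℝ).comp (ψ' x))
      =ᵐ[volume.restrict (ball 0 r)] 0 := by
    filter_upwards [h1, h] with x hx hx'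
    ext v
    have h3 := congrArg (fun L : EuclideanSpace ℝ (Fin m) →L[ℝ] ℂ => L v) hx
    simp only [ContinuousLinearMap.smulRight_apply, hx'] at h3
    -- Both derivatives multiply the same nonzero number `i exp (i ψ)`, which cancels.
    have h4 : φ' x v = ψ' x v := smul_left_injective ℝ (mul_ne_zero Complex.I_ne_zero
      (Circle.coe_ne_zero _)) h3
    simp [h4]
  obtain ⟨a, ha⟩ := ((hφ.add (hψ.clm_comp (-ContinuousLinearMap.id ℝ ℝ))).congr_ae
    EventuallyEq.rfl h2).exists_ae_eq_const hr
  refine ⟨a, ha.mono fun x hx => ?_⟩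
  rw [← hx]
  simp

/-- Liftings on nested balls differ by constants. Subtracting from each the constant by which it
differs from the first on the smallest ball makes the family compatible, and the glued function
lifts `u` up to one rotation. -/
lemma HasWeakFDerivOn.exists_lifting_of_local {u : EuclideanSpace ℝ (Fin m) → Circle}
    (h : ∀ r : ℝ, 0 < r → r < 1 → ∃ (φ : EuclideanSpace ℝ (Fin m) → ℝ)
      (φ' : EuclideanSpace ℝ (Fin m) → EuclideanSpace ℝ (Fin m) →L[ℝ] ℝ),
      HasWeakFDerivOn (ball 0 r) φ φ' ∧
        ∀ᵐ x ∂(volume.restrict (ball 0 r)), u x = Circle.exp (φ x)) :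
    ∃ (φ : EuclideanSpace ℝ (Fin m) → ℝ)
      (φ' : EuclideanSpace ℝ (Fin m) → EuclideanSpace ℝ (Fin m) →L[ℝ] ℝ),
      HasWeakFDerivOn (ball 0 1) φ φ' ∧
        ∀ᵐ x ∂(volume.restrict (ball 0 1)), u x = Circle.exp (φ x) := by
  set ρ : ℕ → ℝ := fun n => 1 - 1 / ((n : ℝ) + 2) with hρ
  have hρ0 : ∀ n, 0 < ρ n := fun n => by
    have : 1 / ((n : ℝ) + 2) < 1 := by rw [div_lt_one (by positivity)]; linarith [n.cast_nonneg (α := ℝ)]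
    simp only [hρ]; linarith
  have hρ1 : ∀ n, ρ n < 1 := fun n => by
    have : 0 < 1 / ((n : ℝ) + 2) := by positivity
    simp only [hρ]; linarith
  have hρm : Monotone ρ := fun n k hnk => by
    simp only [hρ]
    have : (n : ℝ) ≤ k := by exact_mod_cast hnk
    gcongr
  have hρe : ∀ r < 1, ∃ n, r < ρ n := fun r hr => by
    obtain ⟨n, hn⟩ := exists_nat_gt (1 / (1 - r))
    refine ⟨n, ?_⟩
    have h1 : 0 < 1 - r := by linarith
    have h2 : 1 / ((n : ℝ) + 2) < 1 - r := by
      rw [div_lt_comm₀ (by positivity) h1]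
      linarith
    simp only [hρ]; linarith
  choose φ φ' hφ hu using fun n => h (ρ n) (hρ0 n) (hρ1 n)
  have hsub : ∀ {n k}, n ≤ k → ball (0 : EuclideanSpace ℝ (Fin m)) (ρ n) ⊆ ball 0 (ρ k) :=
    fun hnk => ball_subset_ball (hρm hnk)
  have hdiff : ∀ n k, n ≤ k → ∃ a : ℝ,
      ∀ᵐ x ∂(volume.restrict (ball 0 (ρ n))), φ k x = φ n x + a := fun n k hnk =>
    ((hφ k).mono (hsub hnk)).exists_ae_eq_add_const (hρ0 n) (hφ n) (by
      filter_upwards [hu n, ae_restrict_of_ae_restrict_of_subset (hsub hnk) (hu k)] with x h1 h2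
      rw [← h1, ← h2])
  choose c hc using fun k => hdiff 0 k k.zero_le
  have hcomp : ∀ n k, n ≤ k → (fun x => φ k x + -c k)
      =ᵐ[volume.restrict (ball 0 (ρ n))] fun x => φ n x + -c n := by
    intro n k hnk
    obtain ⟨a, ha⟩ := hdiff n k hnk
    have hne : (ae (volume.restrict (ball (0 : EuclideanSpace ℝ (Fin m)) (ρ 0)))).NeBot :=
      ae_restrict_neBot.2 (measure_ball_pos _ _ (hρ0 0)).ne'
    obtain ⟨x, h1, h2, h3⟩ := ((hc n).and ((hc k).and
      (ae_restrict_of_ae_restrict_of_subset (hsub n.zero_le) ha))).exists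
    filter_upwards [ha] with y hy
    rw [hy]
    linarith
  obtain ⟨g, g', hg, hgn⟩ := exists_hasWeakFDerivOn_of_compatible hρm hρe
    (fun n => (hφ n).add (hasWeakFDerivOn_const isOpen_ball (-c n))) hcomp
  have hexp : ∀ n, ∀ᵐ x ∂(volume.restrict (ball (0 : EuclideanSpace ℝ (Fin m)) (ρ n))),
      Circle.exp (g x) = u x * Circle.exp (-c n) := fun n => by
    filter_upwards [hgn n, hu n] with x h1 h2
    rw [h1, h2, Circle.exp_add]
  -- The constants need not agree, but they agree modulo `2 π`, as both rotations relate the same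
  -- glued function to `u` on the smallest ball.
  have hcn : ∀ n, Circle.exp (-c n) = Circle.exp (-c 0) := fun n => by
    have hne : (ae (volume.restrict (ball (0 : EuclideanSpace ℝ (Fin m)) (ρ 0)))).NeBot :=
      ae_restrict_neBot.2 (measure_ball_pos _ _ (hρ0 0)).ne'
    obtain ⟨x, h1, h2⟩ := ((ae_restrict_of_ae_restrict_of_subset (hsub n.zero_le)
      (hexp n)).and (hexp 0)).exists
    exact mul_left_cancel (h1.symm.trans h2)
  refine ⟨_, _, hg.add (hasWeakFDerivOn_const isOpen_ball (c 0)), ?_⟩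
  have hall : ∀ᵐ x ∂(volume : Measure (EuclideanSpace ℝ (Fin m))), ∀ n,
      x ∈ ball (0 : EuclideanSpace ℝ (Fin m)) (ρ n) →
        Circle.exp (g x) = u x * Circle.exp (-c n) :=
    ae_all_iff.2 fun n => (ae_restrict_iff' measurableSet_ball).1 (hexp n)
  filter_upwards [ae_restrict_of_ae hall, ae_restrict_mem measurableSet_ball] with x hx hx1
  obtain ⟨n, hn⟩ := hρe ‖x‖ (by simpa using hx1)
  rw [Circle.exp_add, hx n (by simpa using hn), hcn n, mul_assoc, ← Circle.exp_add]
  simp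

/-- An almost everywhere lifting can be corrected on a null set. -/
lemma exists_ae_eq_forall_eq_exp {Ω : Set (EuclideanSpace ℝ (Fin m))}
    {u : EuclideanSpace ℝ (Fin m) → Circle} {φ₁ φ₂ : EuclideanSpace ℝ (Fin m) → ℝ}
    (h : ∀ᵐ x ∂(volume.restrict Ω), u x = Circle.exp (φ₁ x + φ₂ x)) :
    ∃ φ : EuclideanSpace ℝ (Fin m) → ℝ, φ =ᵐ[volume.restrict Ω] φ₁ ∧
      ∀ x, u x = Circle.exp (φ x + φ₂ x) := by
  classical
  refine ⟨fun x => if u x = Circle.exp (φ₁ x + φ₂ x) then φ₁ x else Complex.arg (u x) - φ₂ x,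
    h.mono fun x hx => by simp only [if_pos hx], fun x => ?_⟩
  by_cases hx : u x = Circle.exp (φ₁ x + φ₂ x)
  · simp only [if_pos hx]
    exact hx
  · simp only [if_neg hx, sub_add_cancel]
    exact (Circle.exp_arg _).symm

lemma dirichletEnergyOn_congr_ae {F : Type*} [NormedAddCommGroup F] [NormedSpace ℝ F]
    {Ω : Set (EuclideanSpace ℝ (Fin m))} {q : ℝ} {f g : EuclideanSpace ℝ (Fin m) → F}
    (h : f =ᵐ[volume.restrict Ω] g) : dirichletEnergyOn Ω q f = dirichletEnergyOn Ω q g := by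
  have key : ∀ f', HasWeakFDerivOn Ω f f' ↔ HasWeakFDerivOn Ω g f' := fun f' =>
    ⟨fun hf => hf.congr_ae h EventuallyEq.rfl, fun hg => hg.congr_ae h.symm EventuallyEq.rfl⟩
  simp only [dirichletEnergyOn, key]

lemma realEnergyOn_congr_ae {Ω : Set (EuclideanSpace ℝ (Fin m))} {s p : ℝ}
    {f g : EuclideanSpace ℝ (Fin m) → ℝ} (h : f =ᵐ[volume.restrict Ω] g) :
    realEnergyOn Ω s p f = realEnergyOn Ω s p g := by
  unfold realEnergyOn
  rw [dirichletEnergyOn_congr_ae h, gagliardoEnergy_congr h]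

lemma dirichletEnergyOn_const {F : Type*} [NormedAddCommGroup F] [NormedSpace ℝ F]
    {Ω : Set (EuclideanSpace ℝ (Fin m))} (hΩ : IsOpen Ω) {q : ℝ} (hq : 0 < q) (c : F) :
    dirichletEnergyOn Ω q (fun _ => c) = 0 := by
  refine le_antisymm ((iInf₂_le _ (hasWeakFDerivOn_const hΩ c)).trans ?_) zero_le
  simp [hq]

/-- The main theorem for weakly differentiable maps, with constant `1`. -/
lemma exists_lifting_order_one {M : Type*} [EMetricSpace M]
    [ChartedSpace (EuclideanSpace ℝ (Fin m)) M] [IsManifold (𝓡 m) ∞ M]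
    [RiemannianBundle (fun x : M => TangentSpace (𝓡 m) x)] [MeasurableSpace M] [BorelSpace M]
    (Γ : LipschitzChart m M) {p : ℝ} (hp : 0 < p)
    (hlift : ∀ u : M → Circle, MemCircleSobolev m 1 p u →
      ∃ φ₁ φ₂ : M → ℝ, MemRealSobolev m 1 p φ₁ ∧ MemRealSobolev m 1 (1 * p) φ₂ ∧
        ∀ᵐ x ∂(μHE[m] : Measure M), u x = Circle.exp (φ₁ x + φ₂ x))
    {u : EuclideanSpace ℝ (Fin m) → Circle} (hu : MemCircleSobolevOn (ball 0 1) 1 p u) :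
    ∃ φ₁ φ₂ : EuclideanSpace ℝ (Fin m) → ℝ,
      MemRealSobolevOn (ball 0 1) 1 p φ₁ ∧ MemRealSobolevOn (ball 0 1) 1 (1 * p) φ₂ ∧
      (∀ x ∈ ball (0 : EuclideanSpace ℝ (Fin m)) 1, u x = Circle.exp (φ₁ x + φ₂ x)) ∧
      realEnergyOn (ball 0 1) 1 p φ₁ + realEnergyOn (ball 0 1) 1 (1 * p) φ₂ ≤
        ENNReal.ofReal 1 * circleEnergyOn (ball 0 1) 1 p u := by
  have hE := hu.2
  simp only [circleEnergyOn, if_true] at hE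
  have hE' := hE
  simp only [dirichletEnergyOn, iInf_lt_iff] at hE'
  obtain ⟨u', hu', hfin⟩ := hE'
  obtain ⟨φ, φ', hφ, hφu⟩ := HasWeakFDerivOn.exists_lifting_of_local fun r hr hr1 =>
    hu'.exists_local_lifting Γ hp hlift hfin hr hr1
  obtain ⟨φ₁, hφ₁, hall⟩ := exists_ae_eq_forall_eq_exp (φ₁ := φ)
    (φ₂ := fun _ => 0) (by simpa using hφu)
  have hz : realEnergyOn (ball 0 1) 1 (1 * p) (fun _ : EuclideanSpace ℝ (Fin m) => (0 : ℝ)) = 0 := by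
    simp only [realEnergyOn, if_true]
    exact dirichletEnergyOn_const isOpen_ball (by linarith) 0
  have hle : realEnergyOn (ball 0 1) 1 p φ₁ ≤ circleEnergyOn (ball 0 1) 1 p u := by
    rw [realEnergyOn_congr_ae hφ₁]
    simp only [realEnergyOn, circleEnergyOn, if_true]
    refine (iInf₂_le _ hφ).trans (le_iInf₂ fun v' hv' => le_of_eq ?_)
    -- Every weak derivative of `u` is almost everywhere `i exp (i φ) φ'`, whose norm is that of
    -- `φ'`.
    have h1 := HasWeakFDerivOn.ae_eq isOpen_ball ((hφ.circle_exp isOpen_ball).congr_ae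
      (hφu.mono fun x hx => by simp only [hx]) EventuallyEq.rfl) hv'
    refine lintegral_congr_ae (h1.mono fun x hx => ?_)
    simp only [← hx, norm_smulRight_I_mul_coe]
  refine ⟨φ₁, fun _ => 0, ⟨?_, hle.trans_lt hu.2⟩, ⟨aemeasurable_const, by rw [hz]; simp⟩,
    fun x _ => hall x, ?_⟩
  · exact (hφ.locallyIntegrableOn.aestronglyMeasurable.congr hφ₁.symm).aemeasurable
  · rw [hz, add_zero, ENNReal.ofReal_one, one_mul]
    exact hle

end OrderOne

/-! ### Estimates for averages over the centre of an opening. -/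

section Averaging

variable {m : ℕ}

lemma lintegral_const_mul_add {X : Type*} [MeasurableSpace X] {μ : Measure X} (c : ℝ≥0∞)
    {f g : X → ℝ≥0∞} (hf : Measurable f) (hg : Measurable g) :
    ∫⁻ x, c * (f x + g x) ∂μ = c * ((∫⁻ x, f x ∂μ) + ∫⁻ x, g x ∂μ) := by
  rw [← lintegral_add_left hf, ← lintegral_const_mul c (f := fun x => f x + g x) (hf.add hg)]

/-- The average of a quasi-distance over parallel segments, estimated by intermediate points. -/
lemma setLIntegral_le_mul_lintegral_ball
    {D : EuclideanSpace ℝ (Fin m) → EuclideanSpace ℝ (Fin m) → ℝ≥0∞}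
    (hD : Measurable (Function.uncurry D)) {q : ℝ≥0∞}
    (hq : ∀ b c z, ‖b‖ < 12 → ‖c‖ < 12 → ‖z‖ < 12 → D b c ≤ q * (D b z + D z c))
    {X Y : EuclideanSpace ℝ (Fin m)} (hX : ‖X‖ ≤ 3) (hY : ‖Y‖ ≤ 3) :
    (∫⁻ a in ball 0 1, D (X + a) (Y + a)) * volume (ball (0 : EuclideanSpace ℝ (Fin m)) ‖Y - X‖) ≤
      q * (2 * ∫⁻ k in ball 0 (2 * ‖Y - X‖), ∫⁻ b, D b (b + k)) := by
  set h := Y - X with hh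
  set G : EuclideanSpace ℝ (Fin m) → ℝ≥0∞ := fun k => ∫⁻ b, D b (b + k) with hG
  have hGm : Measurable G := by
    have : Measurable fun z : EuclideanSpace ℝ (Fin m) × EuclideanSpace ℝ (Fin m) =>
        D z.2 (z.2 + z.1) :=
      hD.comp (measurable_snd.prodMk (measurable_snd.add measurable_fst))
    exact this.lintegral_prod_right'
  have hhn : ‖h‖ ≤ 6 := (norm_sub_le _ _).trans (by linarith)
  -- The intermediate point is `X + a + k` with `|k| < |Y - X|`. All points involved have norm below
  -- `3 + 1 + 6 = 10`, hence below `12`. Translation invariance turns the two averages into `G k`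
  -- and `G (h - k)`; averaging in `k` follows.
  have hT : ∀ k ∈ ball (0 : EuclideanSpace ℝ (Fin m)) ‖h‖,
      ∫⁻ a in ball 0 1, D (X + a) (Y + a) ≤ q * (G k + G (h - k)) := by
    intro k hk
    have hk' : ‖k‖ < ‖h‖ := by simpa using hk
    have m1 : Measurable fun a => D (X + a) (X + a + k) :=
      hD.comp ((measurable_const_add X).prodMk ((measurable_const_add X).add_const k))
    have m2 : Measurable fun a => D (X + a + k) (Y + a) :=
      hD.comp (((measurable_const_add X).add_const k).prodMk (measurable_const_add Y))
    calc ∫⁻ a in ball 0 1, D (X + a) (Y + a)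
        ≤ ∫⁻ a in ball 0 1, q * (D (X + a) (X + a + k) + D (X + a + k) (Y + a)) := by
          refine setLIntegral_mono' measurableSet_ball fun a ha => ?_
          have ha' : ‖a‖ < 1 := by simpa using ha
          have h1 := norm_add_le X a
          have h2 := norm_add_le Y a
          have h3 := norm_add_le (X + a) k
          exact hq _ _ _ (by linarith) (by linarith) (by linarith)
      _ ≤ ∫⁻ a, q * (D (X + a) (X + a + k) + D (X + a + k) (Y + a)) :=
          setLIntegral_le_lintegral _ _
      _ = q * ((∫⁻ a, D (X + a) (X + a + k)) + ∫⁻ a, D (X + a + k) (Y + a)) :=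
          lintegral_const_mul_add q m1 m2
      _ = q * (G k + G (h - k)) := by
          congr 2
          · exact lintegral_add_left_eq_self (fun b => D b (b + k)) X
          · simp only [hG]
            rw [← lintegral_add_left_eq_self (fun b => D b (b + (h - k))) (X + k)]
            refine lintegral_congr fun a => ?_
            congr 1
            · abel
            · rw [hh]; abel
  have hsub : ball (0 : EuclideanSpace ℝ (Fin m)) ‖h‖ ⊆ ball 0 (2 * ‖h‖) :=
    ball_subset_ball (by linarith [norm_nonneg h])
  have hG2 : ∫⁻ k in ball 0 ‖h‖, G (h - k) ≤ ∫⁻ k in ball 0 (2 * ‖h‖), G k := by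
    calc ∫⁻ k in ball 0 ‖h‖, G (h - k)
        ≤ ∫⁻ k, (ball 0 (2 * ‖h‖)).indicator G (h - k) := by
          rw [← lintegral_indicator measurableSet_ball]
          refine lintegral_mono fun k => ?_
          by_cases hk : k ∈ ball (0 : EuclideanSpace ℝ (Fin m)) ‖h‖
          · rw [indicator_of_mem hk, indicator_of_mem]
            have hk' : ‖k‖ < ‖h‖ := by simpa using hk
            rw [mem_ball_zero_iff]
            linarith [norm_sub_le h k]
          · rw [indicator_of_notMem hk]
            exact zero_le
      _ = ∫⁻ k in ball 0 (2 * ‖h‖), G k := by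
          rw [lintegral_sub_left_eq_self (fun k => (ball 0 (2 * ‖h‖)).indicator G k) h,
            lintegral_indicator measurableSet_ball]
  calc (∫⁻ a in ball 0 1, D (X + a) (Y + a)) * volume (ball (0 : EuclideanSpace ℝ (Fin m)) ‖h‖)
      = ∫⁻ _ in ball (0 : EuclideanSpace ℝ (Fin m)) ‖h‖,
          ∫⁻ a in ball 0 1, D (X + a) (Y + a) := (setLIntegral_const _ _).symm
    _ ≤ ∫⁻ k in ball 0 ‖h‖, q * (G k + G (h - k)) := setLIntegral_mono' measurableSet_ball hT
    _ = q * ((∫⁻ k in ball 0 ‖h‖, G k) + ∫⁻ k in ball 0 ‖h‖, G (h - k)) :=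
        lintegral_const_mul_add q hGm (hGm.comp (measurable_const.sub measurable_id))
    _ ≤ q * ((∫⁻ k in ball 0 (2 * ‖h‖), G k) + ∫⁻ k in ball 0 (2 * ‖h‖), G k) := by
        gcongr
    _ = _ := by rw [two_mul (∫⁻ k in ball 0 (2 * ‖h‖), G k)]

/-- The singular integral that arises by averaging over openings. -/
lemma exists_lintegral_lintegral_le {φ : EuclideanSpace ℝ (Fin m) → EuclideanSpace ℝ (Fin m)}
    {R : ℝ} (h0 : ∀ x ∉ ball (0 : EuclideanSpace ℝ (Fin m)) R, φ x = 0) {L : ℝ≥0} (hL : 0 < L)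
    (hφ : LipschitzWith L φ) {σ : ℝ} (hσ : 0 < σ) :
    ∃ C : ℝ≥0∞, C ≠ ⊤ ∧ ∀ k : EuclideanSpace ℝ (Fin m), k ≠ 0 →
      ∫⁻ x, ∫⁻ y, {z : EuclideanSpace ℝ (Fin m) × EuclideanSpace ℝ (Fin m) |
          ‖k‖ₑ < 2 * edist (φ z.1) (φ z.2)}.indicator (fun z => (edist (φ z.1) (φ z.2) ^ (m : ℝ))⁻¹ *
            (edist z.1 z.2 ^ ((m : ℝ) + σ))⁻¹) (x, y) ≤ C * (‖k‖ₑ ^ ((m : ℝ) + σ))⁻¹ := by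
  set τ := ∫⁻ z in {z : EuclideanSpace ℝ (Fin m) | 1 ≤ ‖z‖ₑ}, (‖z‖ₑ ^ ((m : ℝ) + σ))⁻¹ with hτ
  have hτt : τ < ⊤ := lintegral_inv_enorm_rpow_lt_top (by linarith)
  set C₁ : ℝ≥0∞ := ENNReal.ofReal (2 ^ (m : ℝ) * (2 * L) ^ σ) with hC₁
  refine ⟨C₁ * (2 * volume (ball (0 : EuclideanSpace ℝ (Fin m)) R) * τ), by
    have := measure_ball_lt_top (μ := volume) (x := (0 : EuclideanSpace ℝ (Fin m))) (r := R)
    finiteness, fun k hk => ?_⟩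
  have hk0 : 0 < ‖k‖ := norm_pos_iff.2 hk
  have hL0 : (0 : ℝ) < L := hL
  -- The constraint `|k| < 2 |φ x - φ y| ≤ 2 L |x - y|` forces `|x - y| ≥ t`, so only the tail of
  -- the kernel beyond `t` is integrated.
  set t : ℝ := ‖k‖ / (2 * L) with ht
  have ht0 : 0 < t := by positivity
  set g : EuclideanSpace ℝ (Fin m) → ℝ≥0∞ :=
    {z : EuclideanSpace ℝ (Fin m) | ENNReal.ofReal t ≤ ‖z‖ₑ}.indicator
      fun z => (‖z‖ₑ ^ ((m : ℝ) + σ))⁻¹ with hg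
  have hms : MeasurableSet {z : EuclideanSpace ℝ (Fin m) | ENNReal.ofReal t ≤ ‖z‖ₑ} :=
    measurableSet_le measurable_const measurable_enorm
  have hgm : Measurable g := ((measurable_enorm.pow_const _).inv).indicator hms
  have hgi : ∫⁻ z, g z = ENNReal.ofReal t ^ (-σ) * τ := by
    rw [hg, lintegral_indicator hms, lintegral_inv_enorm_rpow_eq ht0]
    congr 2
    ring
  set B := ball (0 : EuclideanSpace ℝ (Fin m)) R with hB
  set κ : ℝ≥0∞ := ((‖k‖ₑ / 2) ^ (m : ℝ))⁻¹ with hκ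
  have hpt : ∀ x y, {z : EuclideanSpace ℝ (Fin m) × EuclideanSpace ℝ (Fin m) |
          ‖k‖ₑ < 2 * edist (φ z.1) (φ z.2)}.indicator (fun z => (edist (φ z.1) (φ z.2) ^ (m : ℝ))⁻¹ *
            (edist z.1 z.2 ^ ((m : ℝ) + σ))⁻¹) (x, y) ≤
      κ * (B.indicator 1 x * g (x - y) + B.indicator 1 y * g (x - y)) := by
    intro x y
    by_cases hxy : ‖k‖ₑ < 2 * edist (φ x) (φ y)
    · rw [indicator_of_mem (by exact hxy)]
      have h1 : κ ≥ (edist (φ x) (φ y) ^ (m : ℝ))⁻¹ := by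
        rw [hκ]
        gcongr
        exact ENNReal.div_le_of_le_mul' hxy.le
      have h2 : g (x - y) = (edist x y ^ ((m : ℝ) + σ))⁻¹ := by
        rw [hg, indicator_of_mem, edist_eq_enorm_sub]
        have h3 := hφ x y
        have h2' : (2 : ℝ≥0∞) = ENNReal.ofReal 2 := by simp
        have h4 : ‖k‖ₑ ≤ ENNReal.ofReal 2 * (L * edist x y) :=
          hxy.le.trans (by rw [← h2']; gcongr)
        rw [mem_ofPred_eq, ← edist_eq_enorm_sub, ht, edist_dist]
        rw [edist_dist, ← ofReal_norm, ← ENNReal.ofReal_coe_nnreal,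
          ← ENNReal.ofReal_mul (by positivity), ← ENNReal.ofReal_mul (by positivity), ENNReal.ofReal_le_ofReal_iff (by positivity)] at h4
        refine ENNReal.ofReal_le_ofReal ?_
        rw [div_le_iff₀ (by positivity)]
        linarith
      -- At least one of the two points lies in the ball of radius `R`, otherwise `φ x = φ y = 0`.
      -- This keeps the double integral finite on an unbounded domain.
      have h5 : (1 : ℝ≥0∞) ≤ B.indicator 1 x + B.indicator 1 y := by
        by_cases hx : x ∈ B
        · rw [indicator_of_mem hx]
          exact le_self_add
        · by_cases hy : y ∈ B
          · rw [indicator_of_mem hy]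
            exact le_add_self
          · rw [h0 x hx, h0 y hy, edist_self, mul_zero] at hxy
            exact absurd hxy not_lt_zero
      simp only
      rw [← h2, ← add_mul]
      calc _ ≤ κ * (1 * g (x - y)) := by rw [one_mul]; gcongr
        _ ≤ _ := by gcongr
    · rw [indicator_of_notMem (by exact hxy)]
      exact zero_le
  have hgx : ∀ x : EuclideanSpace ℝ (Fin m), ∫⁻ y, g (x - y) = ∫⁻ z, g z := fun x =>
    lintegral_sub_left_eq_self g x
  have hBm : Measurable (B.indicator (1 : EuclideanSpace ℝ (Fin m) → ℝ≥0∞)) :=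
    measurable_one.indicator measurableSet_ball
  have hBi : ∫⁻ x, B.indicator (1 : EuclideanSpace ℝ (Fin m) → ℝ≥0∞) x = volume B :=
    lintegral_indicator_one measurableSet_ball
  have hgm2 : Measurable fun z : EuclideanSpace ℝ (Fin m) × EuclideanSpace ℝ (Fin m) =>
      g (z.1 - z.2) := hgm.comp (measurable_fst.sub measurable_snd)
  have i1 : ∫⁻ x, ∫⁻ y, B.indicator (1 : EuclideanSpace ℝ (Fin m) → ℝ≥0∞) x * g (x - y) =
      volume B * ∫⁻ z, g z := by
    refine (lintegral_congr fun x => (lintegral_const_mul _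
      (hgm.comp (measurable_const.sub measurable_id))).trans (congrArg (B.indicator 1 x * ·) (hgx x))).trans ?_
    rw [lintegral_mul_const _ hBm, hBi]
  have i2 : ∫⁻ x, ∫⁻ y, B.indicator (1 : EuclideanSpace ℝ (Fin m) → ℝ≥0∞) y * g (x - y) =
      volume B * ∫⁻ z, g z := by
    rw [lintegral_lintegral_swap ((hBm.comp measurable_snd).mul hgm2).aemeasurable]
    have : ∀ y : EuclideanSpace ℝ (Fin m), ∫⁻ x, g (x - y) = ∫⁻ z, g z := fun y =>
      lintegral_sub_right_eq_self g y
    refine (lintegral_congr fun y => (lintegral_const_mul _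
      (hgm.comp (measurable_id.sub measurable_const))).trans (congrArg (B.indicator 1 y * ·) (this y))).trans ?_
    rw [lintegral_mul_const _ hBm, hBi]
  calc _ ≤ ∫⁻ x, ∫⁻ y, κ * (B.indicator 1 x * g (x - y) + B.indicator 1 y * g (x - y)) :=
        lintegral_mono fun x => lintegral_mono fun y => hpt x y
    _ = κ * ((∫⁻ x, ∫⁻ y, B.indicator 1 x * g (x - y)) +
          ∫⁻ x, ∫⁻ y, B.indicator 1 y * g (x - y)) := by
        have n1 : Measurable fun z : EuclideanSpace ℝ (Fin m) × EuclideanSpace ℝ (Fin m) =>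
            B.indicator (1 : EuclideanSpace ℝ (Fin m) → ℝ≥0∞) z.1 * g (z.1 - z.2) :=
          (hBm.comp measurable_fst).mul hgm2
        have n2 : Measurable fun z : EuclideanSpace ℝ (Fin m) × EuclideanSpace ℝ (Fin m) =>
            B.indicator (1 : EuclideanSpace ℝ (Fin m) → ℝ≥0∞) z.2 * g (z.1 - z.2) :=
          (hBm.comp measurable_snd).mul hgm2
        exact (lintegral_congr fun x => lintegral_const_mul_add κ
          (n1.comp (measurable_const.prodMk measurable_id))
          (n2.comp (measurable_const.prodMk measurable_id))).trans
          (lintegral_const_mul_add κ n1.lintegral_prod_right' n2.lintegral_prod_right')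
    _ = κ * ENNReal.ofReal t ^ (-σ) * (2 * volume B * τ) := by
        rw [i1, i2, hgi]; ring
    _ = _ := by
        have hk2 : ‖k‖ₑ / 2 = ENNReal.ofReal (‖k‖ / 2) := by
          rw [ENNReal.ofReal_div_of_pos (by norm_num), ofReal_norm]
          simp
        have e : κ * ENNReal.ofReal t ^ (-σ) = C₁ * (‖k‖ₑ ^ ((m : ℝ) + σ))⁻¹ := by
          rw [hκ, hC₁, hk2, ← ofReal_norm, ENNReal.ofReal_rpow_of_pos (by positivity),
            ENNReal.ofReal_rpow_of_pos ht0, ENNReal.ofReal_rpow_of_pos hk0,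
            ← ENNReal.ofReal_inv_of_pos (by positivity),
            ← ENNReal.ofReal_inv_of_pos (by positivity), ← ENNReal.ofReal_mul (by positivity),
            ← ENNReal.ofReal_mul (by positivity)]
          congr 1
          rw [ht, Real.rpow_neg (by positivity), Real.div_rpow hk0.le (by norm_num),
            Real.div_rpow hk0.le (by positivity), Real.rpow_add hk0]
          field_simp
        rw [e]
        ring

end Averaging

/-! ### Opening with controlled fractional energy. -/

section OpeningEnergy

variable {m : ℕ}

lemma lintegral_lintegral_lintegral_swap {α β : Type*} [MeasurableSpace α] [MeasurableSpace β]
    {μ : Measure α} {ν : Measure β} [SFinite μ] [SFinite ν] {f : α → β → β → ℝ≥0∞}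
    (hf : Measurable fun z : α × β × β => f z.1 z.2.1 z.2.2) :
    ∫⁻ a, ∫⁻ x, ∫⁻ y, f a x y ∂ν ∂ν ∂μ = ∫⁻ x, ∫⁻ y, ∫⁻ a, f a x y ∂μ ∂ν ∂ν := by
  have h1 : Measurable fun z : (α × β) × β => f z.1.1 z.1.2 z.2 :=
    hf.comp (measurable_fst.fst.prodMk (measurable_fst.snd.prodMk measurable_snd))
  rw [lintegral_lintegral_swap (f := fun a x => ∫⁻ y, f a x y ∂ν)
    h1.lintegral_prod_right'.aemeasurable]
  refine lintegral_congr fun x => lintegral_lintegral_swap (Measurable.aemeasurable ?_)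
  exact hf.comp (measurable_fst.prodMk (measurable_const.prodMk measurable_snd))

/-- Opening with a well-chosen center increases the fractional energy by a bounded factor. -/
lemma exists_gagliardoEnergy_openingMap_le {s p : ℝ} (hs : 0 < s) (hp : 1 ≤ p)
    (lam : ContDiffBump (0 : EuclideanSpace ℝ (Fin m))) (hlam : lam.rOut = 3) :
    ∃ A : ℝ≥0∞, A ≠ ⊤ ∧ ∀ v : EuclideanSpace ℝ (Fin m) → Circle, Measurable v →
      ∃ a ∈ ball (0 : EuclideanSpace ℝ (Fin m)) 1,
        gagliardoEnergy edist m s p volume (fun x => v (openingMap lam a x)) ≤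
          A * gagliardoEnergy edist m s p (volume.restrict (ball 0 12)) v := by
  have hp0 : 0 < p := by linarith
  have hσ : 0 < s * p := mul_pos hs hp0
  set r : ℝ := (m : ℝ) + s * p with hr
  set φ : EuclideanSpace ℝ (Fin m) → EuclideanSpace ℝ (Fin m) := fun y => lam y • y with hφ
  have hφc : Continuous φ := (contDiff_smul_self lam).continuous
  have hφm : Measurable φ := hφc.measurable
  have hφ3 : ∀ x, ‖φ x‖ ≤ 3 := fun x => (norm_smul_self_le lam x).trans hlam.le
  have hφ0 : ∀ x ∉ ball (0 : EuclideanSpace ℝ (Fin m)) 3, φ x = 0 := fun x hx => by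
    simp only [hφ]
    rw [lam.zero_of_le_dist (by simpa [hlam] using hx), zero_smul]
  obtain ⟨L, hL⟩ := ContDiff.lipschitzWith_of_hasCompactSupport (𝕂 := ℝ)
    (hasCompactSupport_smul_self lam) (contDiff_smul_self lam) (by simp)
  obtain ⟨C, hC, hCk⟩ := exists_lintegral_lintegral_le (L := L + 1) hφ0 (by positivity)
    (hL.weaken (by simp)) hσ
  set vol₁ := volume (ball (0 : EuclideanSpace ℝ (Fin m)) 1) with hvol₁
  have hvol₁0 : vol₁ ≠ 0 := (measure_ball_pos _ _ one_pos).ne'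
  have hvol₁t : vol₁ ≠ ⊤ := measure_ball_lt_top.ne
  set q : ℝ≥0∞ := 2 ^ (p - 1) with hq
  have hqt : q ≠ ⊤ := ENNReal.rpow_ne_top_of_nonneg (by linarith) (by simp)
  refine ⟨2 * q * vol₁⁻¹ * C / vol₁, by finiteness, fun v hv => ?_⟩
  set B : Set (EuclideanSpace ℝ (Fin m)) := ball 0 12 with hB
  -- The `p`-th power of the distance of values, cut off outside `B`, so that integrals over all of
  -- space reproduce the energy on `B`. The quasi-triangle inequality is needed for points of `B`
  -- only.
  obtain ⟨D, hD⟩ : ∃ D : EuclideanSpace ℝ (Fin m) → EuclideanSpace ℝ (Fin m) → ℝ≥0∞,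
      ∀ b c, D b c = (B ×ˢ B).indicator (fun z => edist (v z.1) (v z.2) ^ p) (b, c) :=
    ⟨_, fun _ _ => rfl⟩
  have hDm : Measurable (Function.uncurry D) := by
    have h1 : Measurable fun z : EuclideanSpace ℝ (Fin m) × EuclideanSpace ℝ (Fin m) =>
        edist (v z.1) (v z.2) ^ p :=
      ((hv.comp measurable_fst).edist (hv.comp measurable_snd)).pow_const p
    have h2 : Function.uncurry D = (B ×ˢ B).indicator fun z => edist (v z.1) (v z.2) ^ p :=
      funext fun z => hD z.1 z.2
    rw [h2]
    exact h1.indicator (measurableSet_ball.prod measurableSet_ball)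
  have hDin : ∀ b c, ‖b‖ < 12 → ‖c‖ < 12 → D b c = edist (v b) (v c) ^ p := fun b c hb hc =>
    (hD b c).trans (indicator_of_mem (by simp [hB, hb, hc]) _)
  have hD0 : ∀ z, D z z = 0 := fun z => by
    by_cases hz : (z, z) ∈ B ×ˢ B
    · simp only [hD, indicator_of_mem hz, edist_self, ENNReal.zero_rpow_of_pos hp0]
    · simp only [hD, indicator_of_notMem hz]
  have hDq : ∀ b c z, ‖b‖ < 12 → ‖c‖ < 12 → ‖z‖ < 12 → D b c ≤ q * (D b z + D z c) := by
    intro b c z hb hc hz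
    rw [hDin b c hb hc, hDin b z hb hz, hDin z c hz hc]
    exact (ENNReal.rpow_le_rpow (edist_triangle _ (v z) _) hp0.le).trans
      (ENNReal.rpow_add_le_mul_rpow_add_rpow _ _ hp)
  obtain ⟨G, hG⟩ : ∃ G : EuclideanSpace ℝ (Fin m) → ℝ≥0∞, ∀ k, G k = ∫⁻ b, D b (b + k) :=
    ⟨_, fun _ => rfl⟩
  have hGm : Measurable G := by
    have : Measurable fun z : EuclideanSpace ℝ (Fin m) × EuclideanSpace ℝ (Fin m) =>
        D z.2 (z.2 + z.1) :=
      hDm.comp (measurable_snd.prodMk (measurable_snd.add measurable_fst))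
    rw [show G = fun k => ∫⁻ b, D b (b + k) from funext hG]
    exact this.lintegral_prod_right'
  set I : EuclideanSpace ℝ (Fin m) → EuclideanSpace ℝ (Fin m) → EuclideanSpace ℝ (Fin m) → ℝ≥0∞ :=
    fun k x y => {z : EuclideanSpace ℝ (Fin m) × EuclideanSpace ℝ (Fin m) |
          ‖k‖ₑ < 2 * edist (φ z.1) (φ z.2)}.indicator (fun z => (edist (φ z.1) (φ z.2) ^ (m : ℝ))⁻¹ *
            (edist z.1 z.2 ^ r)⁻¹) (x, y) with hI
  have hIm : Measurable fun z : EuclideanSpace ℝ (Fin m) × EuclideanSpace ℝ (Fin m) ×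
      EuclideanSpace ℝ (Fin m) => G z.1 * I z.1 z.2.1 z.2.2 := by
    refine (hGm.comp measurable_fst).mul ?_
    have h1 : Measurable fun z : EuclideanSpace ℝ (Fin m) × EuclideanSpace ℝ (Fin m) ×
        EuclideanSpace ℝ (Fin m) => edist (φ z.2.1) (φ z.2.2) :=
      (hφm.comp measurable_snd.fst).edist (hφm.comp measurable_snd.snd)
    have h2 : Measurable fun z : EuclideanSpace ℝ (Fin m) × EuclideanSpace ℝ (Fin m) ×
        EuclideanSpace ℝ (Fin m) => (edist (φ z.2.1) (φ z.2.2) ^ (m : ℝ))⁻¹ *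
            (edist z.2.1 z.2.2 ^ r)⁻¹ :=
      ((h1.pow_const _).inv).mul ((measurable_snd.fst.edist measurable_snd.snd).pow_const _).inv
    exact h2.indicator (measurableSet_lt measurable_fst.enorm (h1.const_mul 2))
  have hIk : ∀ k, Measurable fun z : EuclideanSpace ℝ (Fin m) × EuclideanSpace ℝ (Fin m) =>
      I k z.1 z.2 := fun k => by
    have h1 : Measurable fun z : EuclideanSpace ℝ (Fin m) × EuclideanSpace ℝ (Fin m) =>
        edist (φ z.1) (φ z.2) := (hφm.comp measurable_fst).edist (hφm.comp measurable_snd)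
    have h2 : Measurable fun z : EuclideanSpace ℝ (Fin m) × EuclideanSpace ℝ (Fin m) =>
        (edist (φ z.1) (φ z.2) ^ (m : ℝ))⁻¹ * (edist z.1 z.2 ^ r)⁻¹ :=
      ((h1.pow_const _).inv).mul ((measurable_fst.edist measurable_snd).pow_const _).inv
    exact h2.indicator (measurableSet_lt measurable_const (h1.const_mul 2))
  -- The average over centres is replaced by a mean of `G` over increments of length below `2 |φ y -
  -- φ x|`. Dividing by the volume of the ball of radius `|φ y - φ x|` produces the weight in `I`,
  -- integrable in `(x, y)` for fixed `k`.
  have hT : ∀ x y, (∫⁻ a in ball 0 1, D (φ x + a) (φ y + a)) * (edist x y ^ r)⁻¹ ≤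
      2 * q * vol₁⁻¹ * ∫⁻ k, G k * I k x y := by
    intro x y
    by_cases hxy : φ x = φ y
    · simp [hxy, hD0]
    have hh : 0 < ‖φ y - φ x‖ := norm_pos_iff.2 (sub_ne_zero.2 (Ne.symm hxy))
    have h1 := setLIntegral_le_mul_lintegral_ball hDm hDq (hφ3 x) (hφ3 y)
    have he : edist (φ x) (φ y) = ENNReal.ofReal ‖φ y - φ x‖ := by
      rw [edist_comm, edist_dist, dist_eq_norm]
    simp only [← hG] at h1
    have hvol : volume (ball (0 : EuclideanSpace ℝ (Fin m)) ‖φ y - φ x‖) =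
        edist (φ x) (φ y) ^ (m : ℝ) * vol₁ := by
      rw [Measure.addHaar_ball_of_pos _ _ hh, finrank_euclideanSpace_fin, he,
        ENNReal.ofReal_pow hh.le, ENNReal.rpow_natCast]
    have hk : ∫⁻ k, G k * I k x y = (∫⁻ k in ball 0 (2 * ‖φ y - φ x‖), G k) *
        ((edist (φ x) (φ y) ^ (m : ℝ))⁻¹ * (edist x y ^ r)⁻¹) := by
      rw [← lintegral_indicator measurableSet_ball, ← lintegral_mul_const _
        (hGm.indicator measurableSet_ball)]
      refine lintegral_congr fun k => ?_
      have hiff : k ∈ ball (0 : EuclideanSpace ℝ (Fin m)) (2 * ‖φ y - φ x‖) ↔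
          ‖k‖ₑ < 2 * edist (φ x) (φ y) := by
        rw [he, mem_ball_zero_iff, ← ofReal_norm, ← ENNReal.ofReal_lt_ofReal_iff (by positivity),
          ENNReal.ofReal_mul (by norm_num)]
        simp
      by_cases hkb : k ∈ ball (0 : EuclideanSpace ℝ (Fin m)) (2 * ‖φ y - φ x‖)
      · rw [indicator_of_mem hkb]
        simp only [hI]
        rw [indicator_of_mem (by exact hiff.1 hkb)]
      · rw [indicator_of_notMem hkb]
        simp only [hI]
        rw [indicator_of_notMem (by exact fun h => hkb (hiff.2 h)), mul_zero, zero_mul]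
    rw [hvol] at h1
    have he0 : edist (φ x) (φ y) ^ (m : ℝ) ≠ 0 := by
      rw [he, ENNReal.ofReal_rpow_of_pos hh]
      simp only [ne_eq, ENNReal.ofReal_eq_zero, not_le]
      positivity
    have het : edist (φ x) (φ y) ^ (m : ℝ) ≠ ⊤ := by
      rw [he]
      exact ENNReal.rpow_ne_top_of_nonneg (by positivity) ENNReal.ofReal_ne_top
    have h2 : ∫⁻ a in ball 0 1, D (φ x + a) (φ y + a) ≤
        q * (2 * ∫⁻ k in ball 0 (2 * ‖φ y - φ x‖), G k) / (edist (φ x) (φ y) ^ (m : ℝ) * vol₁) :=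
      (ENNReal.le_div_iff_mul_le (Or.inl (mul_ne_zero he0 hvol₁0))
        (Or.inl (ENNReal.mul_ne_top het hvol₁t))).2 h1
    refine (mul_le_mul' h2 le_rfl).trans_eq ?_
    rw [hk, div_eq_mul_inv, ENNReal.mul_inv (Or.inl he0) (Or.inl het)]
    ring
  clear_value I
  obtain ⟨J, hJ⟩ : ∃ J : EuclideanSpace ℝ (Fin m) → ℝ≥0∞, ∀ a, J a =
      ∫⁻ x, ∫⁻ y, D (φ x + a) (φ y + a) * (edist x y ^ r)⁻¹ := ⟨_, fun _ => rfl⟩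
  have hDKm : Measurable fun z : EuclideanSpace ℝ (Fin m) × EuclideanSpace ℝ (Fin m) ×
      EuclideanSpace ℝ (Fin m) => D (φ z.2.1 + z.1) (φ z.2.2 + z.1) * (edist z.2.1 z.2.2 ^ r)⁻¹ :=
    (hDm.comp (((hφm.comp measurable_snd.fst).add measurable_fst).prodMk
      ((hφm.comp measurable_snd.snd).add measurable_fst))).mul
      ((measurable_snd.fst.edist measurable_snd.snd).pow_const _).inv
  clear_value φ
  have hJm : Measurable J := by
    have h1 : Measurable fun z : (EuclideanSpace ℝ (Fin m) × EuclideanSpace ℝ (Fin m)) ×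
        EuclideanSpace ℝ (Fin m) =>
          D (φ z.1.2 + z.1.1) (φ z.2 + z.1.1) * (edist z.1.2 z.2 ^ r)⁻¹ :=
      hDKm.comp MeasurableEquiv.prodAssoc.measurable
    have h2 : Measurable fun z : EuclideanSpace ℝ (Fin m) × EuclideanSpace ℝ (Fin m) =>
        ∫⁻ y, D (φ z.2 + z.1) (φ y + z.1) * (edist z.2 y ^ r)⁻¹ := h1.lintegral_prod_right'
    rw [show J = _ from funext hJ]
    exact h2.lintegral_prod_right'
  -- The substitution `c = b + k` writes the energy as an integral of `G` against the kernel in the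
  -- increment, which is what integrating `I` over `x` and `y` returns up to a constant.
  have hEv : gagliardoEnergy edist m s p (volume.restrict B) v =
      ∫⁻ k, G k * (‖k‖ₑ ^ r)⁻¹ := by
    have m1 : Measurable fun z : EuclideanSpace ℝ (Fin m) × EuclideanSpace ℝ (Fin m) =>
        D z.2 (z.2 + z.1) * (‖z.1‖ₑ ^ r)⁻¹ :=
      (hDm.comp (measurable_snd.prodMk (measurable_snd.add measurable_fst))).mul
        (measurable_fst.enorm.pow_const r).inv
    have m2 : ∀ k, Measurable fun b => D b (b + k) := fun k =>
      hDm.comp (measurable_id.prodMk (measurable_id.add measurable_const))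
    calc gagliardoEnergy edist m s p (volume.restrict B) v
        = ∫⁻ b, ∫⁻ c, D b c * (edist b c ^ r)⁻¹ := by
          rw [gagliardoEnergy, ← lintegral_indicator measurableSet_ball]
          refine lintegral_congr fun b => ?_
          by_cases hb : b ∈ B
          · rw [indicator_of_mem hb, ← lintegral_indicator measurableSet_ball]
            refine lintegral_congr fun c => ?_
            by_cases hc : c ∈ B
            · rw [indicator_of_mem hc, hDin b c (mem_ball_zero_iff.1 hb) (mem_ball_zero_iff.1 hc),
                div_eq_mul_inv]
            · rw [indicator_of_notMem hc]
              simp only [hD]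
              rw [indicator_of_notMem (by simp [hc]), zero_mul]
          · rw [indicator_of_notMem hb]
            have : ∀ c, D b c = 0 := fun c => (hD b c).trans (indicator_of_notMem (by simp [hb]) _)
            simp [this]
      _ = ∫⁻ b, ∫⁻ k, D b (b + k) * (‖k‖ₑ ^ r)⁻¹ := by
          refine lintegral_congr fun b => ?_
          rw [← lintegral_add_left_eq_self (fun c => D b c * (edist b c ^ r)⁻¹) b]
          refine lintegral_congr fun k => ?_
          rw [edist_comm, edist_eq_enorm_sub, add_sub_cancel_left]
      _ = ∫⁻ k, ∫⁻ b, D b (b + k) * (‖k‖ₑ ^ r)⁻¹ :=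
          (lintegral_lintegral_swap m1.aemeasurable).symm
      _ = _ := lintegral_congr fun k => by rw [lintegral_mul_const _ (m2 k), hG]
  have hmain : ∫⁻ a in ball 0 1, J a ≤
      2 * q * vol₁⁻¹ * C * gagliardoEnergy edist m s p (volume.restrict B) v := by
    calc ∫⁻ a in ball 0 1, J a
        = ∫⁻ x, ∫⁻ y, ∫⁻ a in ball 0 1, D (φ x + a) (φ y + a) * (edist x y ^ r)⁻¹ :=
          (lintegral_congr hJ).trans (lintegral_lintegral_lintegral_swap hDKm)
      _ = ∫⁻ x, ∫⁻ y, (∫⁻ a in ball 0 1, D (φ x + a) (φ y + a)) * (edist x y ^ r)⁻¹ := by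
          refine lintegral_congr fun x => lintegral_congr fun y => lintegral_mul_const _ ?_
          exact hDm.comp ((measurable_const_add _).prodMk (measurable_const_add _))
      _ ≤ ∫⁻ x, ∫⁻ y, 2 * q * vol₁⁻¹ * ∫⁻ k, G k * I k x y :=
          lintegral_mono fun x => lintegral_mono fun y => hT x y
      _ = 2 * q * vol₁⁻¹ * ∫⁻ x, ∫⁻ y, ∫⁻ k, G k * I k x y := by
          have hc : 2 * q * vol₁⁻¹ ≠ ⊤ := by finiteness
          rw [← lintegral_const_mul' _ _ hc]
          exact lintegral_congr fun x => lintegral_const_mul' _ _ hc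
      _ = 2 * q * vol₁⁻¹ * ∫⁻ k, ∫⁻ x, ∫⁻ y, G k * I k x y := by
          rw [← lintegral_lintegral_lintegral_swap hIm]
      _ ≤ 2 * q * vol₁⁻¹ * ∫⁻ k, C * (G k * (‖k‖ₑ ^ r)⁻¹) := by
          gcongr with k
          -- The kernel is infinite at the origin, but `G 0 = 0`.
          by_cases hk0 : k = 0
          · have : G k = 0 := by simp [hG, hk0, hD0]
            simp [this]
          calc ∫⁻ x, ∫⁻ y, G k * I k x y = G k * ∫⁻ x, ∫⁻ y, I k x y := by
                have h3 : Measurable fun x => ∫⁻ y, I k x y := (hIk k).lintegral_prod_right'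
                have h4 : ∀ x, Measurable fun y => I k x y := fun x => (hIk k).of_uncurry_left
                rw [← lintegral_const_mul _ h3]
                exact lintegral_congr fun x => lintegral_const_mul _ (h4 x)
            _ ≤ G k * (C * (‖k‖ₑ ^ r)⁻¹) := by
                gcongr
                rw [hI]
                exact hCk k hk0
            _ = _ := by ring
      _ = _ := by
          rw [lintegral_const_mul' _ _ hC, ← hEv]
          ring
  -- Some centre does no worse than the average.
  obtain ⟨a, ha, haJ⟩ := exists_le_setLAverage (μ := volume) hvol₁0 hvol₁t hJm.aemeasurable
  refine ⟨a, ha, ?_⟩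
  have ha1 : ‖a‖ < 1 := by simpa using ha
  have hE : gagliardoEnergy edist m s p volume (fun x => v (openingMap lam a x)) = J a := by
    have hn : ∀ x, ‖φ x + a‖ < 12 := fun x => by linarith [norm_add_le (φ x) a, hφ3 x]
    set H : EuclideanSpace ℝ (Fin m) → EuclideanSpace ℝ (Fin m) → ℝ≥0∞ := fun x y =>
      D (φ x + a) (φ y + a) * (edist x y ^ r)⁻¹ with hH
    have h1 : ∀ x y, edist (v (openingMap lam a x)) (v (openingMap lam a y)) ^ p /
        edist x y ^ ((m : ℝ) + s * p) = H (x - a) (y - a) := fun x y => by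
      simp only [hH]
      rw [hDin _ _ (hn _) (hn _), edist_sub_right, div_eq_mul_inv, hφ]
      rfl
    simp only [gagliardoEnergy, h1]
    have h2 : ∀ x, ∫⁻ y, H (x - a) (y - a) = ∫⁻ y, H (x - a) y := fun x =>
      lintegral_sub_right_eq_self (H (x - a)) a
    simp only [h2]
    rw [hJ]
    exact lintegral_sub_right_eq_self (fun x => ∫⁻ y, H x y) a
  rw [hE]
  refine haJ.trans ?_
  rw [setLAverage_eq, ← hvol₁]
  refine (ENNReal.div_le_div_right hmain _).trans_eq ?_
  simp only [div_eq_mul_inv]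
  ring

end OpeningEnergy

/-! ### Extension from the unit ball by inversion and opening. -/

section Extension

open EuclideanGeometry

variable {m : ℕ}

/-- The retraction onto the closed unit ball that maps its complement by inversion. -/
def fold (x : EuclideanSpace ℝ (Fin m)) : EuclideanSpace ℝ (Fin m) :=
  if ‖x‖ < 1 then x else inversion 0 1 x

lemma fold_of_lt {x : EuclideanSpace ℝ (Fin m)} (hx : ‖x‖ < 1) : fold x = x := if_pos hx

lemma fold_of_le {x : EuclideanSpace ℝ (Fin m)} (hx : 1 ≤ ‖x‖) : fold x = inversion 0 1 x :=
  if_neg hx.not_gt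

/-- With `t = |y|⁻²` the difference of the squares is `(1 - t) (|y|² + 1 - 2 ⟨x, y⟩)`, and the
second factor is nonnegative because `⟨x, y⟩ ≤ |y|`. -/
lemma norm_sub_inversion_le {x y : EuclideanSpace ℝ (Fin m)} (hx : ‖x‖ < 1) (hy : 1 ≤ ‖y‖) :
    ‖x - inversion 0 1 y‖ ≤ ‖x - y‖ := by
  refine abs_le_of_sq_le_sq' ?_ (norm_nonneg _) |>.2
  have h1 : inversion 0 1 y = (‖y‖ ^ 2)⁻¹ • y := by
    simp [inversion]
  have h2 : (‖y‖ ^ 2)⁻¹ * ‖y‖ ^ 2 = 1 := inv_mul_cancel₀ (by positivity)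
  have h3 : inner ℝ x y ≤ ‖x‖ * ‖y‖ := real_inner_le_norm x y
  rw [h1, norm_sub_sq_real, norm_sub_sq_real, inner_smul_right, norm_smul, mul_pow,
    Real.norm_of_nonneg (by positivity)]
  set t := (‖y‖ ^ 2)⁻¹
  have ht : t ≤ 1 := inv_le_one_of_one_le₀ (one_le_pow₀ hy)
  have h4 : 0 ≤ (1 - t) * (‖y‖ ^ 2 + 1 - 2 * inner ℝ x y) :=
    mul_nonneg (by linarith) (by nlinarith)
  nlinarith

/-- Outside the unit ball the inversion divides distances by `|x| |y| ≥ 1`. -/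
lemma dist_fold_le (x y : EuclideanSpace ℝ (Fin m)) : dist (fold x) (fold y) ≤ dist x y := by
  rcases lt_or_ge ‖x‖ 1 with hx | hx <;> rcases lt_or_ge ‖y‖ 1 with hy | hy
  · rw [fold_of_lt hx, fold_of_lt hy]
  · rw [fold_of_lt hx, fold_of_le hy, dist_eq_norm, dist_eq_norm]
    exact norm_sub_inversion_le hx hy
  · rw [fold_of_le hx, fold_of_lt hy, dist_comm, dist_comm x, dist_eq_norm, dist_eq_norm]
    exact norm_sub_inversion_le hy hx
  · have hx0 : x ≠ 0 := norm_pos_iff.1 (by linarith)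
    have hy0 : y ≠ 0 := norm_pos_iff.1 (by linarith)
    rw [fold_of_le hx, fold_of_le hy, dist_inversion_inversion hx0 hy0]
    refine mul_le_of_le_one_left dist_nonneg ?_
    rw [dist_zero_right, dist_zero_right, one_pow]
    exact div_le_one_of_le₀ (one_le_mul_of_one_le_of_one_le hx hy) (by positivity)

lemma continuous_fold : Continuous (fold (m := m)) :=
  (LipschitzWith.of_dist_le_mul (K := 1) fun x y => by
    simpa using dist_fold_le x y).continuous

/-- The inversion is an involution, so a preimage is an image; on `1 / 12 < |z| < 1` it is Lipschitz
with constant `12² = 144`. -/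
lemma volume_inversion_preimage_le (A : Set (EuclideanSpace ℝ (Fin m))) :
    volume {x | 1 < ‖x‖ ∧ ‖x‖ < 12 ∧ inversion 0 1 x ∈ A} ≤ 144 ^ m * volume (A ∩ ball 0 1) := by
  set S : Set (EuclideanSpace ℝ (Fin m)) := {z | z ∈ A ∧ 12⁻¹ < ‖z‖ ∧ ‖z‖ < 1} with hS
  have hsub : {x | 1 < ‖x‖ ∧ ‖x‖ < 12 ∧ inversion 0 1 x ∈ A} ⊆ inversion 0 1 '' S := by
    rintro x ⟨h1, h2, h3⟩
    refine ⟨inversion 0 1 x, ⟨h3, ?_⟩, inversion_inversion _ one_ne_zero _⟩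
    have h4 : ‖inversion 0 1 x‖ = ‖x‖⁻¹ := by
      rw [← dist_zero_right, dist_inversion_center, dist_zero_right, one_pow, one_div]
    rw [h4]
    exact ⟨inv_strictAnti₀ (by linarith) h2, inv_lt_one_of_one_lt₀ h1⟩
  have hlip : ∀ x ∈ S, ∀ y ∈ S,
      edist (inversion 0 1 x) (inversion 0 1 y) ≤ ((144 : ℝ≥0) : ℝ≥0∞) * edist x y := by
    rintro x ⟨-, hx, -⟩ y ⟨-, hy, -⟩
    have hx0 : x ≠ 0 := norm_pos_iff.1 (lt_trans (by norm_num) hx)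
    have hy0 : y ≠ 0 := norm_pos_iff.1 (lt_trans (by norm_num) hy)
    rw [edist_nndist, edist_nndist, ← ENNReal.coe_mul, ENNReal.coe_le_coe, ← NNReal.coe_le_coe,
      NNReal.coe_mul, coe_nndist, coe_nndist, dist_inversion_inversion hx0 hy0]
    refine mul_le_mul_of_nonneg_right ?_ dist_nonneg
    rw [dist_zero_right, dist_zero_right, one_pow, div_le_iff₀ (by positivity)]
    have h5 : (12⁻¹ : ℝ) * 12⁻¹ ≤ ‖x‖ * ‖y‖ := by gcongr
    push_cast
    linarith
  have := euclideanHausdorffMeasure_image_le m hlip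
  rw [EuclideanSpace.euclideanHausdorffMeasure_eq_volume] at this
  refine (measure_mono hsub).trans (this.trans ?_)
  refine mul_le_mul' (by simp) (measure_mono fun z hz => ⟨hz.1, by simpa using hz.2.2⟩)

/-- Inside the ball the fold is the identity, the unit sphere is null, and the rest is the volume
bound for the inversion. -/
lemma map_fold_le : (volume.restrict (ball (0 : EuclideanSpace ℝ (Fin m)) 12)).map fold ≤
    ((1 + 144 ^ m : ℝ≥0∞)) • volume.restrict (ball 0 1) := by
  refine Measure.le_iff.2 fun A hA => ?_
  rw [Measure.map_apply continuous_fold.measurable hA,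
    Measure.restrict_apply (continuous_fold.measurable hA), Measure.smul_apply, smul_eq_mul,
    Measure.restrict_apply hA, add_mul, one_mul]
  have hsub : fold ⁻¹' A ∩ ball 0 12 ⊆ (A ∩ ball 0 1 ∪
      {x | 1 < ‖x‖ ∧ ‖x‖ < 12 ∧ inversion 0 1 x ∈ A}) ∪ sphere 0 1 := by
    rintro x ⟨hx, hx12⟩
    rw [mem_ball_zero_iff] at hx12
    rcases lt_trichotomy ‖x‖ 1 with h | h | h
    · rw [mem_preimage, fold_of_lt h] at hx
      exact Or.inl (Or.inl ⟨hx, by simpa using h⟩)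
    · exact Or.inr (by simpa using h)
    · rw [mem_preimage, fold_of_le h.le] at hx
      exact Or.inl (Or.inr ⟨h, hx12, hx⟩)
  refine (measure_mono hsub).trans ((measure_union_le _ _).trans ?_)
  rw [Measure.addHaar_sphere_of_ne_zero _ _ one_ne_zero, add_zero]
  exact (measure_union_le _ _).trans (add_le_add le_rfl (volume_inversion_preimage_le A))

lemma edist_circle_mul_left (a z w : Circle) : edist (a * z) (a * w) = edist z w := by
  have h (z w : Circle) : edist z w = edist (z : ℂ) (w : ℂ) := rfl
  rw [h, h, Circle.coe_mul, Circle.coe_mul, edist_eq_enorm_sub, edist_eq_enorm_sub, ← mul_sub,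
    enorm_mul, ← ofReal_norm (a : ℂ), Circle.norm_coe, ENNReal.ofReal_one, one_mul]

/-- Every circle-valued map on the unit ball extends, up to a rotation of its values, to a map that
is constant outside a larger ball, with control on the energy. -/
theorem exists_extension {s p : ℝ} (hs : 0 < s) (hp : 1 ≤ p) :
    ∃ A : ℝ≥0∞, A ≠ ⊤ ∧ ∀ u : EuclideanSpace ℝ (Fin m) → Circle, Measurable u →
      ∃ (w : EuclideanSpace ℝ (Fin m) → Circle) (b : Circle), Measurable w ∧
        (∀ x ∈ ball 0 1, w x = b * u x) ∧ (∀ x ∉ ball 0 4, w x = 1) ∧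
        gagliardoEnergy edist m s p volume w ≤
          A * gagliardoEnergy edist m s p (volume.restrict (ball 0 1)) u := by
  -- For `|a| < 1`, the inner radius `2` makes the opening the identity on the unit ball, and the
  -- outer radius `3` makes it constant for `|x| ≥ 4`.
  obtain ⟨lam, hin, hout⟩ : ∃ lam : ContDiffBump (0 : EuclideanSpace ℝ (Fin m)),
      lam.rIn = 2 ∧ lam.rOut = 3 := ⟨⟨2, 3, by norm_num, by norm_num⟩, rfl, rfl⟩
  obtain ⟨A, hA, h⟩ := exists_gagliardoEnergy_openingMap_le hs hp lam hout
  refine ⟨A * ((1 + 144 ^ m) * (1 + 144 ^ m)), by finiteness, fun u hu => ?_⟩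
  have hv : Measurable (u ∘ fold) := hu.comp continuous_fold.measurable
  obtain ⟨a, ha, hE⟩ := h (u ∘ fold) hv
  rw [mem_ball_zero_iff] at ha
  refine ⟨fun x => (u (fold a))⁻¹ * u (fold (openingMap lam a x)), (u (fold a))⁻¹, ?_,
    fun x hx => ?_, fun x hx => ?_, ?_⟩
  · exact (continuous_const_mul _).measurable.comp
      (hv.comp (contDiff_openingMap lam a).continuous.measurable)
  · rw [mem_ball_zero_iff] at hx
    have h1 : openingMap lam a x = x := openingMap_eq_self _ (by
      rw [mem_closedBall_zero_iff, hin]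
      linarith [norm_sub_le x a])
    simp only [h1, fold_of_lt hx]
  · rw [mem_ball_zero_iff, not_lt] at hx
    have h1 : openingMap lam a x = a := openingMap_eq_center _ (by
      rw [hout]
      linarith [norm_sub_norm_le x a])
    simp only [h1, inv_mul_cancel]
  · rw [mul_assoc]
    refine le_trans (le_of_eq ?_) (hE.trans (mul_le_mul' le_rfl ?_))
    · exact gagliardoEnergy_congr_dist fun x y => edist_circle_mul_left _ _ _
    · refine (gagliardoEnergy_comp_le (L := 1) (by simp) hs.le (by linarith)
        continuous_fold.measurable.aemeasurable map_fold_le (ae_of_all _ fun x => ae_of_all _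
          fun y => ?_) hu.aemeasurable).trans_eq (by simp)
      rw [one_mul, edist_dist, edist_dist]
      exact ENNReal.ofReal_le_ofReal (dist_fold_le x y)

end Extension

/-! ### Superadditivity over disjoint sets. -/

section Superadditivity

variable {ι : Type*} [Countable ι]

/-- Interactions between different sets are nonnegative and can only add. This is the lower bound on
the cost of lifting many copies. -/
lemma tsum_gagliardoEnergy_restrict_le {X N : Type*} [EMetricSpace X] [MeasurableSpace X]
    {d : N → N → ℝ≥0∞} {m : ℕ} {s p : ℝ} {μ : Measure X} {S : ι → Set X} {Ω : Set X}
    (hS : ∀ i, MeasurableSet (S i)) (hd : Pairwise (Function.onFun Disjoint S))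
    (hΩ : ∀ i, S i ⊆ Ω) (u : X → N) :
    ∑' i, gagliardoEnergy d m s p (μ.restrict (S i)) u ≤
      gagliardoEnergy d m s p (μ.restrict Ω) u := by
  calc ∑' i, gagliardoEnergy d m s p (μ.restrict (S i)) u
      ≤ ∑' i, ∫⁻ x in S i, ∫⁻ y in Ω, d (u x) (u y) ^ p / edist x y ^ ((m : ℝ) + s * p) ∂μ ∂μ :=
        ENNReal.tsum_le_tsum fun i => lintegral_mono fun x =>
          lintegral_mono' (Measure.restrict_mono (hΩ i) le_rfl) le_rfl
    _ = ∫⁻ x in ⋃ i, S i, ∫⁻ y in Ω, d (u x) (u y) ^ p / edist x y ^ ((m : ℝ) + s * p) ∂μ ∂μ :=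
        (lintegral_iUnion hS hd _).symm
    _ ≤ _ := lintegral_mono' (Measure.restrict_mono (iUnion_subset hΩ) le_rfl) le_rfl

lemma tsum_dirichletEnergyOn_le {m : ℕ} {F : Type*} [NormedAddCommGroup F] [NormedSpace ℝ F]
    {q : ℝ} {S : ι → Set (EuclideanSpace ℝ (Fin m))} {Ω : Set (EuclideanSpace ℝ (Fin m))}
    (hS : ∀ i, MeasurableSet (S i)) (hd : Pairwise (Function.onFun Disjoint S))
    (hΩ : ∀ i, S i ⊆ Ω) (f : EuclideanSpace ℝ (Fin m) → F) :
    ∑' i, dirichletEnergyOn (S i) q f ≤ dirichletEnergyOn Ω q f := by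
  refine le_iInf₂ fun f' hf' => ?_
  calc ∑' i, dirichletEnergyOn (S i) q f ≤ ∑' i, ∫⁻ x in S i, ENNReal.ofReal ‖f' x‖ ^ q :=
        ENNReal.tsum_le_tsum fun i => iInf₂_le _ (hf'.mono (hΩ i))
    _ = ∫⁻ x in ⋃ i, S i, ENNReal.ofReal ‖f' x‖ ^ q := (lintegral_iUnion hS hd _).symm
    _ ≤ _ := lintegral_mono' (Measure.restrict_mono (iUnion_subset hΩ) le_rfl) le_rfl

end Superadditivity

/-! ### Gluing maps with disjoint supports. -/

section Gluing

variable {ι : Type*} [Countable ι]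

/-- Maps that are constant outside disjoint sets can be glued, and their energies are added, up to a
constant. -/
lemma exists_glue {X : Type*} [EMetricSpace X] [MeasurableSpace X] [OpensMeasurableSpace X]
    [SecondCountableTopology X] {m : ℕ} {s p : ℝ} (hp : 1 ≤ p) {μ : Measure X} [SFinite μ]
    {S : ι → Set X} (hS : ∀ i, MeasurableSet (S i)) (hd : Pairwise (Function.onFun Disjoint S))
    {w : ι → X → Circle} (hw : ∀ i, Measurable (w i)) (h1 : ∀ i, ∀ x ∉ S i, w i x = 1) :
    ∃ W : X → Circle, Measurable W ∧ (∀ i, ∀ x ∈ S i, W x = w i x) ∧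
      (∀ x, (∀ i, x ∉ S i) → W x = 1) ∧
      gagliardoEnergy edist m s p μ W ≤
        2 ^ (p - 1) * ∑' i, gagliardoEnergy edist m s p μ (w i) := by
  classical
  set W : X → Circle := fun x => if h : ∃ i, x ∈ S i then w h.choose x else 1 with hW
  have hWi : ∀ i, ∀ x ∈ S i, W x = w i x := fun i x hx => by
    have h : ∃ i, x ∈ S i := ⟨i, hx⟩
    have hi : h.choose = i := by
      by_contra hne
      exact disjoint_left.1 (hd hne) h.choose_spec hx
    simp only [hW, dif_pos h]
    rw [hi]
  have hW1 : ∀ x, (∀ i, x ∉ S i) → W x = 1 := fun x hx => dif_neg (not_exists.2 hx)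
  have hWm : Measurable W := by
    intro A hA
    have : W ⁻¹' A = (⋃ i, S i ∩ w i ⁻¹' A) ∪ ((⋃ i, S i)ᶜ ∩ {_x | (1 : Circle) ∈ A}) := by
      ext x
      by_cases h : ∃ i, x ∈ S i
      · obtain ⟨i, hi⟩ := h
        simp only [mem_preimage, hWi i x hi, mem_union, mem_iUnion, mem_inter_iff, mem_compl_iff]
        constructor
        · exact fun hx => Or.inl ⟨i, hi, hx⟩
        · rintro (⟨j, hj, hx⟩ | ⟨hx, -⟩)
          · rwa [← hWi i x hi, hWi j x hj]
          · exact absurd ⟨i, hi⟩ hx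
      · simp only [mem_preimage, hW1 x (not_exists.1 h), mem_union, mem_iUnion, mem_inter_iff,
          mem_compl_iff, h, not_false_eq_true, true_and]
        constructor
        · exact Or.inr
        · rintro (⟨i, hi, -⟩ | hx)
          · exact absurd ⟨i, hi⟩ h
          · exact hx
    rw [this]
    exact (MeasurableSet.iUnion fun i => (hS i).inter (hw i hA)).union
      ((MeasurableSet.iUnion hS).compl.inter (MeasurableSet.const _))
  have hp0 : 0 ≤ p := by linarith
  have hq : (1 : ℝ≥0∞) ≤ 2 ^ (p - 1) := by
    simpa using ENNReal.rpow_le_rpow (one_le_two : (1 : ℝ≥0∞) ≤ 2) (sub_nonneg.2 hp)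
  have key : ∀ x y, edist (W x) (W y) ^ p ≤ 2 ^ (p - 1) * ∑' i, edist (w i x) (w i y) ^ p := by
    intro x y
    have hone : ∀ i, W x = w i x → W y = w i y →
        edist (W x) (W y) ^ p ≤ 2 ^ (p - 1) * ∑' i, edist (w i x) (w i y) ^ p := by
      intro i hx hy
      rw [hx, hy]
      exact (ENNReal.le_tsum (f := fun i => edist (w i x) (w i y) ^ p) i).trans
        (le_mul_of_one_le_left zero_le hq)
    by_cases hx : ∃ i, x ∈ S i
    · obtain ⟨i, hi⟩ := hx
      by_cases hyi : y ∈ S i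
      · exact hone i (hWi i x hi) (hWi i y hyi)
      by_cases hy : ∃ j, y ∈ S j
      · obtain ⟨j, hj⟩ := hy
        have hij : i ≠ j := fun h => hyi (h ▸ hj)
        have hxj : x ∉ S j := disjoint_left.1 (hd hij) hi
        rw [hWi i x hi, hWi j y hj]
        -- The triangle inequality through the common value one: `w i y = 1 = w j x`. At most two
        -- maps enter for each pair of points, so the factor `2 ^ (p - 1)` does not depend on their
        -- number.
        have h2 : edist (w i x) (w j y) ≤ edist (w i x) (w i y) + edist (w j x) (w j y) := by
          rw [h1 i y hyi, h1 j x hxj]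
          exact edist_triangle _ _ _
        refine ((ENNReal.rpow_le_rpow h2 hp0).trans
          (ENNReal.rpow_add_le_mul_rpow_add_rpow _ _ hp)).trans (mul_le_mul' le_rfl ?_)
        have := ENNReal.sum_le_tsum (f := fun i => edist (w i x) (w i y) ^ p) {i, j}
        rwa [Finset.sum_pair hij] at this
      · exact hone i (hWi i x hi) (by rw [hW1 y (not_exists.1 hy), h1 i y hyi])
    · by_cases hy : ∃ j, y ∈ S j
      · obtain ⟨j, hj⟩ := hy
        exact hone j (by rw [hW1 x (not_exists.1 hx), h1 j x (not_exists.1 hx j)]) (hWi j y hj)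
      · rw [hW1 x (not_exists.1 hx), hW1 y (not_exists.1 hy), edist_self,
          ENNReal.zero_rpow_of_pos (by linarith)]
        exact zero_le
  refine ⟨W, hWm, hWi, hW1, ?_⟩
  have hqt : (2 : ℝ≥0∞) ^ (p - 1) ≠ ⊤ :=
    ENNReal.rpow_ne_top_of_nonneg (by linarith) (by norm_num)
  have hm : ∀ i, Measurable fun z : X × X =>
      edist (w i z.1) (w i z.2) ^ p / edist z.1 z.2 ^ ((m : ℝ) + s * p) := fun i =>
    measurable_gagliardo_integrand m (hw i)
  have hsum : ∑' i, gagliardoEnergy edist m s p μ (w i) =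
      ∫⁻ x, ∫⁻ y, ∑' i, edist (w i x) (w i y) ^ p / edist x y ^ ((m : ℝ) + s * p) ∂μ ∂μ := by
    simp only [gagliardoEnergy]
    have h2 : ∀ i, Measurable fun x =>
        ∫⁻ y, edist (w i x) (w i y) ^ p / edist x y ^ ((m : ℝ) + s * p) ∂μ := fun i =>
      (hm i).lintegral_prod_right'
    have h3 : ∀ i x, Measurable fun y =>
        edist (w i x) (w i y) ^ p / edist x y ^ ((m : ℝ) + s * p) := fun i x =>
      (measurable_gagliardo_integrand m (hw i)).of_uncurry_left
    rw [← lintegral_tsum fun i => (h2 i).aemeasurable]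
    exact lintegral_congr fun x => (lintegral_tsum fun i => (h3 i x).aemeasurable).symm
  rw [hsum, gagliardoEnergy, ← lintegral_const_mul' _ _ hqt]
  refine lintegral_mono fun x => ?_
  rw [← lintegral_const_mul' _ _ hqt]
  refine lintegral_mono fun y => ?_
  simp only [div_eq_mul_inv]
  rw [ENNReal.tsum_mul_right, ← mul_assoc]
  exact mul_le_mul' (key x y) le_rfl

end Gluing

/-! ### Simultaneous lifting of rescaled copies. -/

section Packing

variable {m : ℕ}

lemma dilation_inv_dilation (c : EuclideanSpace ℝ (Fin m)) {r : ℝ} (hr : 0 < r)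
    (x : EuclideanSpace ℝ (Fin m)) : dilation (-(r⁻¹ • c)) r⁻¹ (dilation c r x) = x := by
  simp [dilation, smul_add, smul_smul, inv_mul_cancel₀ hr.ne']

lemma ofReal_rpow_mul_rpow_sub {r : ℝ} (hr : 0 < r) (a b : ℝ) :
    ENNReal.ofReal r ^ (a - b) * ENNReal.ofReal r ^ (b - a) = 1 := by
  rw [← ENNReal.rpow_add _ _ (by simpa using hr) ENNReal.ofReal_ne_top]
  simp

/-- The lifting property for a map obtained by gluing rescaled copies of maps on the unit ball
provides liftings of all these maps with summable energies. -/
lemma LipschitzChart.exists_lifting_of_packing {M : Type*} [EMetricSpace M]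
    [ChartedSpace (EuclideanSpace ℝ (Fin m)) M] [IsManifold (𝓡 m) ∞ M]
    [RiemannianBundle (fun x : M => TangentSpace (𝓡 m) x)]
    [IsContMDiffRiemannianBundle (𝓡 m) ∞ (EuclideanSpace ℝ (Fin m))
      (fun x : M => TangentSpace (𝓡 m) x)]
    [IsRiemannianManifold (𝓡 m) M] [MeasurableSpace M] [BorelSpace M] (Γ : LipschitzChart m M)
    (hM : CompactSpace M ∨
      ∃ Φ : M ≃ₘ⟮𝓡 m, 𝓡 m⟯ EuclideanSpace ℝ (Fin m), Isometry Φ)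
    {s p : ℝ} (hs₀ : 0 < s) (hs₁ : s < 1) (hp : 1 ≤ p)
    (hlift : ∀ u : M → Circle, MemCircleSobolev m s p u →
      ∃ φ₁ φ₂ : M → ℝ, MemRealSobolev m s p φ₁ ∧ MemRealSobolev m 1 (s * p) φ₂ ∧
        ∀ᵐ x ∂(μHE[m] : Measure M), u x = Circle.exp (φ₁ x + φ₂ x))
    {ι : Type*} [Countable ι] {c : ι → EuclideanSpace ℝ (Fin m)} {r : ι → ℝ} (hr : ∀ i, 0 < r i)
    (hd : Pairwise (Function.onFun Disjoint fun i => ball (c i) (r i * 4)))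
    (hsub : ∀ i, ball (c i) (r i * 4) ⊆ ball Γ.center (Γ.ρ / 2))
    {u : ι → EuclideanSpace ℝ (Fin m) → Circle} (hu : ∀ i, Measurable (u i))
    (hsum : ∑' i, ENNReal.ofReal (r i) ^ (m - s * p) *
      gagliardoEnergy edist m s p (volume.restrict (ball 0 1)) (u i) < ⊤) :
    ∃ φ₁ φ₂ : ι → EuclideanSpace ℝ (Fin m) → ℝ,
      (∀ i, MemRealSobolevOn (ball 0 1) s p (φ₁ i) ∧
        MemRealSobolevOn (ball 0 1) 1 (s * p) (φ₂ i) ∧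
        ∀ᵐ x ∂volume.restrict (ball 0 1), u i x = Circle.exp (φ₁ i x + φ₂ i x)) ∧
      ∑' i, ENNReal.ofReal (r i) ^ (m - s * p) * (realEnergyOn (ball 0 1) s p (φ₁ i) +
        realEnergyOn (ball 0 1) 1 (s * p) (φ₂ i)) < ⊤ := by
  have hp0 : 0 < p := by linarith
  have hσ : 0 < s * p := mul_pos hs₀ hp0
  obtain ⟨A, hA, hext⟩ := exists_extension (m := m) hs₀ hp
  choose w b hw hwu hw1 hwE using fun i => hext (u i) (hu i)
  -- The extension of `u i`, which equals one off the ball of radius `4`, shrunk into the ball of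
  -- radius `4 r i` about `c i`.
  set v : ι → EuclideanSpace ℝ (Fin m) → Circle := fun i =>
    w i ∘ dilation (-((r i)⁻¹ • c i)) (r i)⁻¹ with hv
  have hvm : ∀ i, Measurable (v i) := fun i => (hw i).comp (measurable_dilation _)
  have hv1 : ∀ i, ∀ x ∉ ball (c i) (r i * 4), v i x = 1 := fun i x hx => by
    refine hw1 i _ fun h => hx ?_
    have h1 : dilation (-((r i)⁻¹ • c i)) (r i)⁻¹ x = (r i)⁻¹ • (x - c i) := by
      rw [dilation, smul_sub]; abel
    rw [h1, mem_ball_zero_iff, norm_smul, norm_inv, Real.norm_of_nonneg (hr i).le,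
      inv_mul_lt_iff₀ (hr i)] at h
    rwa [mem_ball_iff_norm]
  have hvE : ∀ i, gagliardoEnergy edist m s p volume (v i) ≤ A * (ENNReal.ofReal (r i) ^
      (m - s * p) * gagliardoEnergy edist m s p (volume.restrict (ball 0 1)) (u i)) := fun i => by
    have h1 := gagliardoEnergy_comp_dilation_le (-((r i)⁻¹ • c i)) (inv_pos.2 (hr i))
      MeasurableSet.univ hs₀.le hp0 (s := s) (u := w i) (hw i).aemeasurable
    rw [preimage_univ, Measure.restrict_univ, ENNReal.ofReal_inv_of_pos (hr i), ENNReal.inv_rpow,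
      ← ENNReal.rpow_neg, neg_sub] at h1
    refine h1.trans ((mul_le_mul' le_rfl (hwE i)).trans_eq ?_)
    ring
  obtain ⟨W, hWm, hWv, hW1, hWE⟩ := exists_glue (m := m) (s := s) hp (μ := volume)
    (fun i => measurableSet_ball) hd hvm hv1
  have hWfin : gagliardoEnergy edist m s p volume W < ⊤ := by
    refine hWE.trans_lt (ENNReal.mul_lt_top (ENNReal.rpow_lt_top_of_nonneg (by linarith)
      (by norm_num)) ((ENNReal.tsum_le_tsum hvE).trans_lt ?_))
    rw [ENNReal.tsum_mul_left]
    exact ENNReal.mul_lt_top hA.lt_top hsum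
  obtain ⟨φ₁, φ₂, hφ₁, hφ₂, hφ⟩ := Γ.hasSobolevLifting_of_lt_one hM hs₀ hs₁ hp0 hlift hWm
    (fun y hy => hW1 y fun i hi => hy (hsub i hi)) hWfin
  have hS4 : ∀ i, ball (c i) (r i * 1) ⊆ ball (c i) (r i * 4) := fun i =>
    ball_subset_ball (by nlinarith [hr i])
  have hSB : ∀ i, ball (c i) (r i * 1) ⊆ Γ.B := fun i =>
    (hS4 i).trans ((hsub i).trans (ball_subset_ball (by linarith [Γ.ρ_pos])))
  have hdS : Pairwise (Function.onFun Disjoint fun i => ball (c i) (r i * 1)) := fun i j hij =>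
    (hd hij).mono (hS4 i) (hS4 j)
  have hmap : ∀ i, (volume.restrict (ball (0 : EuclideanSpace ℝ (Fin m)) 1)).map
      (dilation (c i) (r i)) = (ENNReal.ofReal (r i) ^ m)⁻¹ •
        volume.restrict (ball (c i) (r i * 1)) := fun i => by
    rw [← preimage_dilation_ball (c i) (hr i) 1, map_restrict_dilation (c i) (hr i)
      measurableSet_ball]
  have hm₁ : ∀ i, AEMeasurable φ₁ (volume.restrict (ball (c i) (r i * 1))) := fun i =>
    hφ₁.1.mono_measure (Measure.restrict_mono (hSB i) le_rfl)
  have hm₂ : ∀ i, AEMeasurable φ₂ (volume.restrict (ball (c i) (r i * 1))) := fun i =>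
    hφ₂.1.mono_measure (Measure.restrict_mono (hSB i) le_rfl)
  have hcomp : ∀ (φ : EuclideanSpace ℝ (Fin m) → ℝ) i,
      AEMeasurable φ (volume.restrict (ball (c i) (r i * 1))) →
        AEMeasurable (φ ∘ dilation (c i) (r i)) (volume.restrict (ball 0 1)) := fun φ i h => by
    refine AEMeasurable.comp_measurable ?_ (measurable_dilation _)
    rw [hmap i]
    exact h.smul_measure _
  simp only [MemRealSobolevOn, realEnergyOn, if_neg hs₁.ne, if_true] at hφ₁ hφ₂ ⊢
  -- The constant `arg (b i)` removes the rotation made by the extension and leaves the energy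
  -- unchanged.
  have e₁ : ∀ i, gagliardoEnergy edist m s p (volume.restrict (ball 0 1))
      (fun x => φ₁ (dilation (c i) (r i) x) - Complex.arg (b i)) ≤
        ENNReal.ofReal (r i) ^ (s * p - m) *
          gagliardoEnergy edist m s p (volume.restrict (ball (c i) (r i * 1))) φ₁ := fun i => by
    refine (gagliardoEnergy_congr_dist (d' := edist) (v := φ₁ ∘ dilation (c i) (r i)) fun x y =>
      edist_sub_right _ _ _).trans_le ?_
    rw [← preimage_dilation_ball (c i) (hr i) 1]
    exact gagliardoEnergy_comp_dilation_le (c i) (hr i) measurableSet_ball hs₀.le hp0 (hm₁ i)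
  have e₂ : ∀ i, dirichletEnergyOn (ball 0 1) (s * p) (φ₂ ∘ dilation (c i) (r i)) ≤
      ENNReal.ofReal (r i) ^ (s * p - m) *
        dirichletEnergyOn (ball (c i) (r i * 1)) (s * p) φ₂ := fun i => by
    rw [← preimage_dilation_ball (c i) (hr i) 1]
    exact dirichletEnergyOn_comp_dilation_le (c i) (hr i) isOpen_ball hσ.le φ₂
  have hsum₁ := tsum_gagliardoEnergy_restrict_le (d := edist) (m := m) (s := s) (p := p)
    (μ := volume) (fun i => measurableSet_ball) hdS hSB φ₁
  have hsum₂ := tsum_dirichletEnergyOn_le (q := s * p) (fun i => measurableSet_ball) hdS hSB φ₂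
  have hrt : ∀ i, ENNReal.ofReal (r i) ^ (s * p - m) < ⊤ := fun i =>
    (ENNReal.rpow_ne_top_of_ne_zero (by simpa using hr i) ENNReal.ofReal_ne_top).lt_top
  refine ⟨fun i x => φ₁ (dilation (c i) (r i) x) - Complex.arg (b i),
    fun i => φ₂ ∘ dilation (c i) (r i), fun i => ⟨⟨(hcomp φ₁ i (hm₁ i)).sub_const _, ?_⟩,
      ⟨hcomp φ₂ i (hm₂ i), ?_⟩, ?_⟩, ?_⟩
  · exact (e₁ i).trans_lt (ENNReal.mul_lt_top (hrt i)
      ((ENNReal.le_tsum i).trans_lt (hsum₁.trans_lt hφ₁.2)))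
  · exact (e₂ i).trans_lt (ENNReal.mul_lt_top (hrt i)
      ((ENNReal.le_tsum i).trans_lt (hsum₂.trans_lt hφ₂.2)))
  · have h1 : ∀ᵐ y ∂(volume.restrict (ball (0 : EuclideanSpace ℝ (Fin m)) 1)).map
        (dilation (c i) (r i)), W y = Circle.exp (φ₁ y + φ₂ y) := by
      rw [hmap i]
      exact Measure.ae_smul_measure (ae_restrict_of_ae_restrict_of_subset (hSB i) hφ) _
    filter_upwards [ae_of_ae_map (measurable_dilation _).aemeasurable h1,
      ae_restrict_mem measurableSet_ball] with x hx hx1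
    have h2 : dilation (c i) (r i) x ∈ ball (c i) (r i * 1) := by
      rw [← preimage_dilation_ball (c i) (hr i) 1] at hx1
      exact hx1
    rw [hWv i _ (hS4 i h2)] at hx
    simp only [hv, Function.comp_apply, dilation_inv_dilation (c i) (hr i), hwu i x hx1] at hx
    simp only [Function.comp_apply]
    rw [sub_add_eq_add_sub, Circle.exp_sub, ← hx, Circle.exp_arg, mul_div_cancel_left]
  -- The weight `r ^ (m - s p)` cancels the scaling `r ^ (s p - m)` exactly, so the weighted sum is
  -- bounded by the energies of `φ₁` and `φ₂` on disjoint balls.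
  · refine (ENNReal.tsum_le_tsum fun i => ?_).trans_lt (b :=
      ∑' i, (gagliardoEnergy edist m s p (volume.restrict (ball (c i) (r i * 1))) φ₁ +
        dirichletEnergyOn (ball (c i) (r i * 1)) (s * p) φ₂)) ?_
    · refine (mul_le_mul' le_rfl (add_le_add (e₁ i) (e₂ i))).trans_eq ?_
      rw [← mul_add, ← mul_assoc, ofReal_rpow_mul_rpow_sub (hr i), one_mul]
    · rw [ENNReal.tsum_add]
      exact ENNReal.add_lt_top.2 ⟨hsum₁.trans_lt hφ₁.2, hsum₂.trans_lt hφ₂.2⟩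

end Packing

/-! ### Placing the copies. -/

section Grid

variable {m : ℕ}

lemma EuclideanSpace.norm_le_mul_of_forall_abs_le {x : EuclideanSpace ℝ (Fin m)} {B : ℝ}
    (hB : 0 ≤ B) (h : ∀ i, |x i| ≤ B) : ‖x‖ ≤ m * B := by
  refine abs_le_of_sq_le_sq' ?_ (by positivity) |>.2
  rw [EuclideanSpace.real_norm_sq_eq]
  calc ∑ i, x i ^ 2 ≤ ∑ _i : Fin m, B ^ 2 :=
        Finset.sum_le_sum fun i _ => sq_le_sq.2 ((h i).trans (le_abs_self _))
    _ = m * B ^ 2 := by simp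
    _ ≤ (m * B) ^ 2 := by
        rw [mul_pow]
        refine mul_le_mul_of_nonneg_right ?_ (sq_nonneg B)
        rcases Nat.eq_zero_or_pos m with h0 | h0
        · simp [h0]
        · exact le_self_pow₀ (by exact_mod_cast h0) two_ne_zero

/-- Disjoint balls whose centers form cubic grids accumulating at a point. -/
lemma exists_disjoint_balls (hm : 1 ≤ m) (z₀ : EuclideanSpace ℝ (Fin m)) {R : ℝ}
    {N : ℕ → ℕ} (hN : ∀ n, 1 ≤ N n) {a : ℕ → ℝ} (ha : ∀ n, 0 < a n)
    (haR : ∀ n, a n ≤ R * 2⁻¹ ^ n / (96 * m)) :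
    ∃ c : (Σ n, Fin m → Fin (N n)) → EuclideanSpace ℝ (Fin m),
      (Pairwise (Function.onFun Disjoint fun i => ball (c i) (a i.1 / N i.1 * 4))) ∧
      ∀ i, ball (c i) (a i.1 / N i.1 * 4) ⊆ ball z₀ R := by
  have hm' : (1 : ℝ) ≤ m := by exact_mod_cast hm
  have hN' : ∀ n, (1 : ℝ) ≤ N n := fun n => by exact_mod_cast hN n
  obtain ⟨r, hr⟩ : ∃ r : ℕ → ℝ, ∀ n, r n = a n / N n := ⟨_, fun _ => rfl⟩
  have hr0 : ∀ n, 0 < r n := fun n => by rw [hr]; exact div_pos (ha n) (by linarith [hN' n])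
  have hrN : ∀ n, r n * N n = a n := fun n => by
    rw [hr, div_mul_cancel₀]; linarith [hN' n]
  set e : EuclideanSpace ℝ (Fin m) := EuclideanSpace.single ⟨0, hm⟩ 1 with he
  have he1 : ‖e‖ = 1 := by simp [he]
  -- Generation `n` occupies the ball of radius `δ n / 4` about `z₀ + δ n • e`. These balls are
  -- disjoint because `δ` at least halves from one generation to any later one.
  set δ : ℕ → ℝ := fun n => R * 2⁻¹ ^ n / 2 with hδ
  have haδ : ∀ n, 12 * m * a n ≤ δ n / 4 := fun n => by
    have := haR n
    rw [le_div_iff₀ (by positivity)] at this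
    simp only [hδ]
    linarith
  have hδ0 : ∀ n, 0 < δ n := fun n => by
    have := haδ n
    have h1 : 0 < 12 * m * a n := mul_pos (by linarith) (ha n)
    linarith
  have hδ2 : ∀ n k, n < k → δ k ≤ δ n / 2 := fun n k hnk => by
    have hR : 0 < R := by
      have := hδ0 0
      simp only [hδ, pow_zero] at this
      linarith
    have h1 : (2⁻¹ : ℝ) ^ k ≤ 2⁻¹ ^ (n + 1) :=
      pow_le_pow_of_le_one (by norm_num) (by norm_num) hnk
    rw [pow_succ] at h1
    simp only [hδ]
    nlinarith
  -- Spacing `8 r` separates balls of radius `4 r`.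
  set g : (Σ n, Fin m → Fin (N n)) → EuclideanSpace ℝ (Fin m) := fun i =>
    WithLp.toLp 2 fun j => 8 * r i.1 * (i.2 j : ℕ) with hg
  have hgi : ∀ i j, g i j = 8 * r i.1 * (i.2 j : ℕ) := fun i j => rfl
  have hgn : ∀ i, ‖g i‖ ≤ m * (8 * a i.1) := fun i => by
    refine EuclideanSpace.norm_le_mul_of_forall_abs_le (by linarith [ha i.1]) fun j => ?_
    have h1 : ((i.2 j : ℕ) : ℝ) ≤ N i.1 := by exact_mod_cast (i.2 j).2.le
    rw [hgi, abs_of_nonneg (mul_nonneg (by linarith [hr0 i.1]) (by positivity)), ← hrN]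
    nlinarith [hr0 i.1]
  set c : (Σ n, Fin m → Fin (N n)) → EuclideanSpace ℝ (Fin m) := fun i =>
    z₀ + δ i.1 • e + g i with hc
  -- The grid has extent at most `8 m a` and the balls radius at most `4 a`, together `12 m a ≤ δ n
  -- / 4`; hence the constant `96 m` in the hypothesis.
  have hcball : ∀ i, ball (c i) (r i.1 * 4) ⊆ ball (z₀ + δ i.1 • e) (δ i.1 / 4) := fun i => by
    refine ball_subset_ball' ?_
    have h1 : dist (c i) (z₀ + δ i.1 • e) = ‖g i‖ := by
      rw [dist_eq_norm]; simp only [hc, add_sub_cancel_left]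
    have h2 : r i.1 ≤ a i.1 := by rw [← hrN]; nlinarith [hr0 i.1, hN' i.1]
    have h3 : a i.1 ≤ m * a i.1 := by nlinarith [ha i.1]
    rw [h1]
    linarith [hgn i, haδ i.1]
  have hdn : ∀ n k, n < k → Disjoint (ball (z₀ + δ n • e) (δ n / 4))
      (ball (z₀ + δ k • e) (δ k / 4)) := fun n k hnk => by
    refine ball_disjoint_ball ?_
    have h1 : dist (z₀ + δ n • e) (z₀ + δ k • e) = |δ n - δ k| := by
      rw [dist_add_left, dist_eq_norm, ← sub_smul, norm_smul, he1, mul_one, Real.norm_eq_abs]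
    rw [h1]
    refine le_trans ?_ (le_abs_self _)
    linarith [hδ2 n k hnk, hδ0 n]
  simp only [← hr]
  refine ⟨c, fun i j hij => ?_, fun i => (hcball i).trans (ball_subset_ball' ?_)⟩
  · obtain ⟨n, k⟩ := i
    obtain ⟨n', k'⟩ := j
    rcases lt_trichotomy n n' with h | h | h
    · exact (hdn n n' h).mono (hcball ⟨n, k⟩) (hcball ⟨n', k'⟩)
    · subst h
      have hk : k ≠ k' := fun h => hij (by rw [h])
      obtain ⟨j, hj⟩ := Function.ne_iff.1 hk
      refine ball_disjoint_ball ?_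
      have h1 : dist (c ⟨n, k⟩) (c ⟨n, k'⟩) = ‖g ⟨n, k⟩ - g ⟨n, k'⟩‖ := by
        simp only [hc, dist_eq_norm, add_sub_add_left_eq_sub]
      have h2 := PiLp.norm_apply_le (g ⟨n, k⟩ - g ⟨n, k'⟩) j
      have h3 : (g ⟨n, k⟩ - g ⟨n, k'⟩) j = 8 * r n * (((k j : ℕ) : ℤ) - ((k' j : ℕ) : ℤ) : ℤ) := by
        rw [PiLp.sub_apply, hgi, hgi]
        push_cast
        ring
      have h4 : (1 : ℝ) ≤ |((((k j : ℕ) : ℤ) - ((k' j : ℕ) : ℤ) : ℤ) : ℝ)| := by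
        rw [← Int.cast_abs]
        have : (0 : ℤ) < |((k j : ℕ) : ℤ) - ((k' j : ℕ) : ℤ)| := by
          rw [abs_pos, sub_ne_zero]
          exact fun h => hj (Fin.ext (by exact_mod_cast h))
        exact_mod_cast this
      rw [h3, Real.norm_eq_abs, abs_mul, abs_of_pos (by linarith [hr0 n])] at h2
      rw [h1]
      refine le_trans ?_ h2
      show r n * 4 + r n * 4 ≤ _
      nlinarith [hr0 n]
    · exact ((hdn n' n h).mono (hcball ⟨n', k'⟩) (hcball ⟨n, k⟩)).symm
  · rw [dist_self_add_left, norm_smul, he1, mul_one, Real.norm_of_nonneg (hδ0 _).le]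
    have h1 : (2⁻¹ : ℝ) ^ i.1 ≤ 1 := pow_le_one₀ (by norm_num) (by norm_num)
    have h2 : 0 < R := by
      have := hδ0 0
      simp only [hδ, pow_zero] at this
      linarith
    simp only [hδ]
    nlinarith

end Grid

/-! ### Choosing the number of copies. -/

section Multiplicity

/-- The exact real solution `x = (b / t) ^ (1 / σ)` is at least one, so rounding it up at most
doubles it. -/
lemma exists_nat_rpow_mul_mem_Icc {σ t b : ℝ} (hσ : 0 < σ) (ht : 0 < t) (htb : t ≤ b) :
    ∃ N : ℕ, 1 ≤ N ∧ (N : ℝ) ^ σ * t ∈ Icc b (2 ^ σ * b) := by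
  have hb : 0 < b := ht.trans_le htb
  set x := (b / t) ^ σ⁻¹ with hx
  have hx1 : 1 ≤ x := Real.one_le_rpow ((one_le_div ht).2 htb) (by positivity)
  have hxσ : x ^ σ * t = b := by
    rw [hx, Real.rpow_inv_rpow (by positivity) hσ.ne', div_mul_cancel₀ _ ht.ne']
  have h1 : x ≤ ⌈x⌉₊ := Nat.le_ceil x
  have h2 : (⌈x⌉₊ : ℝ) ≤ 2 * x := by linarith [Nat.ceil_lt_add_one (show 0 ≤ x by linarith)]
  refine ⟨⌈x⌉₊, Nat.one_le_ceil_iff.2 (by linarith), ?_, ?_⟩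
  · rw [← hxσ]
    gcongr
  · rw [← hxσ, ← mul_assoc, ← Real.mul_rpow (by norm_num) (by linarith)]
    gcongr

/-- There are `N ^ m` copies at scale `a / N`, and `N ^ m (a / N) ^ (m - σ) = N ^ σ a ^ (m - σ)`:
subdivision raises the total energy by the factor `N ^ σ`. -/
lemma tsum_sigma_grid {m : ℕ} {σ : ℝ} {N : ℕ → ℕ} (hN : ∀ n, 1 ≤ N n) {a : ℕ → ℝ}
    (ha : ∀ n, 0 < a n) {e : ℕ → ℝ≥0∞} (he : ∀ n, e n ≠ ⊤) (K : ℕ → ℝ≥0∞) :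
    ∑' i : Σ n, Fin m → Fin (N n), ENNReal.ofReal (a i.1 / N i.1) ^ (m - σ) * (K i.1 * e i.1) =
      ∑' n, K n * ENNReal.ofReal ((N n : ℝ) ^ σ * (a n ^ (m - σ) * (e n).toReal)) := by
  rw [ENNReal.tsum_sigma']
  refine tsum_congr fun n => ?_
  have hN0 : (0 : ℝ) < N n := by exact_mod_cast hN n
  have h1 : 0 < a n / N n := div_pos (ha n) hN0
  simp only [tsum_fintype]
  rw [Finset.sum_const, Finset.card_univ, Fintype.card_pi, Finset.prod_const,
    Fintype.card_fin, Finset.card_univ, Fintype.card_fin, nsmul_eq_mul]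
  have h2 : ((N n ^ m : ℕ) : ℝ≥0∞) = ENNReal.ofReal ((N n : ℝ) ^ (m : ℝ)) := by
    rw [Real.rpow_natCast, ENNReal.ofReal_pow hN0.le, ENNReal.ofReal_natCast, Nat.cast_pow]
  rw [ENNReal.ofReal_rpow_of_pos h1, h2]
  nth_rw 1 [← ENNReal.ofReal_toReal (he n)]
  have h3 : (N n : ℝ) ^ (m : ℝ) * (a n / N n) ^ (m - σ) = (N n : ℝ) ^ σ * a n ^ (m - σ) := by
    rw [Real.div_rpow (ha n).le hN0.le, Real.rpow_sub hN0]
    have := Real.rpow_pos_of_pos hN0 σ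
    have := Real.rpow_pos_of_pos hN0 m
    field_simp
  calc ENNReal.ofReal ((N n : ℝ) ^ (m : ℝ)) * (ENNReal.ofReal ((a n / N n) ^ (m - σ)) *
        (K n * ENNReal.ofReal (e n).toReal))
      = K n * (ENNReal.ofReal ((N n : ℝ) ^ (m : ℝ)) * ENNReal.ofReal ((a n / N n) ^ (m - σ)) *
        ENNReal.ofReal (e n).toReal) := by ring
    _ = _ := by
        rw [← ENNReal.ofReal_mul (by positivity), h3, ← ENNReal.ofReal_mul (mul_nonneg
          (by positivity) (Real.rpow_nonneg (ha n).le _)), mul_assoc]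

end Multiplicity

/-! ### The contradiction argument and the case `s < 1`. -/

section Quantitative

variable {m : ℕ} {M : Type*} [EMetricSpace M]
    [ChartedSpace (EuclideanSpace ℝ (Fin m)) M] [IsManifold (𝓡 m) ∞ M]
    [RiemannianBundle (fun x : M => TangentSpace (𝓡 m) x)]
    [IsContMDiffRiemannianBundle (𝓡 m) ∞ (EuclideanSpace ℝ (Fin m))
      (fun x : M => TangentSpace (𝓡 m) x)]
    [IsRiemannianManifold (𝓡 m) M] [MeasurableSpace M] [BorelSpace M]

/-- Failure of the linear estimate yields maps without good liftings whose rescaled energies are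
small. -/
lemma exists_rescaled_of_forall_not {s p : ℝ}
    {P : ℝ → (EuclideanSpace ℝ (Fin m) → Circle) → Prop}
    {F : (EuclideanSpace ℝ (Fin m) → Circle) → ℝ≥0∞}
    (hP : ∀ {c C : ℝ} {u}, c ≤ C → P C u → P c u)
    (hneg : ∀ C : ℝ, 0 < C → ∃ u, F u ≠ 0 ∧ F u ≠ ⊤ ∧
      (s * p < m ∨ F u ≤ ENNReal.ofReal (1 / C)) ∧ P C u)
    (n : ℕ) {α : ℝ} (hα : 0 < α) :
    ∃ u a, F u ≠ 0 ∧ F u ≠ ⊤ ∧ 0 < a ∧ a ≤ α ∧ a ^ (m - s * p) * (F u).toReal ≤ 2⁻¹ ^ n ∧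
      P (2 ^ n) u := by
  have h2n : (0 : ℝ) < 2 ^ n := by positivity
  -- Below the critical exponent, shrinking reduces the energy, so a small scale suffices. Otherwise
  -- shrinking does not help, the scale is kept at `α`, and the estimate is negated with a `C` so
  -- large that the smallness assumption compensates for `α ^ (m - s p)`.
  rcases lt_or_ge (s * p) m with hσ | hσ
  · obtain ⟨u, h0, ht, -, hu⟩ := hneg (2 ^ n) h2n
    have he : 0 < (F u).toReal := ENNReal.toReal_pos h0 ht
    have hd : 0 < m - s * p := by linarith
    set a := (2⁻¹ ^ n / (F u).toReal) ^ (m - s * p)⁻¹ with ha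
    have ha0 : 0 < a := by positivity
    refine ⟨u, min α a, h0, ht, lt_min hα ha0, min_le_left _ _, ?_, hu⟩
    calc min α a ^ (m - s * p) * (F u).toReal ≤ a ^ (m - s * p) * (F u).toReal := by
          gcongr
          exact min_le_right _ _
      _ = 2⁻¹ ^ n := by
          rw [ha, Real.rpow_inv_rpow (by positivity) hd.ne', div_mul_cancel₀ _ he.ne']
  · set C := 2 ^ n * max 1 (α ^ (m - s * p)) with hC
    have hC0 : 0 < C := by positivity
    obtain ⟨u, h0, ht, hle, hu⟩ := hneg C hC0
    refine ⟨u, α, h0, ht, hα, le_rfl, ?_, hP (le_mul_of_one_le_right h2n.le (le_max_left _ _)) hu⟩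
    have h1 : (F u).toReal ≤ 1 / C :=
      ENNReal.toReal_le_of_le_ofReal (by positivity) (hle.resolve_left hσ.not_gt)
    have h2 : 2 ^ n * α ^ (m - s * p) ≤ C := by
      rw [hC]
      gcongr
      exact le_max_right _ _
    have h3 : 0 < α ^ (m - s * p) := by positivity
    calc α ^ (m - s * p) * (F u).toReal ≤ α ^ (m - s * p) * (1 / C) := by gcongr
      _ ≤ 2⁻¹ ^ n := by
          rw [mul_one_div, div_le_iff₀ hC0, inv_pow, ← div_eq_inv_mul, le_div_iff₀ h2n]
          linarith

/-- The linear estimate for liftings of maps of fractional regularity with positive energy. -/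
lemma exists_linear_lifting_estimate (hm : 1 ≤ m) (Γ : LipschitzChart m M)
    (hM : CompactSpace M ∨
      ∃ Φ : M ≃ₘ⟮𝓡 m, 𝓡 m⟯ EuclideanSpace ℝ (Fin m), Isometry Φ)
    {s p : ℝ} (hs₀ : 0 < s) (hs₁ : s < 1) (hp : 1 ≤ p)
    (hlift : ∀ u : M → Circle, MemCircleSobolev m s p u →
      ∃ φ₁ φ₂ : M → ℝ, MemRealSobolev m s p φ₁ ∧ MemRealSobolev m 1 (s * p) φ₂ ∧
        ∀ᵐ x ∂(μHE[m] : Measure M), u x = Circle.exp (φ₁ x + φ₂ x)) :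
    ∃ C : ℝ, 0 < C ∧ ∀ u : EuclideanSpace ℝ (Fin m) → Circle, Measurable u →
      gagliardoEnergy edist m s p (volume.restrict (ball 0 1)) u ≠ 0 →
      gagliardoEnergy edist m s p (volume.restrict (ball 0 1)) u ≠ ⊤ →
      (s * p < m ∨ gagliardoEnergy edist m s p (volume.restrict (ball 0 1)) u ≤
        ENNReal.ofReal (1 / C)) →
      ∃ φ₁ φ₂ : EuclideanSpace ℝ (Fin m) → ℝ,
        MemRealSobolevOn (ball 0 1) s p φ₁ ∧ MemRealSobolevOn (ball 0 1) 1 (s * p) φ₂ ∧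
        (∀ᵐ x ∂volume.restrict (ball 0 1), u x = Circle.exp (φ₁ x + φ₂ x)) ∧
        realEnergyOn (ball 0 1) s p φ₁ + realEnergyOn (ball 0 1) 1 (s * p) φ₂ ≤
          ENNReal.ofReal C * gagliardoEnergy edist m s p (volume.restrict (ball 0 1)) u := by
  by_contra hcon
  have hσ : 0 < s * p := mul_pos hs₀ (by linarith)
  set F : (EuclideanSpace ℝ (Fin m) → Circle) → ℝ≥0∞ :=
    gagliardoEnergy edist m s p (volume.restrict (ball 0 1)) with hF
  -- Every lifting of `u` costs at least `C F(u)`; this includes maps without any lifting, and only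
  -- becomes weaker as `C` decreases.
  set P : ℝ → (EuclideanSpace ℝ (Fin m) → Circle) → Prop := fun C u => Measurable u ∧
    ∀ φ₁ φ₂ : EuclideanSpace ℝ (Fin m) → ℝ,
      MemRealSobolevOn (ball 0 1) s p φ₁ → MemRealSobolevOn (ball 0 1) 1 (s * p) φ₂ →
      (∀ᵐ x ∂volume.restrict (ball 0 1), u x = Circle.exp (φ₁ x + φ₂ x)) →
      ENNReal.ofReal C * F u ≤
        realEnergyOn (ball 0 1) s p φ₁ + realEnergyOn (ball 0 1) 1 (s * p) φ₂ with hPdef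
  have hP : ∀ {c C : ℝ} {u}, c ≤ C → P C u → P c u := fun hcC h =>
    ⟨h.1, fun φ₁ φ₂ h₁ h₂ h₃ =>
      (mul_le_mul' (ENNReal.ofReal_le_ofReal hcC) le_rfl).trans (h.2 φ₁ φ₂ h₁ h₂ h₃)⟩
  have hneg : ∀ C : ℝ, 0 < C → ∃ u, F u ≠ 0 ∧ F u ≠ ⊤ ∧
      (s * p < m ∨ F u ≤ ENNReal.ofReal (1 / C)) ∧ P C u := fun C hC => by
    by_contra hno
    refine hcon ⟨C, hC, fun u hu h0 ht hsm => ?_⟩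
    by_contra hno'
    refine hno ⟨u, h0, ht, hsm, hu, fun φ₁ φ₂ h₁ h₂ h₃ => ?_⟩
    by_contra hlt
    exact hno' ⟨φ₁, φ₂, h₁, h₂, h₃, (not_le.1 hlt).le⟩
  have hm' : (1 : ℝ) ≤ m := by exact_mod_cast hm
  have hR : 0 < Γ.ρ / 2 := half_pos Γ.ρ_pos
  choose u a h0 ht ha haα hsmall hu using fun n =>
    exists_rescaled_of_forall_not (m := m) (s := s) (p := p)
      (P := P) (F := F) hP hneg n (α := Γ.ρ / 2 * 2⁻¹ ^ n / (96 * m)) (by positivity)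
  -- The number of copies brings the energy of generation `n` between `2⁻¹ ^ n` and `2 ^ (s p) * 2⁻¹
  -- ^ n`. The upper bound makes the total energy finite, the lower bound gives the contradiction;
  -- positivity of the energy is needed here.
  choose N hN hNb using fun n => exists_nat_rpow_mul_mem_Icc hσ (mul_pos
    (Real.rpow_pos_of_pos (ha n) (m - s * p)) (ENNReal.toReal_pos (h0 n) (ht n))) (hsmall n)
  obtain ⟨c, hd, hsub⟩ := exists_disjoint_balls hm Γ.center hN ha haα
  have hN0 : ∀ n, (0 : ℝ) < N n := fun n => by exact_mod_cast hN n
  have hsum : ∑' i : Σ n, Fin m → Fin (N n),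
      ENNReal.ofReal (a i.1 / N i.1) ^ (m - s * p) * F (u i.1) < ⊤ := by
    have h1 := tsum_sigma_grid (m := m) (σ := s * p) hN ha ht 1
    simp only [Pi.one_apply, one_mul] at h1
    rw [h1]
    refine (ENNReal.tsum_le_tsum fun n => ENNReal.ofReal_le_ofReal (hNb n).2).trans_lt ?_
    rw [← ENNReal.ofReal_tsum_of_nonneg (fun n => by positivity)
      ((summable_geometric_of_lt_one (by norm_num) (by norm_num)).mul_left _)]
    exact ENNReal.ofReal_lt_top
  obtain ⟨φ₁, φ₂, hφ, hfin⟩ := Γ.exists_lifting_of_packing hM hs₀ hs₁ hp hlift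
    (r := fun i : Σ n, Fin m → Fin (N n) => a i.1 / N i.1) (fun i => div_pos (ha _) (hN0 _)) hd hsub
    (u := fun i => u i.1) (fun i => (hu i.1).1) hsum
  have hlow := tsum_sigma_grid (m := m) (σ := s * p) hN ha ht fun n => ENNReal.ofReal (2 ^ n)
  -- Each copy costs at least `2 ^ n` times its energy, so every generation contributes at least one
  -- to a sum known to be finite.
  refine (lt_top_iff_ne_top.1 ((ENNReal.tsum_le_tsum fun i => mul_le_mul' le_rfl
    ((hu i.1).2 _ _ (hφ i).1 (hφ i).2.1 (hφ i).2.2)).trans_lt hfin)) ?_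
  rw [hlow, eq_top_iff, ← ENNReal.tsum_const_eq_top_of_ne_zero (α := ℕ) one_ne_zero]
  refine ENNReal.tsum_le_tsum fun n => ?_
  rw [← ENNReal.ofReal_mul (by positivity), ENNReal.one_le_ofReal]
  calc (1 : ℝ) = 2 ^ n * 2⁻¹ ^ n := by rw [← mul_pow]; norm_num
    _ ≤ _ := by
      gcongr
      exact (hNb n).1

/-- For some fixed `x` the integrand vanishes at almost every `y`. Since distances are finite, this
means `u y = u x`. It covers the maps excluded from the contradiction argument. -/
lemma exists_ae_eq_const_of_gagliardoEnergy_eq_zero {s p : ℝ} (hp : 0 < p)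
    {u : EuclideanSpace ℝ (Fin m) → Circle} (hu : Measurable u)
    (h : gagliardoEnergy edist m s p (volume.restrict (ball 0 1)) u = 0) :
    ∃ z, ∀ᵐ x ∂volume.restrict (ball (0 : EuclideanSpace ℝ (Fin m)) 1), u x = z := by
  have hm := measurable_gagliardo_integrand (s := s) (p := p) m hu
  have hm' : Measurable fun x => ∫⁻ y in ball (0 : EuclideanSpace ℝ (Fin m)) 1,
    edist (u x) (u y) ^ p / edist x y ^ ((m : ℝ) + s * p) := hm.lintegral_prod_right'
  rw [gagliardoEnergy, lintegral_eq_zero_iff hm'] at h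
  have : NeBot (ae (volume.restrict (ball (0 : EuclideanSpace ℝ (Fin m)) 1))) :=
    ae_restrict_neBot.2 (measure_ball_pos _ _ one_pos).ne'
  obtain ⟨x, hx⟩ := h.exists
  refine ⟨u x, ?_⟩
  rw [Pi.zero_apply, lintegral_eq_zero_iff hm.of_uncurry_left] at hx
  filter_upwards [hx] with y hy
  rw [Pi.zero_apply, ENNReal.div_eq_zero_iff] at hy
  by_contra hne
  rcases hy with hy | hy
  · rw [ENNReal.rpow_eq_zero_iff_of_pos hp, edist_eq_zero] at hy
    exact hne hy.symm
  · rcases ENNReal.rpow_eq_top_iff.1 hy with ⟨h1, -⟩ | ⟨h1, -⟩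
    · rw [edist_eq_zero] at h1
      exact hne (by rw [h1])
    · exact edist_ne_top _ _ h1

/-- The main theorem for maps of fractional regularity. -/
lemma exists_lifting_of_lt_one (hm : 1 ≤ m) (Γ : LipschitzChart m M)
    (hM : CompactSpace M ∨
      ∃ Φ : M ≃ₘ⟮𝓡 m, 𝓡 m⟯ EuclideanSpace ℝ (Fin m), Isometry Φ)
    {s p : ℝ} (hs₀ : 0 < s) (hs₁ : s < 1) (hp : 1 ≤ p)
    (hlift : ∀ u : M → Circle, MemCircleSobolev m s p u →
      ∃ φ₁ φ₂ : M → ℝ, MemRealSobolev m s p φ₁ ∧ MemRealSobolev m 1 (s * p) φ₂ ∧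
        ∀ᵐ x ∂(μHE[m] : Measure M), u x = Circle.exp (φ₁ x + φ₂ x)) :
    ∃ C : ℝ, 0 < C ∧ ∀ u : EuclideanSpace ℝ (Fin m) → Circle,
      MemCircleSobolevOn (ball 0 1) s p u →
      (s * p < m ∨ circleEnergyOn (ball 0 1) s p u ≤ ENNReal.ofReal (1 / C)) →
      ∃ φ₁ φ₂ : EuclideanSpace ℝ (Fin m) → ℝ,
        MemRealSobolevOn (ball 0 1) s p φ₁ ∧ MemRealSobolevOn (ball 0 1) 1 (s * p) φ₂ ∧
        (∀ x ∈ ball (0 : EuclideanSpace ℝ (Fin m)) 1, u x = Circle.exp (φ₁ x + φ₂ x)) ∧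
        realEnergyOn (ball 0 1) s p φ₁ + realEnergyOn (ball 0 1) 1 (s * p) φ₂ ≤
          ENNReal.ofReal C * circleEnergyOn (ball 0 1) s p u := by
  have hp0 : 0 < p := by linarith
  obtain ⟨C, hC, h⟩ := exists_linear_lifting_estimate hm Γ hM hs₀ hs₁ hp hlift
  refine ⟨C, hC, fun u hu hsm => ?_⟩
  have hum := aemeasurable_of_coe_circle hu.1
  set v := hum.mk u with hv
  have huv : u =ᵐ[volume.restrict (ball 0 1)] v := hum.ae_eq_mk
  set E := gagliardoEnergy edist m s p (volume.restrict (ball 0 1)) v with hE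
  -- The chordal energy is the smaller one, so both the smallness assumption and the final estimate
  -- pass to the geodesic energy with the same `C`.
  have hle : E ≤ circleEnergyOn (ball 0 1) s p u := by
    rw [hE, ← gagliardoEnergy_congr huv, circleEnergyOn, if_neg hs₁.ne]
    simpa using gagliardoEnergy_mono_dist hp0.le (c := 1) ENNReal.one_ne_top
      (fun a b => by simpa using edist_le_circleDist a b) u
  have key : ∃ φ₁ φ₂ : EuclideanSpace ℝ (Fin m) → ℝ,
      MemRealSobolevOn (ball 0 1) s p φ₁ ∧ MemRealSobolevOn (ball 0 1) 1 (s * p) φ₂ ∧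
      (∀ᵐ x ∂volume.restrict (ball 0 1), v x = Circle.exp (φ₁ x + φ₂ x)) ∧
      realEnergyOn (ball 0 1) s p φ₁ + realEnergyOn (ball 0 1) 1 (s * p) φ₂ ≤
        ENNReal.ofReal C * E := by
    by_cases h0 : E = 0
    · obtain ⟨z, hz⟩ := exists_ae_eq_const_of_gagliardoEnergy_eq_zero hp0 hum.measurable_mk h0
      have h1 : realEnergyOn (ball (0 : EuclideanSpace ℝ (Fin m)) 1) s p
          (fun _ => Complex.arg z) = 0 := by
        simp [realEnergyOn, hs₁.ne, gagliardoEnergy, hp0]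
      have h2 : realEnergyOn (ball (0 : EuclideanSpace ℝ (Fin m)) 1) 1 (s * p)
          (fun _ => (0 : ℝ)) = 0 := by
        rw [realEnergyOn, if_pos rfl, dirichletEnergyOn_const isOpen_ball (mul_pos hs₀ hp0)]
      refine ⟨_, _, ⟨aemeasurable_const, by rw [h1]; simp⟩, ⟨aemeasurable_const, by rw [h2]; simp⟩,
        ?_, by rw [h1, h2, add_zero]; exact zero_le⟩
      filter_upwards [hz] with x hx
      rw [add_zero, Circle.exp_arg]
      exact hx
    · exact h v hum.measurable_mk h0 (hle.trans_lt hu.2).ne (hsm.imp_right hle.trans)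
  obtain ⟨φ₁, φ₂, h₁, h₂, h₃, h₄⟩ := key
  -- Changing `φ₁` on a null set makes the lifting valid at every point without affecting the
  -- energies.
  obtain ⟨φ, hφ, hall⟩ := exists_ae_eq_forall_eq_exp (u := u) (φ₁ := φ₁) (φ₂ := φ₂)
    (by filter_upwards [huv, h₃] with x hx hx' using hx.trans hx')
  refine ⟨φ, φ₂, ⟨h₁.1.congr hφ.symm, ?_⟩, h₂, fun x _ => hall x, ?_⟩
  · rw [realEnergyOn_congr_ae hφ]
    exact h₁.2
  · rw [realEnergyOn_congr_ae hφ]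
    exact h₄.trans (mul_le_mul' le_rfl hle)

end Quantitative

end WeakLifting

end

theorem mainTheorem10 (m : ℕ) (hm : 1 ≤ m) (s p : ℝ) (hs₀ : 0 < s) (hs₁ : s ≤ 1) (hp : 1 ≤ p)
    {M : Type*} [Nonempty M] [EMetricSpace M] [MeasurableSpace M] [BorelSpace M]
    [ChartedSpace (EuclideanSpace ℝ (Fin m)) M] [IsManifold (𝓡 m) ∞ M]
    [RiemannianBundle (fun x : M => TangentSpace (𝓡 m) x)]
    [IsContMDiffRiemannianBundle (𝓡 m) ∞ (EuclideanSpace ℝ (Fin m))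
      (fun x : M => TangentSpace (𝓡 m) x)]
    [IsRiemannianManifold (𝓡 m) M]
    (hM : CompactSpace M ∨
      ∃ Φ : M ≃ₘ⟮𝓡 m, 𝓡 m⟯ EuclideanSpace ℝ (Fin m), Isometry Φ)
    (hlift : ∀ u : M → Circle, WeakLifting.MemCircleSobolev m s p u →
      ∃ φ₁ φ₂ : M → ℝ, WeakLifting.MemRealSobolev m s p φ₁ ∧
        WeakLifting.MemRealSobolev m 1 (s * p) φ₂ ∧
        ∀ᵐ x ∂(μHE[m] : Measure M), u x = Circle.exp (φ₁ x + φ₂ x)) :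
    ∃ C : ℝ, 0 < C ∧
      ∀ u : EuclideanSpace ℝ (Fin m) → Circle,
        WeakLifting.MemCircleSobolevOn (Metric.ball 0 1) s p u →
        (s * p < m ∨
          WeakLifting.circleEnergyOn (Metric.ball 0 1) s p u ≤ ENNReal.ofReal (1 / C)) →
        ∃ φ₁ φ₂ : EuclideanSpace ℝ (Fin m) → ℝ,
          WeakLifting.MemRealSobolevOn (Metric.ball 0 1) s p φ₁ ∧
          WeakLifting.MemRealSobolevOn (Metric.ball 0 1) 1 (s * p) φ₂ ∧
          (∀ x ∈ Metric.ball (0 : EuclideanSpace ℝ (Fin m)) 1,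
            u x = Circle.exp (φ₁ x + φ₂ x)) ∧
          WeakLifting.realEnergyOn (Metric.ball 0 1) s p φ₁ +
              WeakLifting.realEnergyOn (Metric.ball 0 1) 1 (s * p) φ₂ ≤
            ENNReal.ofReal C * WeakLifting.circleEnergyOn (Metric.ball 0 1) s p u := by
  obtain ⟨Γ⟩ := WeakLifting.nonempty_lipschitzChart m M
  rcases hs₁.lt_or_eq with h | rfl
  · exact WeakLifting.exists_lifting_of_lt_one hm Γ hM hs₀ h hp hlift
  · exact ⟨1, one_pos, fun u hu _ =>
      WeakLifting.exists_lifting_order_one Γ (by linarith) hlift hu⟩
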